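/- **Networks.** A neural network $\Phi=((A_1,b_1,\varrho_1),\dots,(A_L,b_L,\varrho_L))$ with layer dimensions $N_0,\dots,N_L\ge 1$ consists of matrices $A_\ell\in\mathbb R^{N_\ell\times N_{\ell-1}}$, vectors $b_\ell\in\mathbb R^{N_\ell}$ and, for $\ell<L$, lists $\varrho_\ell$ of $N_\ell$ activation functions $\mathbb R\to\mathbb R$, while $\varrho_L=\mathrm{Id}$. Its realization is $\mathrm R(\Phi)(x)=x_L$, where $x_0=x$ and $x_\ell=\varrho_\ell(A_\ell x_{\ell-1}+b_\ell)$ componentwise; its depth is $L(\Phi)=L$, its size $M(\Phi)$ is the total number of nonzero entries of all $A_\ell,b_\ell$, and the layers $1,\dots,L-1$ are its hidden layers. "With ReLU and BiSU activations" means that every activation in the hidden layers is $\rho(x)=\max\{0,x\}$ or $\sigma(x)=\mathbb 1_{x>0}$. **Meshes.** Let $d\ge2$, let $\Omega\subset\mathbb R^d$ be a bounded polytopal domain, i.e. the nonempty interior of a finite union of closed nondegenerate $d$-simplices (connectedness is not needed), and let $\mathcal T$ be a regular simplicial partition of $\Omega$: a finite set of pairwise disjoint open $d$-simplices such that $\overline\Omega=\bigcup_{T\in\mathcal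 T}\overline T$ and, for $T\ne T'$, $\overline T\cap\overline{T'}$ is empty or a common closed subsimplex. Let $\mathcal V,\mathcal E,\mathcal F$ be the sets of vertices, edges ($1$-subsimplices) and faces ($(d-1)$-subsimplices) of $\mathcal T$, all edges and faces being open simplices. For $i\in\mathcal V\cup\mathcal E\cup\mathcal F\cup\mathcal T$ let $s(i)$ be the number of elements of $\mathcal T$ of which $i$ is a subsimplex (so $s(T)=1$ for $T\in\mathcal T$), and put $\mathfrak s(\mathcal I)=\max_{i\in\mathcal I}s(i)$. **Spaces** (of functions modulo equality a.e. in $\Omega$). * $S_1=\{v\in H^1(\Omega): v|_T\in\mathbb P_1\ \forall T\in\mathcal T\}$, with $\mathcal I=\mathcal V$. * $S_0=\{v\in L^2(\Omega): v|_T\text{ is constant}\ \forall T\in\mathcal T\}$, with $\mathcal I=\mathcal T$. * $RT_0=\{v\in L^1(\Omega)^d: v|_T\in(\mathbb P_0)^d\oplus x\mathbb P_0\ \forall T\in\mathcal T,\ [v\cdot n_f]_f=0\ \forall f\in\mathcal F, f\subset\Omega\}$, with $\mathcal I=\mathcal F$. * For $d\in\{2,3\}$: $N_0=\{v\in L^1(\Omega)^d: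 v|_T\in\mathbb{NE}_0\ \forall T\in\mathcal T,\ [v\times n_f]_f=0\ \forall f\in\mathcal F, f\subset\Omega\}$, with $\mathcal I=\mathcal E$, where $\mathbb{NE}_0=(\mathbb P_0)^2\oplus\mathbb P_0(-x_2,x_1)$ for $d=2$ and $\mathbb{NE}_0=(\mathbb P_0)^3\oplus x\times(\mathbb P_0)^3$ for $d=3$. Here $n_f$ is a unit normal to $f$ and $[\cdot]_f(x_0)$, $x_0\in f$, denotes the jump across $f$, i.e. the limit as $\epsilon\searrow0$ of the difference of the values at $x_0+\epsilon n_f$ and $x_0-\epsilon n_f$. **Shape functions.** * $\theta_p^{S_1}$ is the continuous function on $\overline\Omega$, affine on each element, with $\theta_p^{S_1}(q)=\delta_{pq}$ for $q\in\mathcal V$; $\theta_T^{S_0}=\mathbb 1_T$. * For $f\in\mathcal F$, choose an order of the (one or two) adjacent elements $T_1$ or $T_1,T_2$, and let $a_i$ be the vertex of $T_i$ not in $\overline f$. Then $\theta_f^{RT_0}(x)=(-1)^{i-1}\frac{|f|}{d|T_i|}(x-a_i)$ on $T_i$, and $0$ on the other elements. * For $d=2$, $\theta_f^{N_0}$ is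 $\theta_f^{RT_0}$ rotated by $(y_1,y_2)\mapsto(-y_2,y_1)$. For $d=3$ and $e\in\mathcal E$, choose a unit tangent $t_e$; on each element $T$ adjacent to $e$, with $\tilde e$ the edge of $T$ having no vertex in common with $e$, $t_{\tilde e}$ a unit tangent to it and $m$ denoting midpoints, $$\theta_e^{N_0}(x)=\frac{(x-m_{\tilde e})\times t_{\tilde e}}{t_e\cdot[(m_e-m_{\tilde e})\times t_{\tilde e}]},$$ and $\theta_e^{N_0}=0$ on the other elements. **Proposition.** There is an absolute constant $C>0$, independent of $d$, $\Omega$ and $\mathcal T$, such that the following holds for all $d\ge2$, $\Omega$, $\mathcal T$ as above, all choices in the definition of the shape functions, and every $\blacklozenge\in\{S_1,N_0,RT_0,S_0\}$ ($N_0$ only if $d\le3$). In the cases $\blacklozenge=S_1$, and $\blacklozenge=N_0$ with $d=3$, assume in addition that $\Omega$ does not touch itself along its boundary: every neighbourhood $U$ of a point $x\in\overline\Omega$ contains a neighbourhood $V$ of $x$ such that $V\cap\Omega$ is connected (every Lipschitz domain has this property). Let $m=1$ for $S_1,S_0$ and $m=d$ for $N_0,RT_0$, and let $L=5$ for $S_1,N_0,RT_0$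 and $L=3$ for $S_0$. 1. $\{\theta_i^\blacklozenge\}_{i\in\mathcal I}$ is a basis of $\blacklozenge(\mathcal T,\Omega)$; in particular $|\mathcal I|=\dim\blacklozenge(\mathcal T,\Omega)$. 2. There is a network $\Phi^\blacklozenge$ with ReLU and BiSU activations, input dimension $d$ and $|\mathcal I|\,m$ outputs, such that $\mathrm R(\Phi^\blacklozenge)(x)_i=\theta^\blacklozenge_i(x)\in\mathbb R^m$ for a.e. $x\in\Omega$ and all $i\in\mathcal I$, $L(\Phi^\blacklozenge)=L$, and $$M(\Phi^\blacklozenge)\le Cd^2\sum_{i\in\mathcal I}s(i)\le Cd^2\,\mathfrak s(\mathcal I)\dim\blacklozenge(\mathcal T,\Omega).$$ 3. For every $v\in\blacklozenge(\mathcal T,\Omega)$ there is a network $\Phi^{\blacklozenge,v}$ with ReLU and BiSU activations such that $\mathrm R(\Phi^{\blacklozenge,v})(x)=v(x)$ for a.e. $x\in\Omega$, $L(\Phi^{\blacklozenge,v})=L$, and $M(\Phi^{\blacklozenge,v})$ satisfies the same bounds. The hidden layers of $\Phi^{\blacklozenge,v}$ coincide with those of $\Phi^\blacklozenge$; in particular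 they do not depend on $v$. 4. The layer dimensions and the lists of activation functions of $\Phi^\blacklozenge$ and $\Phi^{\blacklozenge,v}$ are determined by $\blacklozenge$, $d$ and the family $\{s(i)\}_{i\in\mathcal I}$ (which determines $|\mathcal I|$). 5. The set $\mathcal{NN}=\{\Phi^{\blacklozenge,v}:v\in\blacklozenge(\mathcal T,\Omega)\}$, with the linear operations $\Phi^{\blacklozenge,v}\,\widehat+\,\lambda\Phi^{\blacklozenge,w}:=\Phi^{\blacklozenge,v+\lambda w}$, is a vector space, and $\mathrm R:\mathcal{NN}\to\blacklozenge(\mathcal T,\Omega)$ is a linear isomorphism. -/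

import Mathlib

open MeasureTheory Filter Topology
open scoped ContDiff Matrix

noncomputable section

namespace FEMNet

/-! ### Neural networks -/

/-- The ReLU activation. -/
def relu (x : ℝ) : ℝ := max 0 x

open Classical in
/-- The BiSU (Heaviside) activation. -/
def bisu (x : ℝ) : ℝ := if x ≤ 0 then 0 else 1

/-- The hidden layers `(A₁, b₁, ϱ₁), …, (A_{L-1}, b_{L-1}, ϱ_{L-1})` of a network with input
dimension `n`; the second index is the dimension of the last hidden layer
(or `n` if there is no hidden layer). -/
inductive HiddenLayers : ℕ → ℕ → Type
  | nil (n : ℕ) : HiddenLayers n n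
  | cons {n k m : ℕ} (hk : 0 < k) (A : Matrix (Fin k) (Fin n) ℝ) (b : Fin k → ℝ)
      (ϱ : Fin k → ℝ → ℝ) (rest : HiddenLayers k m) : HiddenLayers n m

namespace HiddenLayers

/-- Number of hidden layers. -/
def length : {n m : ℕ} → HiddenLayers n m → ℕ
  | _, _, nil _ => 0
  | _, _, cons _ _ _ _ rest => rest.length + 1

/-- Number of nonzero weights and biases in the hidden layers. -/
def size : {n m : ℕ} → HiddenLayers n m → ℕ
  | _, _, nil _ => 0
  | _, _, cons _ A b _ rest =>
      Set.ncard {p : Fin _ × Fin _ | A p.1 p.2 ≠ 0} + Set.ncard {j | b j ≠ 0} + rest.size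

/-- The map `x ↦ x_{L-1}`, where `x_ℓ = ϱ_ℓ (A_ℓ x_{ℓ-1} + b_ℓ)` componentwise. -/
def realize : {n m : ℕ} → HiddenLayers n m → (Fin n → ℝ) → (Fin m → ℝ)
  | _, _, nil _, x => x
  | _, _, cons _ A b ϱ rest, x => rest.realize (fun j => ϱ j ((A *ᵥ x) j + b j))

/-- The lists `ϱ₁, …, ϱ_{L-1}` of activation functions; the length of the `ℓ`-th list is the
dimension `N_ℓ` of layer `ℓ`. -/
def activations : {n m : ℕ} → HiddenLayers n m → List (List (ℝ → ℝ))
  | _, _, nil _ => []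
  | _, _, cons _ _ _ ϱ rest => List.ofFn ϱ :: rest.activations

end HiddenLayers

/-- A feedforward neural network with input dimension `n` and outputs indexed by `κ`:
hidden layers, followed by an affine output layer without activation. -/
structure Network (n : ℕ) (κ : Type) where
  lastWidth : ℕ
  hidden : HiddenLayers n lastWidth
  A : Matrix κ (Fin lastWidth) ℝ
  b : κ → ℝ

namespace Network

variable {n : ℕ} {κ : Type}

/-- The number `L` of layers. -/
def depth (Φ : Network n κ) : ℕ := Φ.hidden.length + 1

/-- The number of nonzero weights and biases. -/
def size (Φ : Network n κ) : ℕ :=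
  Φ.hidden.size + (Set.ncard {p : κ × Fin Φ.lastWidth | Φ.A p.1 p.2 ≠ 0} +
    Set.ncard {j : κ | Φ.b j ≠ 0})

/-- The realization of the network as a map. -/
def realize (Φ : Network n κ) (x : Fin n → ℝ) : κ → ℝ :=
  fun j => (Φ.A *ᵥ Φ.hidden.realize x) j + Φ.b j

/-- The hidden layers, together with the dimension of the last one. -/
def hiddenLayers (Φ : Network n κ) : Σ m : ℕ, HiddenLayers n m := ⟨Φ.lastWidth, Φ.hidden⟩

/-- The activation lists of the hidden layers (their lengths are the hidden layer dimensions). -/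
def activations (Φ : Network n κ) : List (List (ℝ → ℝ)) := Φ.hidden.activations

/-- All activations are ReLU or BiSU. -/
def IsReLUBiSU (Φ : Network n κ) : Prop :=
  ∀ l ∈ Φ.activations, ∀ a ∈ l, a = relu ∨ a = bisu

end Network

/-! ### Polytopal domains and regular simplicial partitions -/

/-- Euclidean space `ℝ^d`. -/
abbrev E (d : ℕ) : Type := EuclideanSpace ℝ (Fin d)

variable {d : ℕ}

/-- The open convex hull of a finite set of points. A simplex is represented by its finite set of
vertices; the open simplex is the `openHull`, the closed simplex is the `convexHull`. -/
def openHull (s : Finset (E d)) : Set (E d) :=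
  {x | ∃ w : E d → ℝ, (∀ y ∈ s, 0 < w y) ∧ ∑ y ∈ s, w y = 1 ∧ ∑ y ∈ s, w y • y = x}

/-- `s` is the vertex set of a (nondegenerate) `d`-simplex in `ℝ^d`. -/
def IsFullSimplex (s : Finset (E d)) : Prop :=
  s.card = d + 1 ∧ AffineIndependent ℝ ((↑) : s → E d)

/-- Bounded polytopal domain: a nonempty set which is the interior of a finite union of closed
`d`-simplices. (Connectedness is not required.) -/
def IsPolytopalDomain (Ω : Set (E d)) : Prop :=
  Ω.Nonempty ∧ ∃ P : Finset (Finset (E d)), (∀ s ∈ P, IsFullSimplex s) ∧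
    Ω = interior (⋃ s ∈ P, convexHull ℝ (s : Set (E d)))

/-- `Ω` does not touch itself along its boundary: near each point of `closure Ω`, the set `Ω` has
only one connected piece. Lipschitz domains have this property. -/
def LocallyConnectedUpToBoundary (Ω : Set (E d)) : Prop :=
  ∀ x ∈ closure Ω, ∀ U ∈ 𝓝 x, ∃ V ∈ 𝓝 x, V ⊆ U ∧ IsPreconnected (V ∩ Ω)

open Classical in
/-- A regular simplicial partition of `Ω`. -/
structure SimplicialMesh (Ω : Set (E d)) where
  /-- the vertex sets of the elements -/
  cells : Finset (Finset (E d))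
  isFullSimplex : ∀ t ∈ cells, IsFullSimplex t
  cover : closure Ω = ⋃ t ∈ cells, convexHull ℝ (t : Set (E d))
  disjoint : ∀ s ∈ cells, ∀ t ∈ cells, s ≠ t → Disjoint (openHull s) (openHull t)
  /-- two closed elements meet in a (possibly empty) common subsimplex -/
  regular : ∀ s ∈ cells, ∀ t ∈ cells, s ≠ t →
    convexHull ℝ (s : Set (E d)) ∩ convexHull ℝ (t : Set (E d)) ⊆
      convexHull ℝ ((s ∩ t : Finset (E d)) : Set (E d))

namespace SimplicialMesh

variable {Ω : Set (E d)}

open Classical in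
/-- The subsimplices with `j` vertices: vertices of the mesh for `j = 1`, edges for `j = 2`,
faces for `j = d`, elements for `j = d + 1`. -/
def subsimplices (M : SimplicialMesh Ω) (j : ℕ) : Finset (Finset (E d)) :=
  M.cells.biUnion (fun t => t.powersetCard j)

open Classical in
/-- The elements adjacent to the subsimplex `i`. -/
def star (M : SimplicialMesh Ω) (i : Finset (E d)) : Finset (Finset (E d)) :=
  M.cells.filter (fun t => i ⊆ t)

/-- The number `s(i)` of elements adjacent to the subsimplex `i`. -/
def adj (M : SimplicialMesh Ω) (i : Finset (E d)) : ℕ := (M.star i).card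

/-- The choices on which the shape functions depend: for each face `f` the adjacent element that
is called `T₁`, for each edge a unit tangent vector. -/
structure Orientation (M : SimplicialMesh Ω) where
  first : Finset (E d) → Finset (E d)
  first_mem : ∀ f ∈ M.subsimplices d, first f ∈ M.star f
  tangent : Finset (E d) → E d
  norm_tangent : ∀ e ∈ M.subsimplices 2, ‖tangent e‖ = 1
  tangent_mem : ∀ e ∈ M.subsimplices 2, tangent e ∈ vectorSpan ℝ (e : Set (E d))

end SimplicialMesh

/-! ### Finite element spaces -/

/-- `g` is the `j`-th weak partial derivative of `v` in `Ω`. -/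
def HasWeakPartial (Ω : Set (E d)) (j : Fin d) (v g : E d → ℝ) : Prop :=
  ∀ φ : E d → ℝ, ContDiff ℝ ∞ φ → HasCompactSupport φ → tsupport φ ⊆ Ω →
    ∫ x in Ω, v x * fderiv ℝ φ x (EuclideanSpace.single j 1) = -∫ x in Ω, g x * φ x

/-- `v ∈ H¹(Ω)`. -/
def InH1 (Ω : Set (E d)) (v : E d → ℝ) : Prop :=
  MemLp v 2 (volume.restrict Ω) ∧
    ∀ j : Fin d, ∃ g : E d → ℝ, MemLp g 2 (volume.restrict Ω) ∧ HasWeakPartial Ω j v g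

theorem integrable_mul_testFunction {Ω : Set (E d)} {v φ : E d → ℝ}
    (hv : MemLp v 2 (volume.restrict Ω)) (hφ : Continuous φ) (hc : HasCompactSupport φ) :
    Integrable (fun x => v x * φ x) (volume.restrict Ω) :=
  hv.integrable_mul (hφ.memLp_of_hasCompactSupport (p := 2) hc)

theorem integrable_mul_fderiv {Ω : Set (E d)} {v φ : E d → ℝ} (j : Fin d)
    (hv : MemLp v 2 (volume.restrict Ω)) (hφ : ContDiff ℝ ∞ φ) (hc : HasCompactSupport φ) :
    Integrable (fun x => v x * fderiv ℝ φ x (EuclideanSpace.single j 1)) (volume.restrict Ω) :=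
  integrable_mul_testFunction hv ((hφ.continuous_fderiv (by simp)).clm_apply continuous_const)
    (hc.fderiv_apply ℝ _)

theorem InH1.congr {Ω : Set (E d)} {v w : E d → ℝ} (hv : InH1 Ω v)
    (h : v =ᵐ[volume.restrict Ω] w) : InH1 Ω w := by
  refine ⟨(memLp_congr_ae h).1 hv.1, fun j => ?_⟩
  obtain ⟨g, hg, hvg⟩ := hv.2 j
  refine ⟨g, hg, fun φ h1 h2 h3 => ?_⟩
  rw [← hvg φ h1 h2 h3]
  refine integral_congr_ae ?_
  filter_upwards [h] with x hx
  rw [hx]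

theorem InH1.zero {Ω : Set (E d)} : InH1 Ω (fun _ => (0 : ℝ)) :=
  ⟨MemLp.zero', fun _ => ⟨fun _ => 0, MemLp.zero', fun φ _ _ _ => by simp⟩⟩

theorem InH1.add {Ω : Set (E d)} {v w : E d → ℝ} (hv : InH1 Ω v) (hw : InH1 Ω w) :
    InH1 Ω (fun x => v x + w x) := by
  refine ⟨hv.1.add hw.1, fun j => ?_⟩
  obtain ⟨g, hg, hvg⟩ := hv.2 j
  obtain ⟨k, hk, hwk⟩ := hw.2 j
  refine ⟨fun x => g x + k x, hg.add hk, fun φ h1 h2 h3 => ?_⟩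
  simp only [add_mul]
  rw [integral_add (integrable_mul_fderiv j hv.1 h1 h2) (integrable_mul_fderiv j hw.1 h1 h2),
    integral_add (integrable_mul_testFunction hg h1.continuous h2)
      (integrable_mul_testFunction hk h1.continuous h2), hvg φ h1 h2 h3, hwk φ h1 h2 h3]
  ring

theorem InH1.const_mul {Ω : Set (E d)} {v : E d → ℝ} (r : ℝ) (hv : InH1 Ω v) :
    InH1 Ω (fun x => r * v x) := by
  refine ⟨hv.1.const_mul r, fun j => ?_⟩
  obtain ⟨g, hg, hvg⟩ := hv.2 j
  refine ⟨fun x => r * g x, hg.const_mul r, fun φ h1 h2 h3 => ?_⟩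
  simp only [mul_assoc]
  rw [integral_const_mul, integral_const_mul, hvg φ h1 h2 h3]
  ring

/-- `n` is a unit normal to the face `f`. -/
def IsUnitNormal (f : Finset (E d)) (n : E d) : Prop :=
  ‖n‖ = 1 ∧ ∀ a ∈ f, ∀ b ∈ f, inner ℝ (a - b) n = 0

/-- Classes of measurable functions `Ω → ℝ^m` modulo equality almost everywhere. -/
abbrev FunctionClass (Ω : Set (E d)) (m : ℕ) : Type :=
  E d →ₘ[(volume : Measure (E d)).restrict Ω] E m

/-- `ℝT₀ = (ℙ₀)^d ⊕ x ℙ₀`. -/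
def rtLocal (d : ℕ) : Submodule ℝ (E d → E d) where
  carrier := {p | ∃ (a : E d) (c : ℝ), ∀ x, p x = a + c • x}
  zero_mem' := ⟨0, 0, fun x => by simp⟩
  add_mem' := by
    rintro p q ⟨a, c, hp⟩ ⟨a', c', hq⟩
    refine ⟨a + a', c + c', fun x => ?_⟩
    simp only [Pi.add_apply, hp, hq, add_smul]
    abel
  smul_mem' := by
    rintro r p ⟨a, c, hp⟩
    exact ⟨r • a, r * c, fun x => by simp [hp, mul_smul]⟩

/-- Rotation by `90` degrees, `x ↦ (-x₂, x₁)`. -/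
def rot (x : E 2) : E 2 := !₂[-(x 1), x 0]

/-- The cross product on `ℝ³`. -/
def cross (x y : E 3) : E 3 := WithLp.toLp 2 (x.ofLp ⨯₃ y.ofLp)

/-- `ℕ𝔼₀`: `(ℙ₀)² ⊕ ℙ₀ (-x₂, x₁)` for `d = 2`, `(ℙ₀)³ ⊕ x × (ℙ₀)³` for `d = 3`
(and `{0}`, a dummy value, for other `d`). -/
def neLocal : (d : ℕ) → Submodule ℝ (E d → E d)
  | 2 =>
    { carrier := {p | ∃ (a : E 2) (c : ℝ), ∀ x, p x = a + c • rot x}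
      zero_mem' := ⟨0, 0, fun x => by simp⟩
      add_mem' := by
        rintro p q ⟨a, c, hp⟩ ⟨a', c', hq⟩
        refine ⟨a + a', c + c', fun x => ?_⟩
        simp only [Pi.add_apply, hp, hq, add_smul]
        abel
      smul_mem' := by
        rintro r p ⟨a, c, hp⟩
        exact ⟨r • a, r * c, fun x => by simp [hp, mul_smul]⟩ }
  | 3 =>
    { carrier := {p | ∃ a b : E 3, ∀ x, p x = a + cross x b}
      zero_mem' := ⟨0, 0, fun x => by simp [cross]⟩
      add_mem' := by
        rintro p q ⟨a, b, hp⟩ ⟨a', b', hq⟩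
        refine ⟨a + a', b + b', fun x => ?_⟩
        simp only [Pi.add_apply, hp, hq, cross, WithLp.ofLp_add, map_add, WithLp.toLp_add]
        abel
      smul_mem' := by
        rintro r p ⟨a, b, hp⟩
        exact ⟨r • a, r • b, fun x => by simp [hp, cross]⟩ }
  | _ => ⊥

/-- The inclusion `ℝ^d → ℝ³` for `d ≤ 3` (padding with zeros). -/
def embed3 (d : ℕ) : E d →ₗ[ℝ] (Fin 3 → ℝ) where
  toFun w j := if h : (j : ℕ) < d then w ⟨j, h⟩ else 0
  map_add' u w := by
    ext j
    by_cases h : (j : ℕ) < d <;> simp [h]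
  map_smul' r w := by
    ext j
    by_cases h : (j : ℕ) < d <;> simp [h]

/-- The normal component `w ↦ w · n`. -/
def normalPart (n : E d) : E d →ₗ[ℝ] ℝ := (innerₗ (E d)).flip n

/-- The tangential component `w ↦ w × n`, for `d = 2, 3`; for `d = 2` it is the third coordinate
of the vector product in `ℝ³`, the other two being zero. -/
def tangentialPart (n : E d) : E d →ₗ[ℝ] (Fin 3 → ℝ) :=
  ((crossProduct (R := ℝ)).flip (embed3 d n)).comp (embed3 d)

namespace SimplicialMesh

variable {Ω : Set (E d)} (M : SimplicialMesh Ω)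

/-- The functions in `L¹(Ω)^d` that belong to `P` on every element and for which the jump of
`trace n_f v` across every face `f ⊆ Ω` vanishes. The jump is a limit of values of the
representative which is equal to an element of `P` everywhere on each open element. -/
def jumpSpace {W : Type} [AddCommGroup W] [Module ℝ W] [TopologicalSpace W]
    [IsTopologicalAddGroup W] [ContinuousSMul ℝ W]
    (P : Submodule ℝ (E d → E d)) (trace : E d → E d →ₗ[ℝ] W) :
    Submodule ℝ (FunctionClass Ω d) where
  carrier := {v | MemLp v 1 (volume.restrict Ω) ∧ ∃ u : E d → E d,
    v =ᵐ[volume.restrict Ω] u ∧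
    (∀ t ∈ M.cells, ∃ p ∈ P, Set.EqOn u p (openHull t)) ∧
    ∀ f ∈ M.subsimplices d, openHull f ⊆ Ω → ∀ n, IsUnitNormal f n → ∀ x₀ ∈ openHull f,
      Tendsto (fun ε : ℝ => trace n (u (x₀ + ε • n) - u (x₀ - ε • n))) (𝓝[>] 0) (𝓝 0)}
  zero_mem' := by
    refine ⟨(memLp_congr_ae AEEqFun.coeFn_zero).2 MemLp.zero', 0, AEEqFun.coeFn_zero,
      fun t _ => ⟨0, P.zero_mem, fun x _ => rfl⟩, fun f _ _ n _ x₀ _ => ?_⟩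
    simpa using tendsto_const_nhds
  add_mem' := by
    rintro v w ⟨hv, u, hvu, hu, hju⟩ ⟨hw, u', hwu, hu', hju'⟩
    refine ⟨(memLp_congr_ae (AEEqFun.coeFn_add v w)).2 (hv.add hw), u + u',
      (AEEqFun.coeFn_add v w).trans (hvu.add hwu), fun t ht => ?_, fun f hf hfΩ n hn x₀ hx => ?_⟩
    · obtain ⟨p, hp, hup⟩ := hu t ht
      obtain ⟨q, hq, huq⟩ := hu' t ht
      exact ⟨p + q, P.add_mem hp hq, fun x hx => by simp [hup hx, huq hx]⟩
    · have := (hju f hf hfΩ n hn x₀ hx).add (hju' f hf hfΩ n hn x₀ hx)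
      rw [add_zero] at this
      refine this.congr fun ε => ?_
      rw [← map_add]
      congr 1
      simp only [Pi.add_apply]
      abel
  smul_mem' := by
    rintro r v ⟨hv, u, hvu, hu, hju⟩
    refine ⟨(memLp_congr_ae (AEEqFun.coeFn_smul r v)).2 (hv.const_smul r), r • u,
      (AEEqFun.coeFn_smul r v).trans (hvu.const_smul r), fun t ht => ?_,
      fun f hf hfΩ n hn x₀ hx => ?_⟩
    · obtain ⟨p, hp, hup⟩ := hu t ht
      exact ⟨r • p, P.smul_mem r hp, fun x hx => by simp [hup hx]⟩
    · have := (hju f hf hfΩ n hn x₀ hx).const_smul r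
      rw [smul_zero] at this
      refine this.congr fun ε => ?_
      rw [← map_smul]
      simp only [Pi.smul_apply, smul_sub]

/-- The lowest order Raviart-Thomas space `RT₀(𝒯, Ω)`. -/
def RT0 : Submodule ℝ (FunctionClass Ω d) := M.jumpSpace (rtLocal d) normalPart

/-- The lowest order Nédélec space `N₀(𝒯, Ω)`, for `d = 2, 3`. -/
def N0 : Submodule ℝ (FunctionClass Ω d) := M.jumpSpace (neLocal d) tangentialPart

/-- `S₁(𝒯, Ω)`: the functions in `H¹(Ω)` that are affine on each element. -/
def S1 : Submodule ℝ (FunctionClass Ω 1) where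
  carrier := {v | InH1 Ω (fun x => v x 0) ∧
    ∀ t ∈ M.cells, ∃ ℓ : E d →ᵃ[ℝ] ℝ, ∀ᵐ x ∂(volume.restrict Ω), x ∈ openHull t → v x 0 = ℓ x}
  zero_mem' := by
    have h0 : ∀ᵐ x ∂((volume : Measure (E d)).restrict Ω), (0 : FunctionClass Ω 1) x = 0 :=
      AEEqFun.coeFn_zero
    refine ⟨InH1.zero.congr ?_, fun t _ => ⟨0, ?_⟩⟩ <;> filter_upwards [h0] with x hx <;> simp [hx]
  add_mem' := by
    rintro v w ⟨hv, hv'⟩ ⟨hw, hw'⟩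
    have h0 := AEEqFun.coeFn_add v w
    refine ⟨(hv.add hw).congr ?_, fun t ht => ?_⟩
    · filter_upwards [h0] with x hx
      simp [hx]
    · obtain ⟨p, hp⟩ := hv' t ht
      obtain ⟨q, hq⟩ := hw' t ht
      refine ⟨p + q, ?_⟩
      filter_upwards [h0, hp, hq] with x hx h1 h2 h3
      simp [hx, h1 h3, h2 h3]
  smul_mem' := by
    rintro r v ⟨hv, hv'⟩
    have h0 := AEEqFun.coeFn_smul r v
    refine ⟨(hv.const_mul r).congr ?_, fun t ht => ?_⟩
    · filter_upwards [h0] with x hx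
      simp [hx]
    · obtain ⟨p, hp⟩ := hv' t ht
      refine ⟨r • p, ?_⟩
      filter_upwards [h0, hp] with x hx h1 h3
      simp [hx, h1 h3]

/-- `S₀(𝒯, Ω)`: the functions in `L²(Ω)` that are constant on each element. -/
def S0 : Submodule ℝ (FunctionClass Ω 1) where
  carrier := {v | MemLp v 2 (volume.restrict Ω) ∧
    ∀ t ∈ M.cells, ∃ c : ℝ, ∀ᵐ x ∂(volume.restrict Ω), x ∈ openHull t → v x 0 = c}
  zero_mem' := by
    have h0 : ∀ᵐ x ∂((volume : Measure (E d)).restrict Ω), (0 : FunctionClass Ω 1) x = 0 :=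
      AEEqFun.coeFn_zero
    refine ⟨(memLp_congr_ae AEEqFun.coeFn_zero).2 MemLp.zero', fun t _ => ⟨0, ?_⟩⟩
    filter_upwards [h0] with x hx
    simp [hx]
  add_mem' := by
    rintro v w ⟨hv, hv'⟩ ⟨hw, hw'⟩
    have h0 := AEEqFun.coeFn_add v w
    refine ⟨(memLp_congr_ae h0).2 (hv.add hw), fun t ht => ?_⟩
    obtain ⟨p, hp⟩ := hv' t ht
    obtain ⟨q, hq⟩ := hw' t ht
    refine ⟨p + q, ?_⟩
    filter_upwards [h0, hp, hq] with x hx h1 h2 h3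
    simp [hx, h1 h3, h2 h3]
  smul_mem' := by
    rintro r v ⟨hv, hv'⟩
    have h0 := AEEqFun.coeFn_smul r v
    refine ⟨(memLp_congr_ae h0).2 (hv.const_smul r), fun t ht => ?_⟩
    obtain ⟨p, hp⟩ := hv' t ht
    refine ⟨r * p, ?_⟩
    filter_upwards [h0, hp] with x hx h1 h3
    simp [hx, h1 h3]

end SimplicialMesh

/-! ### Shape functions -/

/-- The Lebesgue measure `|T|` of a `d`-simplex `T`. -/
def cellVolume (t : Finset (E d)) : ℝ := (volume (openHull t)).toReal

/-- The `(d-1)`-dimensional Lebesgue measure `|f|` of a `(d-1)`-simplex `f`. -/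
def faceArea (f : Finset (E d)) : ℝ := (Measure.euclideanHausdorffMeasure (d - 1) (openHull f)).toReal

open Classical in
/-- The vertex of the element `t` that does not belong to its face `f`. -/
def oppositeVertex (f t : Finset (E d)) : E d := ∑ y ∈ t \ f, y

/-- The midpoint of an edge. -/
def edgeMidpoint (e : Finset (E d)) : E d := (1 / 2 : ℝ) • ∑ y ∈ e, y

open Classical in
/-- The affine function with value `1` at the vertices of `t` in `i` and `0` at the other
vertices of `t`. If `t` is a nondegenerate `d`-simplex, it exists and is unique. -/
def nodalAffine (i t : Finset (E d)) : E d →ᵃ[ℝ] ℝ :=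
  Classical.epsilon fun ℓ => ∀ q ∈ t, ℓ q = if q ∈ i then 1 else 0

namespace SimplicialMesh

variable {Ω : Set (E d)} (M : SimplicialMesh Ω)

open Classical in
/-- The indicator function of an open element. -/
def shapeS0 (t : Finset (E d)) (x : E d) : E 1 := !₂[(openHull t).indicator 1 x]

open Classical in
/-- The hat function of the vertex `p`, where `i = {p}`: continuous on `closure Ω`, affine on each
element, equal to `1` at `p` and to `0` at all other vertices. (On common faces of closed elements
the value does not depend on the element that is chosen.) -/
def shapeS1 (i : Finset (E d)) (x : E d) : E 1 :=
  !₂[if h : ∃ t ∈ M.star i, x ∈ convexHull ℝ (t : Set (E d)) then nodalAffine i h.choose x else 0]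

open Classical in
/-- The Raviart-Thomas shape function of the face `f`:
`|f| / (d |T₁|) (x - a₁)` on `T₁`, `- |f| / (d |T₂|) (x - a₂)` on `T₂` (if there is a second
adjacent element), and `0` elsewhere. -/
def shapeRT0 (o : M.Orientation) (f : Finset (E d)) (x : E d) : E d :=
  ∑ t ∈ M.star f, (openHull t).indicator (fun x =>
    ((if t = o.first f then 1 else -1) * (faceArea f / (d * cellVolume t))) •
      (x - oppositeVertex f t)) x

open Classical in
/-- The Nédélec shape function of the edge `e`. For `d = 2`, it is the Raviart-Thomas function of
`e`, rotated by 90 degrees: with `t_f = rot n_f` this means that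
`θ^N · t_f = θ^RT · n_f` and `θ^N · n_f = - θ^RT · t_f`. For `d = 3`, on each adjacent element `t`,
with `e' = t \ e` the opposite edge, it is
`(x - m_{e'}) × τ_{e'} / (τ_e · ((m_e - m_{e'}) × τ_{e'}))`, which does not depend on
the direction of `τ_{e'}`, so that the latter need not be chosen such that the denominator is
positive. For other `d`, it has a dummy value. -/
def shapeN0 : {d : ℕ} → {Ω : Set (E d)} → (M : SimplicialMesh Ω) → M.Orientation →
    Finset (E d) → E d → E d
  | 2, _, M, o, f, x => rot (M.shapeRT0 o f x)
  | 3, _, M, o, e, x => ∑ t ∈ M.star e, (openHull t).indicator (fun x =>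
      (inner ℝ (o.tangent e)
        (cross (edgeMidpoint e - edgeMidpoint (t \ e)) (o.tangent (t \ e))))⁻¹ •
        cross (x - edgeMidpoint (t \ e)) (o.tangent (t \ e))) x
  | _, _, _, _, _, _ => 0

end SimplicialMesh

/-! ### The four families of finite elements -/

/-- The four lowest order finite element families. -/
inductive FEKind
  | S1
  | N0
  | RT0
  | S0

namespace FEKind

/-- The number of components of the functions in the space. -/
def valueDim : FEKind → ℕ → ℕ
  | S1, _ => 1
  | N0, d => d
  | RT0, d => d
  | S0, _ => 1

/-- The number of vertices of the subsimplices to which the shape functions are attached: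
vertices for `S₁`, edges for `N₀`, faces for `RT₀`, elements for `S₀`. -/
def nodeCard : FEKind → ℕ → ℕ
  | S1, _ => 1
  | N0, _ => 2
  | RT0, d => d
  | S0, d => d + 1

/-- The depth of the networks. -/
def netDepth : FEKind → ℕ
  | S1 => 5
  | N0 => 5
  | RT0 => 5
  | S0 => 3

end FEKind

namespace SimplicialMesh

variable {Ω : Set (E d)} (M : SimplicialMesh Ω)

/-- The finite element space. -/
def feSpace : (k : FEKind) → Submodule ℝ (FunctionClass Ω (k.valueDim d))
  | .S1 => M.S1
  | .N0 => M.N0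
  | .RT0 => M.RT0
  | .S0 => M.S0

/-- The index set `𝓘` of the shape functions. -/
def nodes (k : FEKind) : Finset (Finset (E d)) := M.subsimplices (k.nodeCard d)

/-- The shape functions `θ_i`. -/
def shape (o : M.Orientation) : (k : FEKind) → Finset (E d) → E d → E (k.valueDim d)
  | .S1 => M.shapeS1
  | .N0 => M.shapeN0 o
  | .RT0 => M.shapeRT0 o
  | .S0 => shapeS0

/-- The maximum `𝔰(𝓘)` of the numbers `s(i)`. -/
def maxAdj (k : FEKind) : ℕ := (M.nodes k).sup M.adj

/-- The family `(s(i))_{i ∈ 𝓘}` up to the order of its members (it determines `|𝓘|`). -/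
def adjFamily (k : FEKind) : Multiset ℕ := (M.nodes k).val.map M.adj

end SimplicialMesh

end FEMNet

end

open FEMNet

/-! All four spaces follow one pattern, recorded in `FEData`: a local space `P` of affine maps and,
for each node `i`, a single functional `dof i` used on every adjacent element. A function belongs to
the space exactly if its restrictions to the elements lie in `P` and, at each node, all adjacent
elements give the same value of `dof i`. The functionals at the nodes of one element determine a
member of `P`, and the shape functions are dual to the functionals up to nonzero factors.
`FEData.exists_basis` then obtains the basis by comparing degrees of freedom element by element.

The work lies in showing that conformity means single-valued degrees of freedom. For `RT0` the
functional is a multiple of the normal component, which is constant on a face; the planar Nédélec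
space is a rotated copy. For `N0` in space it is the tangential component along an edge, for `S1`
the value at a vertex. In these two cases conformity compares only elements that share a face,
whereas elements that meet at an edge or a vertex need not share one; `face_connected_star` links
them by crossing faces, and here the assumption enters that the domain does not touch itself. For
`S1`, `affine_eq_on_face` excludes jumps of functions in `H¹`, and `inH1_of_piecewise` gives the
converse by integrating by parts with a Lipschitz function.

The networks rest on two observations. An open `d`-simplex is an intersection of `d + 1` open half
spaces, so two BiSU layers compute its indicator `χ`. If `|p| ≤ R` on the domain, then `relu (p + R
(χ - 1))` and `relu (-p + R (χ - 1))` are the positive and negative parts of `p χ`, so that the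
product is exact. Each pair of a node and an adjacent element costs `O(d²)` weights, and the number
of pairs is the sum of the `s(i)`; this gives both the size and the architecture. A linear
combination of shape functions changes only the output layer and does not increase the number of
weights (`Network.combine_size_le`). Distinct functions have distinct networks, so the vector space
structure can be transported. -/

noncomputable section

namespace FEMNet

variable {d : ℕ}

/-! ### Barycentric coordinates -/

/-- The barycentric coordinate of the vertex `y` of the `d`-simplex `t`. -/
def bary (t : Finset (E d)) (y : E d) : E d →ᵃ[ℝ] ℝ := nodalAffine {y} t

theorem affineMap_sum {W : Type*} [AddCommGroup W] [Module ℝ W] (A : E d →ᵃ[ℝ] W)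
    (s : Finset (E d)) (w : E d → ℝ) (hw : ∑ y ∈ s, w y = 1) :
    A (∑ y ∈ s, w y • y) = ∑ y ∈ s, w y • A y := by
  have h : ∀ z, A z = A.linear z + A 0 := fun z => by
    conv_lhs => rw [AffineMap.decomp A]
    rfl
  have h2 : ∑ y ∈ s, w y • A y = ∑ y ∈ s, (w y • A.linear y + w y • A 0) :=
    Finset.sum_congr rfl fun y _ => by rw [h y, smul_add]
  rw [h, map_sum, h2, Finset.sum_add_distrib, ← Finset.sum_smul, hw, one_smul]
  simp only [map_smul]

namespace IsFullSimplex

variable {t : Finset (E d)} (ht : IsFullSimplex t)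
include ht

theorem nonempty : t.Nonempty := by
  rw [← Finset.card_pos, ht.1]; omega

theorem affineSpan_eq_top : affineSpan ℝ (t : Set (E d)) = ⊤ := by
  have := (ht.2.affineSpan_eq_top_iff_card_eq_finrank_add_one).2 (by simp [ht.1])
  simpa using this

/-- The vertices as an affine basis. -/
def affineBasis : AffineBasis t ℝ (E d) :=
  ⟨(↑), ht.2, by simpa using ht.affineSpan_eq_top⟩

theorem affineBasis_apply (y : t) : ht.affineBasis y = y := rfl

theorem exists_affine (g : E d → ℝ) : ∃ ℓ : E d →ᵃ[ℝ] ℝ, ∀ q ∈ t, ℓ q = g q := by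
  classical
  refine ⟨∑ y : t, g y • ht.affineBasis.coord y, fun q hq => ?_⟩
  have : ∀ y : t, ht.affineBasis.coord y q = if y = ⟨q, hq⟩ then 1 else 0 := fun y => by
    have := ht.affineBasis.coord_apply y ⟨q, hq⟩
    rwa [affineBasis_apply] at this
  have h2 : ∀ s : Finset t, (∑ y ∈ s, g y • ht.affineBasis.coord y) q
      = ∑ y ∈ s, g y * ht.affineBasis.coord y q := by
    intro s
    induction s using Finset.induction_on with
    | empty => simp
    | insert a s ha ih => simp [Finset.sum_insert ha, ih]
  rw [h2]
  simp [this]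

open Classical in
theorem nodalAffine_apply (i : Finset (E d)) {q : E d} (hq : q ∈ t) :
    nodalAffine i t q = if q ∈ i then 1 else 0 :=
  Classical.epsilon_spec (ht.exists_affine fun q => if q ∈ i then 1 else 0) q hq

theorem bary_self {y : E d} (hy : y ∈ t) : bary t y y = 1 := by
  simp [bary, ht.nodalAffine_apply _ hy]

theorem bary_of_ne {y q : E d} (hq : q ∈ t) (h : q ≠ y) : bary t y q = 0 := by
  simp [bary, ht.nodalAffine_apply _ hq, h]

open Classical in
theorem bary_of_sum {s : Finset (E d)} (hs : s ⊆ t) {w : E d → ℝ} (hw : ∑ y ∈ s, w y = 1)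
    (z : E d) : bary t z (∑ y ∈ s, w y • y) = if z ∈ s then w z else 0 := by
  rw [affineMap_sum _ _ _ hw]
  have : ∀ y ∈ s, w y • bary t z y = if y = z then w z else 0 := by
    intro y hy
    by_cases h : y = z
    · subst h; simp [ht.bary_self (hs hy)]
    · simp [h, ht.bary_of_ne (hs hy) h]
  rw [Finset.sum_congr rfl this]
  simp

theorem exists_weights (x : E d) : ∃ w : E d → ℝ, ∑ y ∈ t, w y = 1 ∧ ∑ y ∈ t, w y • y = x := by
  classical
  refine ⟨fun y => if h : y ∈ t then ht.affineBasis.coord ⟨y, h⟩ x else 0, ?_, ?_⟩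
  · rw [← ht.affineBasis.sum_coord_apply_eq_one x, ← Finset.sum_coe_sort]
    exact Finset.sum_congr rfl fun y _ => by simp
  · conv_rhs => rw [← ht.affineBasis.linear_combination_coord_eq_self x]
    rw [← Finset.sum_coe_sort]
    exact Finset.sum_congr rfl fun y _ => by simp [affineBasis_apply]

theorem sum_bary (x : E d) : ∑ y ∈ t, bary t y x = 1 := by
  obtain ⟨w, h1, h2⟩ := ht.exists_weights x
  rw [← h1, ← h2]
  exact Finset.sum_congr rfl fun y hy => by rw [ht.bary_of_sum subset_rfl h1]; simp [hy]

theorem sum_bary_smul (x : E d) : ∑ y ∈ t, bary t y x • y = x := by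
  obtain ⟨w, h1, h2⟩ := ht.exists_weights x
  conv_rhs => rw [← h2]
  rw [← h2]
  exact Finset.sum_congr rfl fun y hy => by rw [ht.bary_of_sum subset_rfl h1]; simp [hy]

theorem affine_eq_sum {W : Type*} [AddCommGroup W] [Module ℝ W] (A : E d →ᵃ[ℝ] W) (x : E d) :
    A x = ∑ y ∈ t, bary t y x • A y := by
  conv_lhs => rw [← ht.sum_bary_smul x]
  exact affineMap_sum A t _ (ht.sum_bary x)

theorem affine_ext {W : Type*} [AddCommGroup W] [Module ℝ W] {A B : E d →ᵃ[ℝ] W}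
    (h : ∀ y ∈ t, A y = B y) : A = B := by
  ext x
  rw [ht.affine_eq_sum A, ht.affine_eq_sum B]
  exact Finset.sum_congr rfl fun y hy => by rw [h y hy]

/-- Subsimplices of `t` are recognized by the signs of the coordinates of `t`, so that all incidence
questions refer to one fixed family of affine functions. -/
theorem mem_convexHull_iff {s : Finset (E d)} (hs : s ⊆ t) {x : E d} :
    x ∈ convexHull ℝ (s : Set (E d)) ↔
      (∀ y ∈ t, 0 ≤ bary t y x) ∧ ∀ y ∈ t, y ∉ s → bary t y x = 0 := by
  classical
  rw [Finset.mem_convexHull']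
  constructor
  · rintro ⟨w, h0, h1, rfl⟩
    simp_rw [ht.bary_of_sum hs h1]
    refine ⟨fun y _ => ?_, fun y _ h => by simp [h]⟩
    split_ifs with h
    · exact h0 y h
    · exact le_rfl
  · rintro ⟨h0, h1⟩
    refine ⟨fun y => bary t y x, fun y hy => h0 y (hs hy), ?_, ?_⟩
    · rw [← ht.sum_bary x]
      exact Finset.sum_subset hs fun y hy hys => h1 y hy hys
    · conv_rhs => rw [← ht.sum_bary_smul x]
      exact Finset.sum_subset hs fun y hy hys => by simp only [h1 y hy hys, zero_smul]

theorem mem_openHull_iff {s : Finset (E d)} (hs : s ⊆ t) {x : E d} :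
    x ∈ openHull s ↔ (∀ y ∈ s, 0 < bary t y x) ∧ ∀ y ∈ t, y ∉ s → bary t y x = 0 := by
  classical
  constructor
  · rintro ⟨w, h0, h1, rfl⟩
    simp_rw [ht.bary_of_sum hs h1]
    exact ⟨fun y h => by simpa [h] using h0 y h, fun y _ h => by simp [h]⟩
  · rintro ⟨h0, h1⟩
    refine ⟨fun y => bary t y x, fun y hy => h0 y hy, ?_, ?_⟩
    · rw [← ht.sum_bary x]
      exact Finset.sum_subset hs fun y hy hys => h1 y hy hys
    · conv_rhs => rw [← ht.sum_bary_smul x]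
      exact Finset.sum_subset hs fun y hy hys => by simp only [h1 y hy hys, zero_smul]

theorem mem_convexHull_self_iff {x : E d} :
    x ∈ convexHull ℝ (t : Set (E d)) ↔ ∀ y ∈ t, 0 ≤ bary t y x := by
  rw [ht.mem_convexHull_iff subset_rfl]
  exact ⟨fun h => h.1, fun h => ⟨h, fun y hy hy' => absurd hy hy'⟩⟩

theorem mem_openHull_self_iff {x : E d} : x ∈ openHull t ↔ ∀ y ∈ t, 0 < bary t y x := by
  rw [ht.mem_openHull_iff subset_rfl]
  exact ⟨fun h => h.1, fun h => ⟨h, fun y hy hy' => absurd hy hy'⟩⟩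

end IsFullSimplex

/-! ### Topology and measure of open and closed simplices -/

theorem continuous_affineMap {W : Type*} [NormedAddCommGroup W] [NormedSpace ℝ W]
    (A : E d →ᵃ[ℝ] W) : Continuous A :=
  AffineMap.continuous_of_finiteDimensional A

theorem openHull_subset_convexHull (s : Finset (E d)) :
    openHull s ⊆ convexHull ℝ (s : Set (E d)) := by
  rintro x ⟨w, h0, h1, h2⟩
  exact Finset.mem_convexHull'.2 ⟨w, fun y hy => (h0 y hy).le, h1, h2⟩

theorem centroid_mem_openHull {s : Finset (E d)} (hs : s.Nonempty) :
    ∑ y ∈ s, (s.card : ℝ)⁻¹ • y ∈ openHull s := by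
  have : (0 : ℝ) < s.card := by exact_mod_cast hs.card_pos
  exact ⟨fun _ => (s.card : ℝ)⁻¹, fun _ _ => by positivity, by simp [this.ne'], rfl⟩

theorem openHull_nonempty {s : Finset (E d)} (hs : s.Nonempty) : (openHull s).Nonempty :=
  ⟨_, centroid_mem_openHull hs⟩

theorem lineMap_mem_openHull {s : Finset (E d)} {x z : E d} (hx : x ∈ convexHull ℝ (s : Set (E d)))
    (hz : z ∈ openHull s) {r : ℝ} (h0 : 0 < r) (h1 : r ≤ 1) :
    AffineMap.lineMap x z r ∈ openHull s := by
  obtain ⟨v, v0, v1, rfl⟩ := Finset.mem_convexHull'.1 hx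
  obtain ⟨w, w0, w1, rfl⟩ := hz
  refine ⟨fun y => (1 - r) * v y + r * w y, fun y hy => ?_, ?_, ?_⟩
  · have := mul_nonneg (sub_nonneg.2 h1) (v0 y hy)
    have := mul_pos h0 (w0 y hy)
    linarith
  · simp only [Finset.sum_add_distrib, ← Finset.mul_sum, v1, w1]; ring
  · rw [AffineMap.lineMap_apply_module]
    simp only [add_smul, mul_smul, Finset.sum_add_distrib, ← Finset.smul_sum]

theorem convexHull_subset_closure_openHull {s : Finset (E d)} (hs : s.Nonempty) :
    convexHull ℝ (s : Set (E d)) ⊆ closure (openHull s) := by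
  intro x hx
  obtain ⟨z, hz⟩ := openHull_nonempty hs
  have h : Tendsto (fun r : ℝ => AffineMap.lineMap x z r) (𝓝[>] 0) (𝓝 x) := by
    have : Continuous (fun r : ℝ => (AffineMap.lineMap x z r : E d)) :=
      AffineMap.lineMap_continuous
    simpa using (this.tendsto 0).mono_left nhdsWithin_le_nhds
  refine mem_closure_of_tendsto h ?_
  filter_upwards [Ioc_mem_nhdsGT (zero_lt_one' ℝ)] with r hr
  exact lineMap_mem_openHull hx hz hr.1 hr.2

theorem isClosed_convexHull (s : Finset (E d)) : IsClosed (convexHull ℝ (s : Set (E d))) :=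
  (s.finite_toSet.isCompact_convexHull ℝ).isClosed

theorem IsFullSimplex.isOpen_openHull {t : Finset (E d)} (ht : IsFullSimplex t) :
    IsOpen (openHull t) := by
  have : openHull t = ⋂ y ∈ t, {x | 0 < bary t y x} := by
    ext x; simp [ht.mem_openHull_self_iff]
  rw [this]
  exact isOpen_biInter_finset fun y _ => isOpen_lt continuous_const (continuous_affineMap _)

/-- The zero set of a nonzero affine function is a null set. -/
theorem volume_affine_zero (ℓ : E d →ᵃ[ℝ] ℝ) {y : E d} (hy : ℓ y ≠ 0) :
    volume {x | ℓ x = 0} = 0 := by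
  by_cases h : ∃ x₀, ℓ x₀ = 0
  · let S : AffineSubspace ℝ (E d) := (AffineSubspace.mk' (0 : ℝ) ⊥).comap ℓ
    have hS : (S : Set (E d)) = {x | ℓ x = 0} := by
      ext x; simp [S, AffineSubspace.mem_mk']
    rw [← hS]
    refine Measure.addHaar_affineSubspace volume S fun h => hy ?_
    have : y ∈ (S : Set (E d)) := by rw [h]; trivial
    rwa [hS] at this
  · push Not at h
    simp [h]

theorem IsFullSimplex.volume_convexHull_diff {t : Finset (E d)} (ht : IsFullSimplex t) :
    volume (convexHull ℝ (t : Set (E d)) \ openHull t) = 0 := by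
  refine measure_mono_null (t := ⋃ y ∈ t, {x | bary t y x = 0}) ?_ ?_
  · rintro x ⟨h1, h2⟩
    rw [ht.mem_convexHull_self_iff] at h1
    rw [ht.mem_openHull_self_iff] at h2
    push Not at h2
    obtain ⟨y, hy, h⟩ := h2
    simp only [Set.mem_iUnion, Set.mem_ofPred_eq]
    exact ⟨y, hy, le_antisymm h (h1 y hy)⟩
  · refine (measure_biUnion_null_iff t.countable_toSet).2 fun y hy => ?_
    exact volume_affine_zero _ (y := y) (by rw [ht.bary_self hy]; exact one_ne_zero)

/-- This is the form in which polytopality is used: a set contained in the closure of the domain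
lies in the domain as soon as it is open. -/
theorem IsPolytopalDomain.interior_closure {Ω : Set (E d)} (hΩ : IsPolytopalDomain Ω) :
    interior (closure Ω) = Ω := by
  obtain ⟨-, P, hP, h⟩ := hΩ
  have hc : IsClosed (⋃ s ∈ P, convexHull ℝ (s : Set (E d))) :=
    Set.Finite.isClosed_biUnion P.finite_toSet fun s _ => isClosed_convexHull s
  have h1 : closure Ω = ⋃ s ∈ P, convexHull ℝ (s : Set (E d)) := by
    refine subset_antisymm (closure_minimal (h ▸ interior_subset) hc) ?_
    refine Set.iUnion₂_subset fun s hs => ?_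
    refine (convexHull_subset_closure_openHull (hP s hs).nonempty).trans (closure_mono ?_)
    rw [h]
    refine interior_maximal ?_ (hP s hs).isOpen_openHull
    exact (openHull_subset_convexHull s).trans
      (Set.subset_biUnion_of_mem (u := fun s : Finset (E d) => convexHull ℝ (s : Set (E d))) hs)
  rw [h1, ← h]

theorem IsPolytopalDomain.isOpen {Ω : Set (E d)} (hΩ : IsPolytopalDomain Ω) : IsOpen Ω := by
  rw [← hΩ.interior_closure]; exact isOpen_interior

/-! ### Incidence relations in a regular mesh -/

namespace SimplicialMesh

variable {Ω : Set (E d)} (M : SimplicialMesh Ω)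

theorem mem_star {i t : Finset (E d)} : t ∈ M.star i ↔ t ∈ M.cells ∧ i ⊆ t := by
  simp [star]

theorem mem_subsimplices {j : ℕ} {i : Finset (E d)} :
    i ∈ M.subsimplices j ↔ ∃ t ∈ M.cells, i ⊆ t ∧ i.card = j := by
  simp [subsimplices, Finset.mem_powersetCard]

theorem exists_cell_of_mem {x : E d} (hx : x ∈ closure Ω) :
    ∃ t ∈ M.cells, x ∈ convexHull ℝ (t : Set (E d)) := by
  rw [M.cover] at hx
  simpa using hx

theorem convexHull_subset_closure {t : Finset (E d)} (ht : t ∈ M.cells) :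
    convexHull ℝ (t : Set (E d)) ⊆ closure Ω := by
  rw [M.cover]
  exact Set.subset_biUnion_of_mem (u := fun s : Finset (E d) => convexHull ℝ (s : Set (E d))) ht

theorem openHull_subset (hΩ : IsPolytopalDomain Ω) {t : Finset (E d)} (ht : t ∈ M.cells) :
    openHull t ⊆ Ω := by
  rw [← hΩ.interior_closure]
  exact interior_maximal ((openHull_subset_convexHull t).trans (M.convexHull_subset_closure ht))
    (M.isFullSimplex t ht).isOpen_openHull

theorem cells_nonempty (hΩ : IsPolytopalDomain Ω) : M.cells.Nonempty := by
  obtain ⟨x, hx⟩ := hΩ.1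
  obtain ⟨t, ht, -⟩ := M.exists_cell_of_mem (subset_closure hx)
  exact ⟨t, ht⟩

include M in
theorem isCompact_closure : IsCompact (closure Ω) := by
  rw [M.cover]
  exact M.cells.finite_toSet.isCompact_biUnion
    fun t _ => t.finite_toSet.isCompact_convexHull ℝ

include M in
theorem volume_lt_top : volume Ω < ⊤ :=
  (measure_mono subset_closure).trans_lt M.isCompact_closure.measure_lt_top

/-- The closed elements cover the domain and their boundaries are null sets. Hence every identity
need only be checked inside open elements. -/
theorem ae_mem_openHull (hΩ : IsPolytopalDomain Ω) :
    ∀ᵐ x ∂(volume.restrict Ω), ∃ t ∈ M.cells, x ∈ openHull t := by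
  rw [ae_restrict_iff' hΩ.isOpen.measurableSet]
  have h : ∀ᵐ x : E d, ∀ t ∈ M.cells, x ∉ convexHull ℝ (t : Set (E d)) \ openHull t := by
    refine (ae_ball_iff M.cells.countable_toSet).2 ?_
    exact fun t ht => measure_eq_zero_iff_ae_notMem.1 (M.isFullSimplex t ht).volume_convexHull_diff
  filter_upwards [h] with x hx hxΩ
  obtain ⟨t, ht, hxt⟩ := M.exists_cell_of_mem (subset_closure hxΩ)
  exact ⟨t, ht, by simpa [hxt] using hx t ht⟩

/-- Regularity places `x` in the hull of `s ∩ t`, so the coordinates of `x` at vertices of `s`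
outside `t` vanish; those at the vertices of `i` are positive. Thus a relative interior point of a
subsimplex detects its whole star. -/
theorem subset_of_mem_convexHull {i s t : Finset (E d)} (hs : s ∈ M.cells) (hi : i ⊆ s) {x : E d}
    (hx : x ∈ openHull i) (ht : t ∈ M.cells) (hxt : x ∈ convexHull ℝ (t : Set (E d))) : i ⊆ t := by
  classical
  by_cases hst : s = t
  · rwa [← hst]
  have h1 := M.regular s hs t ht hst
    ⟨convexHull_mono (by exact_mod_cast hi) (openHull_subset_convexHull i hx), hxt⟩
  have hs' := M.isFullSimplex s hs
  have h2 := ((hs'.mem_convexHull_iff (by convert! Finset.inter_subset_left)).1 h1).2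
  intro y hy
  by_contra hyt
  have := h2 y (hi hy) (by simp [hyt])
  have h3 := ((hs'.mem_openHull_iff hi).1 hx).1 y hy
  linarith

theorem eq_of_mem_openHull {s t : Finset (E d)} (hs : s ∈ M.cells) {x : E d}
    (hx : x ∈ openHull s) (ht : t ∈ M.cells) (hxt : x ∈ convexHull ℝ (t : Set (E d))) : s = t :=
  Finset.eq_of_subset_of_card_le (M.subset_of_mem_convexHull hs subset_rfl hx ht hxt)
    (by rw [(M.isFullSimplex s hs).1, (M.isFullSimplex t ht).1])

/-- There are finitely many elements and they are closed: those missing `x` also miss a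
neighbourhood of it. -/
theorem eventually_mem_convexHull (x : E d) :
    ∀ᶠ y in 𝓝 x, ∀ t ∈ M.cells, y ∈ convexHull ℝ (t : Set (E d)) →
      x ∈ convexHull ℝ (t : Set (E d)) := by
  rw [Filter.eventually_all_finset]
  intro t _
  by_cases h : x ∈ convexHull ℝ (t : Set (E d))
  · simp [h]
  · filter_upwards [(isClosed_convexHull t).isOpen_compl.mem_nhds h] with y hy hy'
    exact absurd hy' hy

end SimplicialMesh

/-! ### Faces -/

section Face

variable {f t : Finset (E d)}

theorem oppositeVertex_spec (ht : IsFullSimplex t) (hft : f ⊆ t) (hf : f.card = d) :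
    oppositeVertex f t ∈ t ∧ oppositeVertex f t ∉ f ∧ ∀ y ∈ t, y ∉ f → y = oppositeVertex f t := by
  classical
  have h1 : (t \ f).card = 1 := by
    rw [Finset.card_sdiff_of_subset hft, ht.1, hf]; omega
  obtain ⟨a, ha⟩ := Finset.card_eq_one.1 h1
  have h2 : oppositeVertex f t = a := by
    have : oppositeVertex f t = ∑ y ∈ t \ f, y := by unfold oppositeVertex; congr!
    rw [this, ha]; simp
  rw [h2]
  have h3 : a ∈ t \ f := by simp [ha]
  rw [Finset.mem_sdiff] at h3
  refine ⟨h3.1, h3.2, fun y hy hyf => ?_⟩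
  have : y ∈ t \ f := Finset.mem_sdiff.2 ⟨hy, hyf⟩
  simpa [ha] using this

variable (ht : IsFullSimplex t) (hft : f ⊆ t) (hf : f.card = d)
include ht hft hf

theorem oppositeVertex_mem : oppositeVertex f t ∈ t := (oppositeVertex_spec ht hft hf).1

theorem oppositeVertex_notMem : oppositeVertex f t ∉ f := (oppositeVertex_spec ht hft hf).2.1

theorem eq_oppositeVertex {y : E d} (hy : y ∈ t) (hyf : y ∉ f) : y = oppositeVertex f t :=
  (oppositeVertex_spec ht hft hf).2.2 y hy hyf

theorem bary_opposite_self : bary t (oppositeVertex f t) (oppositeVertex f t) = 1 :=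
  ht.bary_self (oppositeVertex_mem ht hft hf)

theorem bary_opposite_of_mem {y : E d} (hy : y ∈ f) : bary t (oppositeVertex f t) y = 0 :=
  ht.bary_of_ne (hft hy) fun h => oppositeVertex_notMem ht hft hf (h ▸ hy)

theorem bary_opposite_of_mem_openHull {x : E d} (hx : x ∈ openHull f) :
    bary t (oppositeVertex f t) x = 0 :=
  ((ht.mem_openHull_iff hft).1 hx).2 _ (oppositeVertex_mem ht hft hf)
    (oppositeVertex_notMem ht hft hf)

/-- Near a relative interior point of the face the coordinates of the vertices of `f` stay positive,
so the sign of the one remaining coordinate decides. -/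
theorem eventually_side {x₀ : E d} (hx : x₀ ∈ openHull f) :
    ∀ᶠ x in 𝓝 x₀, (0 < bary t (oppositeVertex f t) x → x ∈ openHull t) ∧
      (0 ≤ bary t (oppositeVertex f t) x → x ∈ convexHull ℝ (t : Set (E d))) := by
  have h1 : ∀ᶠ x in 𝓝 x₀, ∀ y ∈ f, 0 < bary t y x := by
    rw [Filter.eventually_all_finset]
    exact fun y hy => (continuous_affineMap (bary t y)).continuousAt.eventually_const_lt
      (((ht.mem_openHull_iff hft).1 hx).1 y hy)
  filter_upwards [h1] with x hx'
  rw [ht.mem_openHull_self_iff, ht.mem_convexHull_self_iff]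
  constructor <;> intro h y hy <;> by_cases hyf : y ∈ f
  · exact hx' y hyf
  · rwa [eq_oppositeVertex ht hft hf hy hyf]
  · exact (hx' y hyf).le
  · rwa [eq_oppositeVertex ht hft hf hy hyf]

omit ht hft hf in
theorem face_affine_eq_zero {W : Type*} [NormedAddCommGroup W] [NormedSpace ℝ W]
    (hne : f.Nonempty) (A : E d →ᵃ[ℝ] W) (h : ∀ x ∈ openHull f, A x = 0) {y : E d}
    (hy : y ∈ f) : A y = 0 := by
  have hc : IsClosed {x | A x = 0} := isClosed_eq (continuous_affineMap A) continuous_const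
  have := closure_minimal (s := openHull f) h hc
  exact this (convexHull_subset_closure_openHull hne (subset_convexHull ℝ _ hy))

omit ht hft hf in
theorem affine_eq_zero_on_face {W : Type*} [AddCommGroup W] [Module ℝ W]
    (A : E d →ᵃ[ℝ] W) (h : ∀ y ∈ f, A y = 0) {x : E d} (hx : x ∈ openHull f) : A x = 0 := by
  obtain ⟨w, -, h1, rfl⟩ := hx
  rw [affineMap_sum A f w h1]
  exact Finset.sum_eq_zero fun y hy => by rw [h y hy, smul_zero]

/-- Both functionals vanish on the directions of the face, hence are proportional; the factor is
nonzero because `n · n = 1`. This allows barycentric coordinates to replace unit normals throughout.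
-/
theorem exists_inner_normal {n : E d} (hne : f.Nonempty) (hn : IsUnitNormal f n) :
    ∃ h : ℝ, h ≠ 0 ∧ ∀ w, inner ℝ w n = h * (bary t (oppositeVertex f t)).linear w := by
  obtain ⟨y₀, hy₀⟩ := hne
  set a := oppositeVertex f t with ha
  have key : ∀ x, inner ℝ (x - y₀) n = inner ℝ (a - y₀) n * bary t a x := by
    let A : E d →ᵃ[ℝ] ℝ := ((innerₗ (E d)).flip n).toAffineMap - AffineMap.const ℝ (E d) (inner ℝ y₀ n)
    have hA : ∀ x, A x = inner ℝ (x - y₀) n := fun x => by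
      simp [A, inner_sub_left, real_inner_comm]
    have : A = inner ℝ (a - y₀) n • bary t a := by
      refine ht.affine_ext fun y hy => ?_
      rw [hA]
      by_cases hyf : y ∈ f
      · simp [hn.2 y hyf y₀ hy₀, bary_opposite_of_mem ht hft hf hyf, ha]
      · rw [eq_oppositeVertex ht hft hf hy hyf]
        simp [bary_opposite_self ht hft hf, ha]
    intro x
    rw [← hA, this]; simp
  have key2 : ∀ w, inner ℝ w n = inner ℝ (a - y₀) n * (bary t a).linear w := by
    intro w
    have h1 := key (w + y₀)
    have h2 : bary t a (w + y₀) = (bary t a).linear w + bary t a y₀ := (bary t a).map_vadd y₀ w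
    rw [h2, bary_opposite_of_mem ht hft hf hy₀] at h1
    simpa using h1
  refine ⟨_, fun h0 => ?_, key2⟩
  have := key2 n
  rw [h0, zero_mul, real_inner_self_eq_norm_sq, hn.1] at this
  norm_num at this

theorem exists_unitNormal (hne : f.Nonempty) : ∃ n : E d, IsUnitNormal f n := by
  set a := oppositeVertex f t with ha
  obtain ⟨y₀, hy₀⟩ := hne
  -- The Riesz representative, that is, the gradient of the coordinate that vanishes on the face.
  let g : E d := (InnerProductSpace.toDual ℝ (E d)).symm
    (LinearMap.toContinuousLinearMap (bary t a).linear)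
  have hg : ∀ w, inner ℝ g w = (bary t a).linear w := fun w => by
    simp [g, InnerProductSpace.toDual_symm_apply]
  have hlin : ∀ x y, (bary t a).linear (x - y) = bary t a x - bary t a y := fun x y =>
    (bary t a).linearMap_vsub x y
  have hg0 : g ≠ 0 := by
    intro h
    have := hg (a - y₀)
    rw [hlin, ha, bary_opposite_self ht hft hf, bary_opposite_of_mem ht hft hf hy₀, h] at this
    simp at this
  refine ⟨‖g‖⁻¹ • g, by simp [norm_smul, hg0], fun x hx y hy => ?_⟩
  rw [inner_smul_right, real_inner_comm, hg, hlin, ha, bary_opposite_of_mem ht hft hf hx,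
    bary_opposite_of_mem ht hft hf hy]
  simp

end Face

namespace SimplicialMesh

variable {Ω : Set (E d)} (M : SimplicialMesh Ω)

section TwoCells

variable {f s t : Finset (E d)} (hs : s ∈ M.cells) (ht : t ∈ M.cells)
  (hfs : f ⊆ s) (hft : f ⊆ t) (hf : f.card = d) (hst : s ≠ t)
include hs ht hfs hft hf

/-- Proportionality of the barycentric coordinates that vanish on a common face. -/
theorem bary_opposite_mul (x : E d) : bary s (oppositeVertex f s) x =
    bary s (oppositeVertex f s) (oppositeVertex f t) * bary t (oppositeVertex f t) x := by
  have hs' := M.isFullSimplex s hs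
  have ht' := M.isFullSimplex t ht
  have : bary s (oppositeVertex f s) =
      bary s (oppositeVertex f s) (oppositeVertex f t) • bary t (oppositeVertex f t) := by
    refine ht'.affine_ext fun y hy => ?_
    by_cases hyf : y ∈ f
    · simp [bary_opposite_of_mem hs' hfs hf hyf, bary_opposite_of_mem ht' hft hf hyf]
    · rw [eq_oppositeVertex ht' hft hf hy hyf]
      simp [bary_opposite_self ht' hft hf]
  conv_lhs => rw [this]
  simp

include hst in
/-- Two elements with a common face lie on different sides of it. -/
theorem bary_opposite_neg (hd : 0 < d) :
    bary s (oppositeVertex f s) (oppositeVertex f t) < 0 := by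
  have hs' := M.isFullSimplex s hs
  have ht' := M.isFullSimplex t ht
  have hmul := M.bary_opposite_mul hs ht hfs hft hf
  by_contra! hneg
  -- If the factor were zero, the coordinate of `s` would vanish identically. If it were positive,
  -- points slightly off the face towards the opposite vertex of `t` would lie in both open
  -- elements.
  rcases hneg.eq_or_lt with h0 | hpos
  · have := hmul (oppositeVertex f s)
    rw [← h0, bary_opposite_self hs' hfs hf] at this
    simp at this
  · have hne : f.Nonempty := by rw [← Finset.card_pos]; omega
    obtain ⟨x₀, hx₀⟩ := openHull_nonempty hne
    have h1 := (eventually_side hs' hfs hf hx₀).and (eventually_side ht' hft hf hx₀)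
    have hc : Tendsto (fun r : ℝ => AffineMap.lineMap x₀ (oppositeVertex f t) r) (𝓝[>] 0)
        (𝓝 x₀) := by
      have : Continuous (fun r : ℝ => (AffineMap.lineMap x₀ (oppositeVertex f t) r : E d)) :=
        AffineMap.lineMap_continuous
      simpa using (this.tendsto 0).mono_left nhdsWithin_le_nhds
    obtain ⟨r, ⟨hr1, hr2⟩, hr⟩ := ((hc.eventually h1).and self_mem_nhdsWithin).exists
    have h2 : bary t (oppositeVertex f t) (AffineMap.lineMap x₀ (oppositeVertex f t) r) = r := by
      rw [AffineMap.apply_lineMap, bary_opposite_of_mem_openHull ht' hft hf hx₀,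
        bary_opposite_self ht' hft hf]
      simp [AffineMap.lineMap_apply]
    have hr' : 0 < r := hr
    have h3 := hr2.1 (by rw [h2]; exact hr')
    have h4 := hr1.1 (by rw [hmul, h2]; exact mul_pos hpos hr')
    exact Set.disjoint_left.1 (M.disjoint s hs t ht hst) h4 h3

include hst in
theorem eventually_two_sides (hd : 0 < d) {x₀ : E d} (hx : x₀ ∈ openHull f) :
    ∀ᶠ x in 𝓝 x₀, (0 < bary s (oppositeVertex f s) x → x ∈ openHull s) ∧
      (bary s (oppositeVertex f s) x < 0 → x ∈ openHull t) ∧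
      (x ∈ convexHull ℝ (s : Set (E d)) ∪ convexHull ℝ (t : Set (E d))) := by
  have hs' := M.isFullSimplex s hs
  have ht' := M.isFullSimplex t ht
  have hneg := M.bary_opposite_neg hs ht hfs hft hf hst hd
  filter_upwards [eventually_side hs' hfs hf hx, eventually_side ht' hft hf hx] with x h1 h2
  have hmul := M.bary_opposite_mul hs ht hfs hft hf x
  have h3 : bary s (oppositeVertex f s) x < 0 → x ∈ openHull t := by
    intro h
    refine h2.1 ?_
    rw [hmul] at h
    by_contra! h'
    have := mul_nonneg_of_nonpos_of_nonpos hneg.le h'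
    linarith
  refine ⟨h1.1, h3, ?_⟩
  rcases le_or_gt 0 (bary s (oppositeVertex f s) x) with h | h
  · exact Or.inl (h1.2 h)
  · exact Or.inr (openHull_subset_convexHull _ (h3 h))

-- The two closed elements fill a neighbourhood of each point of the open face, which is therefore
-- interior to the closure of the domain.
include hst in
theorem openHull_face_subset (hΩ : IsPolytopalDomain Ω) (hd : 0 < d) : openHull f ⊆ Ω := by
  intro x₀ hx
  rw [← hΩ.interior_closure, mem_interior_iff_mem_nhds]
  filter_upwards [M.eventually_two_sides hs ht hfs hft hf hst hd hx] with x h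
  rcases h.2.2 with h | h
  · exact M.convexHull_subset_closure hs h
  · exact M.convexHull_subset_closure ht h

end TwoCells

/-- Starting from a point of the open face, a small step away from `s` stays in the domain, hence
ends in some element. That element contains `f` because it is close to the point, and it is not `s`
because a coordinate of `s` is negative there. -/
theorem exists_second_cell (hd : 0 < d) {f s : Finset (E d)} (hf : f.card = d) (hs : s ∈ M.star f)
    (hΩ : IsPolytopalDomain Ω) (hfΩ : openHull f ⊆ Ω) : ∃ t ∈ M.star f, s ≠ t := by
  rw [mem_star] at hs
  have hs' := M.isFullSimplex s hs.1
  have hne : f.Nonempty := by rw [← Finset.card_pos]; omega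
  obtain ⟨x₀, hx₀⟩ := openHull_nonempty hne
  have hc : Tendsto (fun r : ℝ => AffineMap.lineMap x₀ (oppositeVertex f s) r) (𝓝[<] 0)
      (𝓝 x₀) := by
    have : Continuous (fun r : ℝ => (AffineMap.lineMap x₀ (oppositeVertex f s) r : E d)) :=
      AffineMap.lineMap_continuous
    simpa using (this.tendsto 0).mono_left nhdsWithin_le_nhds
  obtain ⟨r, ⟨h1, h2⟩, hr⟩ := ((hc.eventually ((M.eventually_mem_convexHull x₀).and
    (hΩ.isOpen.mem_nhds (hfΩ hx₀)))).and self_mem_nhdsWithin).exists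
  obtain ⟨t, ht, hxt⟩ := M.exists_cell_of_mem (subset_closure h2)
  refine ⟨t, M.mem_star.2 ⟨ht, M.subset_of_mem_convexHull hs.1 hs.2 hx₀ ht (h1 t ht hxt)⟩, ?_⟩
  rintro rfl
  have := (hs'.mem_convexHull_self_iff).1 hxt _ (oppositeVertex_mem hs' hs.2 hf)
  rw [AffineMap.apply_lineMap, bary_opposite_of_mem_openHull hs' hs.2 hf hx₀,
        bary_opposite_self hs' hs.2 hf] at this
  simp [AffineMap.lineMap_apply] at this
  exact absurd hr (by simpa using this)

end SimplicialMesh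

/-! ### Connectedness of stars through faces -/

theorem affineSpan_ne_top_of_card_le {s : Finset (E d)} (h0 : s.Nonempty) (hs : s.card ≤ d) :
    affineSpan ℝ (s : Set (E d)) ≠ ⊤ := by
  classical
  intro h
  obtain ⟨n, hn⟩ : ∃ n, s.card = n + 1 := ⟨s.card - 1, by have := h0.card_pos; omega⟩
  have h1 := finrank_vectorSpan_image_finset_le ℝ (id : E d → E d) s hn
  have h2 : vectorSpan ℝ (s : Set (E d)) = ⊤ := by
    rw [← direction_affineSpan, h, AffineSubspace.direction_top]
  rw [Finset.image_id, h2, finrank_top, finrank_euclideanSpace, Fintype.card_fin] at h1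
  omega

namespace SimplicialMesh

variable {Ω : Set (E d)} (M : SimplicialMesh Ω)

open Classical in
/-- The union of the closed elements with a given property. -/
def region (Q : Finset (E d) → Prop) : Set (E d) :=
  ⋃ t ∈ M.cells.filter Q, convexHull ℝ (t : Set (E d))

theorem mem_region {Q : Finset (E d) → Prop} {x : E d} :
    x ∈ M.region Q ↔ ∃ t ∈ M.cells, Q t ∧ x ∈ convexHull ℝ (t : Set (E d)) := by
  simp [region, and_assoc]

theorem isClosed_region (Q : Finset (E d) → Prop) : IsClosed (M.region Q) :=
  Set.Finite.isClosed_biUnion (Finset.finite_toSet _) fun s _ => isClosed_convexHull s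

theorem closure_subset_region (Q : Finset (E d) → Prop) :
    closure Ω ⊆ M.region Q ∪ M.region (fun t => ¬ Q t) := by
  intro x hx
  obtain ⟨t, ht, hxt⟩ := M.exists_cell_of_mem hx
  by_cases h : Q t
  · exact Or.inl (M.mem_region.2 ⟨t, ht, h, hxt⟩)
  · exact Or.inr (M.mem_region.2 ⟨t, ht, h, hxt⟩)

/-- The elements with `Q` and those without `Q` form two closed sets that cover `S`; if `S` is
connected and meets both, they have a common point in `S`. -/
theorem exists_mem_region_inter (Q : Finset (E d) → Prop) {S : Set (E d)} (hS : IsPreconnected S)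
    (hSΩ : S ⊆ closure Ω) {s t : Finset (E d)} (hs : s ∈ M.cells) (ht : t ∈ M.cells) (hQs : Q s)
    (hQt : ¬ Q t) {y z : E d} (hy : y ∈ S) (hys : y ∈ convexHull ℝ (s : Set (E d))) (hz : z ∈ S)
    (hzt : z ∈ convexHull ℝ (t : Set (E d))) :
    ∃ p ∈ S, ∃ a ∈ M.cells, ∃ b ∈ M.cells, Q a ∧ ¬ Q b ∧
      p ∈ convexHull ℝ (a : Set (E d)) ∧ p ∈ convexHull ℝ (b : Set (E d)) := by
  obtain ⟨p, hp, h1, h2⟩ := isPreconnected_closed_iff.1 hS _ _ (M.isClosed_region Q)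
    (M.isClosed_region fun t => ¬ Q t) (hSΩ.trans (M.closure_subset_region Q))
    ⟨y, hy, M.mem_region.2 ⟨s, hs, hQs, hys⟩⟩ ⟨z, hz, M.mem_region.2 ⟨t, ht, hQt, hzt⟩⟩
  obtain ⟨a, ha, hQa, hpa⟩ := M.mem_region.1 h1
  obtain ⟨b, hb, hQb, hpb⟩ := M.mem_region.1 h2
  exact ⟨p, hp, a, ha, b, hb, hQa, hQb, hpa, hpb⟩

open Classical in
/-- The elements around an interior point are connected through faces. -/
theorem face_connected_at_interior (hΩ : IsPolytopalDomain Ω) {x : E d}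
    (hx : x ∈ Ω) (Q : Finset (E d) → Prop)
    (hQ : ∀ s ∈ M.cells, ∀ t ∈ M.cells, x ∈ convexHull ℝ (s : Set (E d)) →
      x ∈ convexHull ℝ (t : Set (E d)) → s ≠ t → (s ∩ t).card = d → Q s → Q t)
    {s t : Finset (E d)} (hs : s ∈ M.cells) (ht : t ∈ M.cells)
    (hxs : x ∈ convexHull ℝ (s : Set (E d))) (hxt : x ∈ convexHull ℝ (t : Set (E d)))
    (hQs : Q s) : Q t := by
  by_contra hQt
  obtain ⟨ε, hε, hball⟩ := Metric.eventually_nhds_iff_ball.1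
    ((M.eventually_mem_convexHull x).and (hΩ.isOpen.mem_nhds hx))
  have hs' := M.isFullSimplex s hs
  have ht' := M.isFullSimplex t ht
  obtain ⟨y, hyb, hys⟩ := mem_closure_iff_nhds.1
    (convexHull_subset_closure_openHull hs'.nonempty hxs) _ (Metric.ball_mem_nhds x hε)
  obtain ⟨z₀, hz₀⟩ := mem_closure_iff_nhds.1
    (convexHull_subset_closure_openHull ht'.nonempty hxt) _ (Metric.ball_mem_nhds x hε)
  -- Points `z` for which the segment from `y` might pass through an intersection of two elements
  -- with fewer than `d` common vertices. Together with `y` such an intersection is spanned by at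
  -- most `d` points, so the set is null and `z` can be chosen outside it. The segment then changes
  -- elements only through faces.
  let bad : Set (E d) := ⋃ p ∈ (M.cells ×ˢ M.cells).filter (fun p => (p.1 ∩ p.2).card < d),
    (affineSpan ℝ ((insert y (p.1 ∩ p.2) : Finset (E d)) : Set (E d)) : Set (E d))
  have hbad : volume bad = 0 := by
    refine (measure_biUnion_null_iff (Finset.countable_toSet _)).2 fun p hp => ?_
    refine Measure.addHaar_affineSubspace volume _
      (affineSpan_ne_top_of_card_le (Finset.insert_nonempty _ _) ?_)
    have : (p.1 ∩ p.2).card < d := (Finset.mem_filter.1 hp).2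
    exact (Finset.card_insert_le _ _).trans this
  obtain ⟨z, hz, hzbad⟩ : ∃ z ∈ Metric.ball x ε ∩ openHull t, z ∉ bad := by
    by_contra! h
    have hopen := (Metric.isOpen_ball (x := x) (ε := ε)).inter ht'.isOpen_openHull
    exact (hopen.measure_pos volume ⟨z₀, hz₀⟩).ne' (measure_mono_null h hbad)
  have hseg : segment ℝ y z ⊆ Metric.ball x ε := (convex_ball x ε).segment_subset hyb hz.1
  obtain ⟨p, hp, a, ha, b, hb, hQa, hQb, hpa, hpb⟩ := M.exists_mem_region_inter Q
    (convex_segment y z).isPreconnected (fun p hp => subset_closure (hball p (hseg hp)).2) hs ht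
    hQs hQt (left_mem_segment ℝ y z) (openHull_subset_convexHull s hys) (right_mem_segment ℝ y z)
    (openHull_subset_convexHull t hz.2)
  have hab : a ≠ b := fun h => hQb (h ▸ hQa)
  have hxa := (hball p (hseg hp)).1 a ha hpa
  have hxb := (hball p (hseg hp)).1 b hb hpb
  have hcard : (a ∩ b).card < d := by
    have h1 : (a ∩ b).card ≤ d := by
      by_contra! h
      have ha' := (M.isFullSimplex a ha).1
      have hb' := (M.isFullSimplex b hb).1
      have h1 := Finset.eq_of_subset_of_card_le (Finset.inter_subset_left (s₁ := a) (s₂ := b))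
        (by omega)
      have h2 := Finset.eq_of_subset_of_card_le (Finset.inter_subset_right (s₁ := a) (s₂ := b))
        (by omega)
      exact hab (h1.symm.trans h2)
    exact lt_of_le_of_ne h1 fun h => hQb (hQ a ha b hb hxa hxb hab h hQa)
  have hpab := M.regular a ha b hb hab ⟨hpa, hpb⟩
  rw [segment_eq_image_lineMap] at hp
  obtain ⟨u, -, rfl⟩ := hp
  -- At `u = 0` the crossing point is `y`, which lies in the open element `s` and hence in no other
  -- element. Otherwise `z` lies on the line through `y` and the crossing point, hence in the bad
  -- set.
  by_cases hu : u = 0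
  · subst hu
    rw [AffineMap.lineMap_apply_zero] at hpa hpb
    exact hab ((M.eq_of_mem_openHull hs hys ha hpa).symm.trans (M.eq_of_mem_openHull hs hys hb hpb))
  · apply hzbad
    simp only [bad, Set.mem_iUnion]
    refine ⟨(a, b), by simp [ha, hb, hcard], ?_⟩
    have h1 : AffineMap.lineMap y z u ∈
        affineSpan ℝ ((insert y (a ∩ b) : Finset (E d)) : Set (E d)) := by
      refine convexHull_subset_affineSpan _ (convexHull_mono ?_ hpab)
      intro q hq
      have : q ∈ a ∩ b := by convert! hq
      simp only [Finset.coe_insert]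
      exact Or.inr this
    have h2 : y ∈ affineSpan ℝ ((insert y (a ∩ b) : Finset (E d)) : Set (E d)) :=
      subset_affineSpan ℝ _ (by simp)
    have h3 : z = AffineMap.lineMap y (AffineMap.lineMap y z u : E d) u⁻¹ := by
      simp [AffineMap.lineMap_apply, smul_smul, hu]
    rw [h3]
    exact AffineMap.lineMap_mem _ h2 h1

open Classical in
/-- The star of a subsimplex is connected through faces if `Ω` does not touch itself. -/
theorem face_connected_star (hΩ : IsPolytopalDomain Ω) (hc : LocallyConnectedUpToBoundary Ω)
    {i : Finset (E d)} (hi : i.Nonempty) (Q : Finset (E d) → Prop)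
    (hQ : ∀ s ∈ M.star i, ∀ t ∈ M.star i, s ≠ t → (s ∩ t).card = d → Q s → Q t)
    {s t : Finset (E d)} (hs : s ∈ M.star i) (ht : t ∈ M.star i) (hQs : Q s) : Q t := by
  by_contra hQt
  rw [mem_star] at hs ht
  obtain ⟨x, hx⟩ := openHull_nonempty hi
  have hmem : ∀ r ∈ M.cells, i ⊆ r → x ∈ convexHull ℝ (r : Set (E d)) := fun r _ hir =>
    convexHull_mono (by exact_mod_cast hir) (openHull_subset_convexHull i hx)
  obtain ⟨V, hV, hVU, hVc⟩ := hc x (M.convexHull_subset_closure hs.1 (hmem s hs.1 hs.2)) _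
    (M.eventually_mem_convexHull x)
  have hex : ∀ r ∈ M.cells, i ⊆ r → ∃ y ∈ V ∩ Ω, y ∈ convexHull ℝ (r : Set (E d)) := by
    intro r hr hir
    obtain ⟨y, hyV, hyr⟩ := mem_closure_iff_nhds.1 (convexHull_subset_closure_openHull
      (M.isFullSimplex r hr).nonempty (hmem r hr hir)) V hV
    exact ⟨y, ⟨hyV, M.openHull_subset hΩ hr hyr⟩, openHull_subset_convexHull r hyr⟩
  obtain ⟨y, hy, hys⟩ := hex s hs.1 hs.2
  obtain ⟨z, hz, hzt⟩ := hex t ht.1 ht.2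
  obtain ⟨p, hp, a, ha, b, hb, hQa, hQb, hpa, hpb⟩ := M.exists_mem_region_inter Q hVc
    (fun p hp => subset_closure hp.2) hs.1 ht.1 hQs hQt hy hys hz hzt
  have hstar : ∀ r ∈ M.cells, p ∈ convexHull ℝ (r : Set (E d)) → r ∈ M.star i := fun r hr hpr =>
    M.mem_star.2 ⟨hr, M.subset_of_mem_convexHull hs.1 hs.2 hx hr (hVU hp.1 r hr hpr)⟩
  -- The crossing point lies in the domain itself, not only in its closure, so the interior result
  -- applies; by the choice of `V`, all elements around this point belong to the star of `i`.
  exact hQb (M.face_connected_at_interior hΩ hp.2 Q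
    (fun a ha b hb hpa hpb => hQ a (hstar a ha hpa) b (hstar b hb hpb)) ha hb hpa hpb hQa)

end SimplicialMesh

/-! ### Bases of abstract finite element spaces -/

theorem coeFn_sum_smul {Ω : Set (E d)} {m : ℕ} {ι : Type*} (s : Finset ι) (c : ι → ℝ)
    (v : ι → FunctionClass Ω m) :
    ∀ᵐ x ∂(volume.restrict Ω),
      (∑ i ∈ s, c i • v i : FunctionClass Ω m) x = ∑ i ∈ s, c i • v i x := by
  classical
  induction s using Finset.induction_on with
  | empty =>
    filter_upwards [AEEqFun.coeFn_zero (β := E m) (μ := (volume : Measure (E d)).restrict Ω)]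
      with x hx
    simpa using hx
  | insert a s ha ih =>
    rw [Finset.sum_insert ha]
    filter_upwards [ih, AEEqFun.coeFn_add (c a • v a) (∑ i ∈ s, c i • v i),
      AEEqFun.coeFn_smul (c a) (v a)] with x h1 h2 h3
    rw [h2, Pi.add_apply, h1, h3, Pi.smul_apply, Finset.sum_insert ha]

namespace SimplicialMesh

variable {Ω : Set (E d)} (M : SimplicialMesh Ω)

/-- Inside the open element the set where `A` does not vanish is open and null, hence empty; by
continuity `A` vanishes at the vertices too. -/
theorem affine_eq_zero_of_ae (hΩ : IsPolytopalDomain Ω) {W : Type*} [NormedAddCommGroup W]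
    [NormedSpace ℝ W] {t : Finset (E d)} (ht : t ∈ M.cells) (A : E d →ᵃ[ℝ] W)
    (h : ∀ᵐ x ∂(volume.restrict Ω), x ∈ openHull t → A x = 0) : A = 0 := by
  have ht' := M.isFullSimplex t ht
  have h1 : ∀ x ∈ openHull t, A x = 0 := by
    rw [ae_restrict_iff' hΩ.isOpen.measurableSet] at h
    have hopen : IsOpen (openHull t ∩ {x | A x ≠ 0}) :=
      ht'.isOpen_openHull.inter (isOpen_ne_fun (continuous_affineMap A) continuous_const)
    have hnull : volume (openHull t ∩ {x | A x ≠ 0}) = 0 := by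
      refine measure_mono_null ?_ h
      rintro x ⟨hx, hx'⟩ hh
      exact hx' (hh (M.openHull_subset hΩ ht hx) hx)
    replace hnull := (hopen.measure_eq_zero_iff volume).1 hnull
    intro x hx
    by_contra hx'
    have : x ∈ openHull t ∩ {x | A x ≠ 0} := ⟨hx, hx'⟩
    rw [hnull] at this
    exact this
  exact ht'.affine_ext fun y hy => by
    rw [face_affine_eq_zero ht'.nonempty A h1 hy]; rfl

/-- A description of a finite element space `V` by a local space `P` of affine maps and degrees of
freedom `dof i`, dual to the functions `θ i`, whose restrictions to the elements are `loc i t`. -/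
structure FEData (m : ℕ) (V : Submodule ℝ (FunctionClass Ω m)) (N : Finset (Finset (E d)))
    (θ : Finset (E d) → E d → E m) where
  P : Submodule ℝ (E d → E m)
  affine : ∀ p ∈ P, ∃ A : E d →ᵃ[ℝ] E m, p = A
  loc : Finset (E d) → Finset (E d) → E d → E m
  dof : Finset (E d) → (E d → E m) →ₗ[ℝ] ℝ
  star_nonempty : ∀ i ∈ N, (M.star i).Nonempty
  loc_mem : ∀ i ∈ N, ∀ t ∈ M.star i, loc i t ∈ P
  shape_eq : ∀ i ∈ N, ∀ t ∈ M.star i, ∀ x ∈ openHull t, θ i x = loc i t x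
  shape_eq_zero : ∀ i ∈ N, ∀ t ∈ M.cells, ¬ i ⊆ t → ∀ x ∈ openHull t, θ i x = 0
  -- The value need not be `1`, only nonzero and the same on all adjacent elements; this leaves the
  -- scaling of the Raviart-Thomas functionals free.
  dof_self : ∀ i ∈ N, ∃ c : ℝ, c ≠ 0 ∧ ∀ t ∈ M.star i, dof i (loc i t) = c
  dof_other : ∀ i ∈ N, ∀ j ∈ N, i ≠ j → ∀ t ∈ M.cells, i ⊆ t → j ⊆ t → dof j (loc i t) = 0
  unisolvent : ∀ p ∈ P, ∀ t ∈ M.cells, (∀ i ∈ N, i ⊆ t → dof i p = 0) → p = 0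
  mem_iff : ∀ v : FunctionClass Ω m, v ∈ V ↔ ∃ p : Finset (E d) → E d → E m,
    (∀ t ∈ M.cells, p t ∈ P) ∧
    (∀ t ∈ M.cells, ∀ᵐ x ∂(volume.restrict Ω), x ∈ openHull t → v x = p t x) ∧
    ∀ i ∈ N, ∀ s ∈ M.star i, ∀ t ∈ M.star i, dof i (p s) = dof i (p t)

namespace FEData

variable {M} {m : ℕ} {V : Submodule ℝ (FunctionClass Ω m)} {N : Finset (Finset (E d))}
  {θ : Finset (E d) → E d → E m} (D : M.FEData m V N θ)
include D

open Classical in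
/-- The restriction of `θ i` to the element `t`, extended to an element of the local space. -/
def ext (i t : Finset (E d)) : E d → E m := if i ⊆ t then D.loc i t else 0

theorem shape_eq_ext {i t : Finset (E d)} (hi : i ∈ N) (ht : t ∈ M.cells) {x : E d}
    (hx : x ∈ openHull t) : θ i x = D.ext i t x := by
  unfold ext
  split_ifs with h
  · exact D.shape_eq i hi t (M.mem_star.2 ⟨ht, h⟩) x hx
  · exact D.shape_eq_zero i hi t ht h x hx

theorem ext_mem {i t : Finset (E d)} (hi : i ∈ N) (ht : t ∈ M.cells) : D.ext i t ∈ D.P := by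
  unfold ext
  split_ifs with h
  · exact D.loc_mem i hi t (M.mem_star.2 ⟨ht, h⟩)
  · exact D.P.zero_mem

theorem dof_ext {i j t : Finset (E d)} (hi : i ∈ N) (hj : j ∈ N) (hij : i ≠ j) (ht : t ∈ M.cells)
    (hjt : j ⊆ t) : D.dof j (D.ext i t) = 0 := by
  unfold ext
  split_ifs with h
  · exact D.dof_other i hi j hj hij t ht h hjt
  · exact map_zero _

theorem ext_of_mem {i t : Finset (E d)} (ht : t ∈ M.star i) : D.ext i t = D.loc i t :=
  if_pos (M.mem_star.1 ht).2

theorem dof_ext_self_congr {i s t : Finset (E d)} (hi : i ∈ N) (hs : s ∈ M.star i)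
    (ht : t ∈ M.star i) : D.dof i (D.ext i s) = D.dof i (D.ext i t) := by
  obtain ⟨c, -, hc⟩ := D.dof_self i hi
  rw [D.ext_of_mem hs, D.ext_of_mem ht, hc s hs, hc t ht]

theorem dof_ext_self_ne {i t : Finset (E d)} (hi : i ∈ N) (ht : t ∈ M.star i) :
    D.dof i (D.ext i t) ≠ 0 := by
  obtain ⟨c, hc0, hc⟩ := D.dof_self i hi
  rw [D.ext_of_mem ht, hc t ht]
  exact hc0

theorem continuous_of_mem {p : E d → E m} (hp : p ∈ D.P) : Continuous p := by
  obtain ⟨A, rfl⟩ := D.affine p hp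
  exact continuous_affineMap A

theorem eq_zero_of_ae (hΩ : IsPolytopalDomain Ω) {t : Finset (E d)} (ht : t ∈ M.cells)
    {p : E d → E m} (hp : p ∈ D.P)
    (h : ∀ᵐ x ∂(volume.restrict Ω), x ∈ openHull t → p x = 0) : p = 0 := by
  obtain ⟨A, rfl⟩ := D.affine p hp
  rw [M.affine_eq_zero_of_ae hΩ ht A h]
  rfl

theorem aestronglyMeasurable_shape (hΩ : IsPolytopalDomain Ω) {i : Finset (E d)} (hi : i ∈ N) :
    AEStronglyMeasurable (θ i) ((volume : Measure (E d)).restrict Ω) := by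
  refine ⟨fun x => ∑ t ∈ M.cells, (openHull t).indicator (D.ext i t) x, ?_, ?_⟩
  · exact Finset.stronglyMeasurable_fun_sum _ fun t ht =>
      (D.continuous_of_mem (D.ext_mem hi ht)).stronglyMeasurable.indicator
        (M.isFullSimplex t ht).isOpen_openHull.measurableSet
  · filter_upwards [M.ae_mem_openHull hΩ] with x ⟨t, ht, hx⟩
    rw [Finset.sum_eq_single_of_mem t ht, Set.indicator_of_mem hx, D.shape_eq_ext hi ht hx]
    intro s hs hst
    exact Set.indicator_of_notMem (fun hxs =>
      Set.disjoint_left.1 (M.disjoint s hs t ht hst) hxs hx) _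

/-- The class of the function `θ i`. -/
def shapeClass (hΩ : IsPolytopalDomain Ω) (i : N) : FunctionClass Ω m :=
  AEEqFun.mk (θ i) (D.aestronglyMeasurable_shape hΩ i.2)

theorem shapeClass_ae (hΩ : IsPolytopalDomain Ω) (i : N) :
    (D.shapeClass hΩ i : E d → E m) =ᵐ[volume.restrict Ω] θ i :=
  AEEqFun.coeFn_mk _ _

theorem shapeClass_mem (hΩ : IsPolytopalDomain Ω) (i : N) : D.shapeClass hΩ i ∈ V := by
  rw [D.mem_iff]
  refine ⟨D.ext i, fun t ht => D.ext_mem i.2 ht, fun t ht => ?_, fun j hj s hs t ht => ?_⟩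
  · filter_upwards [D.shapeClass_ae hΩ i] with x hx hxt
    rw [hx, D.shape_eq_ext i.2 ht hxt]
  · by_cases hij : (i : Finset (E d)) = j
    · subst hij
      exact D.dof_ext_self_congr hj hs ht
    · rw [D.dof_ext i.2 hj hij (M.mem_star.1 hs).1 (M.mem_star.1 hs).2,
        D.dof_ext i.2 hj hij (M.mem_star.1 ht).1 (M.mem_star.1 ht).2]

theorem dof_sum {t : Finset (E d)} (c : N → ℝ) (j : N) (ht : t ∈ M.star j) :
    D.dof j (∑ i : N, c i • D.ext i t) = c j * D.dof j (D.ext j t) := by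
  rw [map_sum, Finset.sum_eq_single_of_mem j (Finset.mem_univ j), map_smul, smul_eq_mul]
  intro i _ hij
  rw [map_smul, D.dof_ext i.2 j.2 (fun h => hij (Subtype.ext h)) (M.mem_star.1 ht).1
    (M.mem_star.1 ht).2, smul_zero]

theorem sum_shapeClass_ae (hΩ : IsPolytopalDomain Ω) (c : N → ℝ) :
    ∀ᵐ x ∂(volume.restrict Ω), ∀ t ∈ M.cells, x ∈ openHull t →
      (∑ i : N, c i • D.shapeClass hΩ i : FunctionClass Ω m) x = (∑ i : N, c i • D.ext i t) x := by
  have h : ∀ᵐ x ∂(volume.restrict Ω), ∀ i : N, D.shapeClass hΩ i x = θ i x :=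
    ae_all_iff.2 fun i => D.shapeClass_ae hΩ i
  filter_upwards [coeFn_sum_smul Finset.univ c (D.shapeClass hΩ), h] with x h1 h2 t ht hxt
  rw [h1, Finset.sum_apply]
  exact Finset.sum_congr rfl fun i _ => by
    rw [h2, D.shape_eq_ext i.2 ht hxt, Pi.smul_apply]

/-- Independence: on an element adjacent to `j`, an identity almost everywhere between combinations
is an identity of affine maps, and `dof j` isolates the `j`-th coefficient. Spanning: the quotient
of degrees of freedom that defines the coefficient does not depend on the adjacent element, so on
every element the combination has the same degrees of freedom as the given function, and unisolvence
applies. -/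
theorem exists_basis (hΩ : IsPolytopalDomain Ω) : ∃ b : Module.Basis N ℝ V,
    ∀ i, ((b i : FunctionClass Ω m) : E d → E m) =ᵐ[volume.restrict Ω] θ i := by
  let w : N → V := fun i => ⟨D.shapeClass hΩ i, D.shapeClass_mem hΩ i⟩
  have hw : ∀ c : N → ℝ, ((∑ i : N, c i • w i : V) : FunctionClass Ω m) =
      ∑ i : N, c i • D.shapeClass hΩ i := fun c => by simp [w]
  have hsumP : ∀ (c : N → ℝ) (t), t ∈ M.cells → ∑ i : N, c i • D.ext i t ∈ D.P := fun c t ht =>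
    D.P.sum_mem fun i _ => D.P.smul_mem _ (D.ext_mem i.2 ht)
  have hli : LinearIndependent ℝ w := by
    refine Fintype.linearIndependent_iffₛ.2 fun c e hc j => ?_
    have h0 : (∑ i : N, c i • D.shapeClass hΩ i) = ∑ i : N, e i • D.shapeClass hΩ i := by
      rw [← hw, ← hw, hc]
    obtain ⟨t, ht⟩ := D.star_nonempty j j.2
    have htc := (M.mem_star.1 ht).1
    have h1 : (∑ i : N, c i • D.ext i t) - ∑ i : N, e i • D.ext i t = 0 := by
      refine D.eq_zero_of_ae hΩ htc (D.P.sub_mem (hsumP c t htc) (hsumP e t htc)) ?_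
      filter_upwards [D.sum_shapeClass_ae hΩ c, D.sum_shapeClass_ae hΩ e] with x hx hx0 hxt
      rw [Pi.sub_apply, ← hx t htc hxt, ← hx0 t htc hxt, h0, sub_self]
    have h2 := D.dof_sum c j ht
    rw [sub_eq_zero.1 h1, D.dof_sum e j ht] at h2
    exact (mul_right_cancel₀ (D.dof_ext_self_ne j.2 ht) h2).symm
  have hsp : ⊤ ≤ Submodule.span ℝ (Set.range w) := by
    rintro v -
    obtain ⟨p, hpP, hpv, hpd⟩ := (D.mem_iff v).1 v.2
    choose τ hτ using fun i : N => D.star_nonempty i i.2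
    -- The element `τ i` is an arbitrary one around `i`; both numerator and denominator take the
    -- same values on all other adjacent elements.
    let c : N → ℝ := fun i => D.dof i (p (τ i)) / D.dof i (D.ext i (τ i))
    have hloc : ∀ t ∈ M.cells, p t = ∑ i : N, c i • D.ext i t := by
      intro t ht
      rw [← sub_eq_zero]
      refine D.unisolvent _ (D.P.sub_mem (hpP t ht) (hsumP c t ht)) t ht fun j hj hjt => ?_
      have hts := M.mem_star.2 ⟨ht, hjt⟩
      rw [map_sub, D.dof_sum c ⟨j, hj⟩ hts, sub_eq_zero]
      simp only [c]
      rw [D.dof_ext_self_congr hj hts (hτ ⟨j, hj⟩),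
        div_mul_cancel₀ _ (D.dof_ext_self_ne hj (hτ ⟨j, hj⟩))]
      exact hpd j hj t hts _ (hτ ⟨j, hj⟩)
    have hv : v = ∑ i : N, c i • w i := by
      refine Subtype.ext ?_
      rw [hw]
      refine AEEqFun.ext ?_
      have hpv' : ∀ᵐ x ∂(volume.restrict Ω), ∀ t ∈ M.cells, x ∈ openHull t →
          (v : FunctionClass Ω m) x = p t x := (ae_ball_iff M.cells.countable_toSet).2 hpv
      filter_upwards [M.ae_mem_openHull hΩ, hpv', D.sum_shapeClass_ae hΩ c] with x ⟨t, ht, hxt⟩ h1 h2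
      rw [h1 t ht hxt, h2 t ht hxt, hloc t ht]
    rw [hv]
    exact Submodule.sum_mem _ fun i _ =>
      Submodule.smul_mem _ _ (Submodule.subset_span ⟨i, rfl⟩)
  refine ⟨Module.Basis.mk hli hsp, fun i => ?_⟩
  rw [Module.Basis.mk_apply]
  exact D.shapeClass_ae hΩ i

end FEData

end SimplicialMesh

/-! ### Networks with layers indexed by finite types -/

section Reindex

variable {α β : Type*} [Fintype α] [Fintype β] {n k m : ℕ}

/-- A layer whose units are indexed by arbitrary finite types. -/
def consReindex (e₀ : α ≃ Fin n) (e₁ : β ≃ Fin k) (hk : 0 < k) (A : Matrix β α ℝ) (b : β → ℝ)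
    (ϱ : β → ℝ → ℝ) (rest : HiddenLayers k m) : HiddenLayers n m :=
  .cons hk (A.submatrix e₁.symm e₀.symm) (b ∘ e₁.symm) (ϱ ∘ e₁.symm) rest

omit [Fintype β] in
theorem realize_consReindex (e₀ : α ≃ Fin n) (e₁ : β ≃ Fin k) (hk : 0 < k) (A : Matrix β α ℝ)
    (b : β → ℝ) (ϱ : β → ℝ → ℝ) (rest : HiddenLayers k m) (x : α → ℝ) :
    (consReindex e₀ e₁ hk A b ϱ rest).realize (x ∘ e₀.symm) =
      rest.realize ((fun i => ϱ i ((A *ᵥ x) i + b i)) ∘ e₁.symm) := by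
  simp only [consReindex, HiddenLayers.realize]
  congr 1
  funext j
  have : (x ∘ e₀.symm) ∘ e₀ = x := by funext i; simp
  rw [Matrix.submatrix_mulVec_equiv, Equiv.symm_symm, this]
  rfl

omit [Fintype α] [Fintype β] in
theorem ncard_submatrix (e₀ : α ≃ Fin n) (e₁ : β ≃ Fin k) (A : Matrix β α ℝ) :
    Set.ncard {p : Fin k × Fin n | (A.submatrix e₁.symm e₀.symm) p.1 p.2 ≠ 0} =
      Set.ncard {p : β × α | A p.1 p.2 ≠ 0} := by
  rw [← Set.ncard_image_of_injective _ (Equiv.prodCongr e₁.symm e₀.symm).injective]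
  congr 1
  ext ⟨i, j⟩
  simp only [Set.mem_image, Set.mem_ofPred_eq, Equiv.prodCongr_apply]
  constructor
  · rintro ⟨⟨a, b⟩, h, h'⟩
    simp only [Prod.map_apply, Prod.mk.injEq] at h'
    simpa [← h'.1, ← h'.2] using h
  · intro h
    exact ⟨(e₁ i, e₀ j), by simpa using h, by simp⟩

omit [Fintype α] in
theorem ncard_support_le (A : Matrix β α ℝ) (S : β → Finset α) (hS : ∀ i j, A i j ≠ 0 → j ∈ S i) :
    Set.ncard {p : β × α | A p.1 p.2 ≠ 0} ≤ ∑ i, (S i).card := by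
  classical
  rw [← Finset.card_sigma]
  rw [← Set.ncard_coe_finset]
  refine Set.ncard_le_ncard_of_injOn (fun p => ⟨p.1, p.2⟩) (fun p hp => ?_) (fun p _ q _ h => ?_)
    (Finset.finite_toSet _)
  · simpa using hS _ _ hp
  · cases p; cases q; simpa using h

omit [Fintype α] in
/-- A row-wise bound on the number of weights gives a bound on the size of a layer. -/
theorem size_consReindex_le (e₀ : α ≃ Fin n) (e₁ : β ≃ Fin k) (hk : 0 < k) (A : Matrix β α ℝ)
    (b : β → ℝ) (ϱ : β → ℝ → ℝ) (rest : HiddenLayers k m) (S : β → Finset α)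
    (hS : ∀ i j, A i j ≠ 0 → j ∈ S i) :
    (consReindex e₀ e₁ hk A b ϱ rest).size ≤ ∑ i, (S i).card + k + rest.size := by
  have h1 := ncard_submatrix e₀ e₁ A
  have h2 := ncard_support_le A S hS
  have h3 : Set.ncard {j | (b ∘ e₁.symm) j ≠ 0} ≤ k := by
    have := Set.ncard_le_card {j : Fin k | (b ∘ e₁.symm) j ≠ 0}
    simpa using this
  simp only [consReindex, HiddenLayers.size]
  omega

end Reindex

/-! ### The indicator function of a simplex and its product with an affine function -/

theorem bisu_of_pos {x : ℝ} (h : 0 < x) : bisu x = 1 := by simp [bisu, h]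

theorem bisu_of_nonpos {x : ℝ} (h : x ≤ 0) : bisu x = 0 := by simp [bisu, h]

theorem bisu_le_one (x : ℝ) : bisu x ≤ 1 := by unfold bisu; split_ifs <;> norm_num

-- A sum of `d + 1` numbers from `{0, 1}` exceeds `d + 1/2` only if all of them are `1`. The value
-- of `bisu` at `0` is `0`, so that strict inequalities, and thus open simplices, are detected.
open Classical in
theorem bisu_sum_bisu {d : ℕ} (h : Fin (d + 1) → ℝ) :
    bisu (∑ r, bisu (h r) + -(d + 1 / 2 : ℝ)) = if ∀ r, 0 < h r then 1 else 0 := by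
  split_ifs with H
  · refine bisu_of_pos ?_
    rw [Finset.sum_congr rfl fun r _ => bisu_of_pos (H r)]
    simp only [Finset.sum_const, Finset.card_univ, Fintype.card_fin, nsmul_eq_mul, mul_one]
    push_cast
    linarith
  · refine bisu_of_nonpos ?_
    push Not at H
    obtain ⟨r, hr⟩ := H
    have h1 := Finset.add_sum_erase Finset.univ (fun r => bisu (h r)) (Finset.mem_univ r)
    have h2 : ∑ r ∈ Finset.univ.erase r, bisu (h r) ≤ ∑ r ∈ Finset.univ.erase r, (1 : ℝ) :=
      Finset.sum_le_sum fun r _ => bisu_le_one _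
    simp only [bisu_of_nonpos hr, Finset.sum_const, Finset.card_erase_of_mem (Finset.mem_univ r),
      Finset.card_univ, Fintype.card_fin, Nat.add_sub_cancel, nsmul_eq_mul, mul_one] at h1 h2
    linarith

theorem relu_of_nonneg {x : ℝ} (h : 0 ≤ x) : relu x = x := max_eq_right h

theorem relu_of_nonpos {x : ℝ} (h : x ≤ 0) : relu x = 0 := max_eq_left h

theorem relu_nonneg (x : ℝ) : 0 ≤ relu x := le_max_left _ _

theorem relu_sub_relu_neg (x : ℝ) : relu x - relu (-x) = x := by
  rcases le_total 0 x with h | h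
  · rw [relu_of_nonneg h, relu_of_nonpos (by linarith)]; ring
  · rw [relu_of_nonpos h, relu_of_nonneg (by linarith)]; ring

/-- The signs `1` and `-1`. -/
def sgn : Fin 2 → ℝ := ![1, -1]

theorem sum_sgn_relu (x : ℝ) : ∑ s, sgn s * relu (sgn s * x) = x := by
  have := relu_sub_relu_neg x
  simp [sgn, Fin.sum_univ_two]
  linarith

/-- With the switch on, the two units carry the positive and negative parts of `p`. With the switch
off, the shift by `-R` makes both arguments nonpositive. -/
theorem sum_sgn_relu_cutoff {p R : ℝ} (hp : |p| ≤ R) (P : Prop) [Decidable P] :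
    ∑ s, sgn s * relu (sgn s * p + R * ((if P then 1 else 0) - 1)) = if P then p else 0 := by
  split_ifs with h
  · simpa using sum_sgn_relu p
  · have h1 := abs_le.1 hp
    simp [sgn, Fin.sum_univ_two]
    rw [relu_of_nonpos (by linarith), relu_of_nonpos (by linarith)]
    ring

section ElementNet

variable (N d m : ℕ)

/-- Units of the first hidden layer: half spaces and the input. -/
abbrev Units₁ : Type := (Fin N × Fin (d + 1)) ⊕ (Fin d × Fin 2)

/-- Units of the second hidden layer: elements and the input. -/
abbrev Units₂ : Type := Fin N ⊕ (Fin d × Fin 2)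

/-- Units of the third and fourth hidden layer: signed components. -/
abbrev Units₃ : Type := (Fin N × Fin m) × Fin 2

/-- Enumeration of the first layer. -/
def enum₁ : Units₁ N d ≃ Fin (N * (d + 1) + d * 2) :=
  (Equiv.sumCongr finProdFinEquiv finProdFinEquiv).trans finSumFinEquiv

/-- Enumeration of the second layer. -/
def enum₂ : Units₂ N d ≃ Fin (N + d * 2) :=
  (Equiv.sumCongr (Equiv.refl _) finProdFinEquiv).trans finSumFinEquiv

/-- Enumeration of the third layer. -/
def enum₃ : Units₃ N m ≃ Fin (N * m * 2) :=
  (Equiv.prodCongr finProdFinEquiv (Equiv.refl _)).trans finProdFinEquiv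

/-- BiSU on the first summand, ReLU on the second one. -/
def sumActivation {α β : Type} : α ⊕ β → ℝ → ℝ := Sum.elim (fun _ => bisu) (fun _ => relu)

/-- The activations of the network of depth five. -/
def deepActivations : List (List (ℝ → ℝ)) :=
  [List.ofFn (sumActivation ∘ (enum₁ N d).symm), List.ofFn (sumActivation ∘ (enum₂ N d).symm),
    List.ofFn ((fun _ => relu) ∘ (enum₃ N m).symm), List.ofFn ((fun _ => relu) ∘ (enum₃ N m).symm)]

/-- The activations of the network of depth three. -/
def shallowActivations : List (List (ℝ → ℝ)) :=
  [List.ofFn ((fun _ => bisu) ∘ (finProdFinEquiv (m := N) (n := d + 1)).symm),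
    List.ofFn ((fun _ => bisu) ∘ (Equiv.refl (Fin N)).symm)]

variable {N d m}

theorem deepActivations_spec {l : List (ℝ → ℝ)} (hl : l ∈ deepActivations N d m) {a : ℝ → ℝ}
    (ha : a ∈ l) : a = relu ∨ a = bisu := by
  have hsum : ∀ {α β : Type} (u : α ⊕ β), sumActivation u = relu ∨ sumActivation u = bisu := by
    rintro α β (u | u) <;> simp [sumActivation]
  simp only [deepActivations, List.mem_cons, List.not_mem_nil, or_false] at hl
  rcases hl with rfl | rfl | rfl | rfl <;> rw [List.mem_ofFn] at ha <;> obtain ⟨j, rfl⟩ := ha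
  · exact hsum _
  · exact hsum _
  · exact Or.inl rfl
  · exact Or.inl rfl

theorem shallowActivations_spec {l : List (ℝ → ℝ)} (hl : l ∈ shallowActivations N d) {a : ℝ → ℝ}
    (ha : a ∈ l) : a = relu ∨ a = bisu := by
  simp only [shallowActivations, List.mem_cons, List.not_mem_nil, or_false] at hl
  rcases hl with rfl | rfl <;> rw [List.mem_ofFn] at ha <;> obtain ⟨j, rfl⟩ := ha <;>
    exact Or.inr rfl

variable (Ha : Fin N → Fin (d + 1) → Fin d → ℝ) (Hb : Fin N → Fin (d + 1) → ℝ)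
  (pa : Fin N → Fin m → Fin d → ℝ) (pb : Fin N → Fin m → ℝ) (R : ℝ)

/-- Weights of the first layer. -/
def weight₁ : Matrix (Units₁ N d) (Fin d) ℝ
  | .inl q, j => Ha q.1 q.2 j
  | .inr l, j => if j = l.1 then sgn l.2 else 0

/-- Biases of the first layer. -/
def bias₁ : Units₁ N d → ℝ
  | .inl q => Hb q.1 q.2
  | .inr _ => 0

/-- Weights of the second layer. -/
def weight₂ : Matrix (Units₂ N d) (Units₁ N d) ℝ
  | .inl q, .inl p => if p.1 = q then 1 else 0
  | .inl _, .inr _ => 0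
  | .inr _, .inl _ => 0
  | .inr l, .inr p => if p = l then 1 else 0

/-- Biases of the second layer. -/
def bias₂ : Units₂ N d → ℝ
  | .inl _ => -(d + 1 / 2 : ℝ)
  | .inr _ => 0

/-- Weights of the third layer. -/
def weight₃ : Matrix (Units₃ N m) (Units₂ N d) ℝ
  | p, .inl q => if q = p.1.1 then R else 0
  | p, .inr l => sgn p.2 * pa p.1.1 p.1.2 l.1 * sgn l.2

/-- Biases of the third layer. -/
def bias₃ : Units₃ N m → ℝ := fun p => sgn p.2 * pb p.1.1 p.1.2 - R

open Classical in
/-- The indicator of an intersection of half spaces. -/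
def cutoff (q : Fin N) (x : Fin d → ℝ) : ℝ := if ∀ r, 0 < Ha q r ⬝ᵥ x + Hb q r then 1 else 0

theorem layer₁_inr (x : Fin d → ℝ) (l : Fin d × Fin 2) :
    sumActivation (Sum.inr l : Units₁ N d) ((weight₁ Ha *ᵥ x) (.inr l) + bias₁ Hb (.inr l)) =
      relu (sgn l.2 * x l.1) := by
  simp [sumActivation, Matrix.mulVec, dotProduct, weight₁, bias₁]

theorem layer₂_inl (y : Units₁ N d → ℝ) (q : Fin N) :
    (weight₂ *ᵥ y) (.inl q) = ∑ r, y (.inl (q, r)) := by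
  simp only [Matrix.mulVec, dotProduct, weight₂, Fintype.sum_sum_type, Fintype.sum_prod_type]
  rw [Finset.sum_eq_single_of_mem q (Finset.mem_univ q)]
  · simp
  · intro p _ hp
    simp [hp]

theorem layer₂_inr (y : Units₁ N d → ℝ) (l : Fin d × Fin 2) :
    (weight₂ *ᵥ y) (.inr l) = y (.inr l) := by
  simp [Matrix.mulVec, dotProduct, weight₂, Fintype.sum_sum_type]

/-- The signed ReLU copies of the input recombine to `x`, so the affine function is available here
together with the indicator computed meanwhile; the bias contributes its constant term and the `-R`
of the cutoff. -/
theorem layer₃ (y : Units₂ N d → ℝ) (x : Fin d → ℝ)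
    (hy : ∀ l, y (.inr l) = relu (sgn l.2 * x l.1)) (p : Units₃ N m) :
    (weight₃ pa R *ᵥ y) p + bias₃ pb R p =
      sgn p.2 * (pa p.1.1 p.1.2 ⬝ᵥ x + pb p.1.1 p.1.2) + R * (y (.inl p.1.1) - 1) := by
  have h1 : ∑ l : Fin d × Fin 2, weight₃ pa R p (.inr l) * y (.inr l) =
      sgn p.2 * (pa p.1.1 p.1.2 ⬝ᵥ x) := by
    rw [Fintype.sum_prod_type, dotProduct, Finset.mul_sum]
    refine Finset.sum_congr rfl fun l _ => ?_
    have : ∀ s : Fin 2, weight₃ pa R p (.inr (l, s)) * y (.inr (l, s)) =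
        sgn p.2 * pa p.1.1 p.1.2 l * (sgn s * relu (sgn s * x l)) := fun s => by
      rw [hy]; simp only [weight₃]; ring
    rw [Finset.sum_congr rfl fun s _ => this s, ← Finset.mul_sum, sum_sgn_relu]
    ring
  have h2 : ∑ q : Fin N, weight₃ (d := d) pa R p (.inl q) * y (.inl q) = R * y (.inl p.1.1) := by
    simp [weight₃]
  rw [Matrix.mulVec, dotProduct, Fintype.sum_sum_type, h1, h2, bias₃]
  ring

variable (hN : 0 < N) (hd : 0 < d) (hm : 0 < m)

/-- The hidden layers computing the positive and negative parts of the products of affine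
functions with indicator functions. -/
def deepHidden : HiddenLayers d (N * m * 2) :=
  consReindex (Equiv.refl _) (enum₁ N d) (by positivity) (weight₁ Ha) (bias₁ Hb) sumActivation <|
  consReindex (enum₁ N d) (enum₂ N d) (by positivity) weight₂ bias₂ sumActivation <|
  consReindex (enum₂ N d) (enum₃ N m) (by positivity) (weight₃ pa R) (bias₃ pb R)
    (fun _ => relu) <|
  -- An identity layer acting on nonnegative values; it only raises the depth to five.
  consReindex (enum₃ N m) (enum₃ N m) (by positivity) 1 0 (fun _ => relu) (.nil _)

theorem deepHidden_realize (x : Fin d → ℝ) :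
    (deepHidden Ha Hb pa pb R hN hd hm).realize x = (fun p : Units₃ N m =>
      relu (sgn p.2 * (pa p.1.1 p.1.2 ⬝ᵥ x + pb p.1.1 p.1.2) +
        R * (cutoff Ha Hb p.1.1 x - 1))) ∘ (enum₃ N m).symm := by
  have hx : x = x ∘ (Equiv.refl (Fin d)).symm := rfl
  conv_lhs => rw [hx]
  rw [deepHidden, realize_consReindex, realize_consReindex, realize_consReindex,
    realize_consReindex]
  simp only [HiddenLayers.realize]
  funext j
  simp only [Function.comp_apply, Matrix.one_mulVec, Pi.zero_apply, add_zero]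
  rw [relu_of_nonneg (relu_nonneg _), layer₃ pa pb R _ x]
  · congr 4
    simp only [sumActivation, Sum.elim_inl, layer₂_inl, bias₂]
    exact bisu_sum_bisu _
  · intro l
    rw [layer₂_inr]
    simp only [layer₁_inr]
    simp only [sumActivation, Sum.elim_inr, bias₂, add_zero]
    exact relu_of_nonneg (relu_nonneg _)

/-- The quadratic terms come from the `d + 1` half spaces with `d` weights each and from the `2 m`
cutoff units with `2 d + 1` weights each, for each of the `N` blocks. The `2 d` units that pass on
the input are shared by all blocks. -/
theorem deepHidden_size : (deepHidden Ha Hb pa pb R hN hd hm).size ≤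
    (N * (d + 1) * d + d * 2 + (N * (d + 1) + d * 2)) + (N * (d + 1) + d * 2 + (N + d * 2)) +
      (N * m * 2 * (1 + d * 2) + N * m * 2) + (N * m * 2 + N * m * 2) := by
  classical
  have h1 := size_consReindex_le (Equiv.refl (Fin d)) (enum₁ N d) (by positivity) (weight₁ Ha)
    (bias₁ Hb) sumActivation
    (consReindex (enum₁ N d) (enum₂ N d) (by positivity) weight₂ bias₂ sumActivation <|
      consReindex (enum₂ N d) (enum₃ N m) (by positivity) (weight₃ pa R) (bias₃ pb R)
        (fun _ => relu) <|
      consReindex (enum₃ N m) (enum₃ N m) (by positivity) 1 0 (fun _ => relu) (.nil _))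
    (Sum.elim (fun _ => Finset.univ) (fun l => {l.1})) (by
      rintro (q | l) j h
      · simp
      · by_contra h'
        simp only [Sum.elim_inr, Finset.mem_singleton] at h'
        simp [weight₁, h'] at h)
  have h2 := size_consReindex_le (enum₁ N d) (enum₂ N d) (by positivity) weight₂ bias₂
    sumActivation
    (consReindex (enum₂ N d) (enum₃ N m) (by positivity) (weight₃ pa R) (bias₃ pb R)
        (fun _ => relu) <|
      consReindex (enum₃ N m) (enum₃ N m) (by positivity) 1 0 (fun _ => relu) (.nil _))
    (Sum.elim (fun q => Finset.univ.image fun r => .inl (q, r)) (fun l => {.inr l})) (by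
      rintro (q | l) (p | p) h
      · by_cases hp : p.1 = q
        · subst hp; simp
        · simp [weight₂, hp] at h
      · simp [weight₂] at h
      · simp [weight₂] at h
      · by_cases hp : p = l
        · simp [hp]
        · simp [weight₂, hp] at h)
  have h3 := size_consReindex_le (enum₂ N d) (enum₃ N m) (by positivity) (weight₃ pa R)
    (bias₃ pb R) (fun _ => relu)
    (consReindex (enum₃ N m) (enum₃ N m) (by positivity) 1 0 (fun _ => relu) (.nil _))
    (fun p => insert (.inl p.1.1) (Finset.univ.image .inr)) (by
      rintro p (q | l) h
      · by_cases hp : q = p.1.1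
        · simp [hp]
        · simp [weight₃, hp] at h
      · simp)
  have h4 := size_consReindex_le (enum₃ N m) (enum₃ N m) (by positivity) 1 0 (fun _ => relu)
    (.nil _) (fun p => {p}) (by
      intro p q h
      by_contra h'
      rw [Finset.mem_singleton] at h'
      exact h (Matrix.one_apply_ne (Ne.symm h')))
  have c2 : ∀ q : Fin N, (Finset.univ.image fun r : Fin (d + 1) =>
      (Sum.inl (q, r) : Units₁ N d)).card ≤ d + 1 := fun q =>
    Finset.card_image_le.trans (by simp)
  have c3 : ∀ p : Units₃ N m, (insert (.inl p.1.1) (Finset.univ.image .inr) :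
      Finset (Units₂ N d)).card ≤ 1 + d * 2 := fun p =>
    (Finset.card_insert_le _ _).trans (by
      have : (Finset.univ.image (Sum.inr : Fin d × Fin 2 → Units₂ N d)).card ≤ d * 2 :=
        Finset.card_image_le.trans (by simp)
      omega)
  have s2 : ∑ q : Fin N, (Finset.univ.image fun r : Fin (d + 1) =>
      (Sum.inl (q, r) : Units₁ N d)).card ≤ N * (d + 1) :=
    (Finset.sum_le_sum fun q _ => c2 q).trans (by simp)
  have s3 : ∑ p : Units₃ N m, (insert (.inl p.1.1) (Finset.univ.image .inr) :
      Finset (Units₂ N d)).card ≤ N * m * 2 * (1 + d * 2) :=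
    (Finset.sum_le_sum fun q _ => c3 q).trans (by simp)
  simp only [Fintype.sum_sum_type, Sum.elim_inl, Sum.elim_inr, Finset.card_singleton,
    Finset.sum_const, Finset.card_univ, Fintype.card_prod, Fintype.card_fin, smul_eq_mul, mul_one,
    HiddenLayers.size, add_zero] at h1 h2 h3 h4
  rw [deepHidden]
  omega

variable {κ : Type} (π : Fin N → κ)

open Classical in
/-- The network of depth five, whose outputs are sums of products of affine functions with
indicator functions. -/
def deepNet : Network d (κ × Fin m) where
  lastWidth := N * m * 2
  hidden := deepHidden Ha Hb pa pb R hN hd hm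
  A := fun i j => if (π ((enum₃ N m).symm j).1.1, ((enum₃ N m).symm j).1.2) = i then
    sgn ((enum₃ N m).symm j).2 else 0
  b := 0

open Classical in
theorem deepNet_realize (x : Fin d → ℝ) (hR : ∀ q j, |pa q j ⬝ᵥ x + pb q j| ≤ R) (i : κ)
    (j : Fin m) : (deepNet Ha Hb pa pb R hN hd hm π).realize x (i, j) =
      ∑ q, if π q = i ∧ ∀ r, 0 < Ha q r ⬝ᵥ x + Hb q r then pa q j ⬝ᵥ x + pb q j else 0 := by
  have h : (deepNet Ha Hb pa pb R hN hd hm π).realize x (i, j) = ∑ k : Fin (N * m * 2),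
      (if (π ((enum₃ N m).symm k).1.1, ((enum₃ N m).symm k).1.2) = (i, j) then
        sgn ((enum₃ N m).symm k).2 else 0) * (deepHidden Ha Hb pa pb R hN hd hm).realize x k + 0 :=
    rfl
  rw [h, add_zero, deepHidden_realize, ← (enum₃ N m).sum_comp]
  simp only [Function.comp_apply, Equiv.symm_apply_apply, Prod.mk.injEq]
  rw [Fintype.sum_prod_type, Fintype.sum_prod_type]
  refine Finset.sum_congr rfl fun q _ => ?_
  rw [Finset.sum_eq_single_of_mem j (Finset.mem_univ j)]
  · by_cases hq : π q = i
    · simp only [hq, and_self, if_true, true_and]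
      exact sum_sgn_relu_cutoff (hR q j) _
    · simp [hq]
  · intro l _ hl
    simp [hl]

theorem deepNet_size (hmd : m ≤ d) :
    (deepNet Ha Hb pa pb R hN hd hm π).size ≤ 100 * d ^ 2 * N := by
  classical
  have h1 := deepHidden_size Ha Hb pa pb R hN hd hm
  have h2 : Set.ncard {p : (κ × Fin m) × Fin (N * m * 2) |
      (deepNet Ha Hb pa pb R hN hd hm π).A p.1 p.2 ≠ 0} ≤ N * m * 2 := by
    -- Each hidden unit feeds exactly one output, so a nonzero entry is determined by its column.
    have := Set.ncard_le_ncard_of_injOn (s := {p : (κ × Fin m) × Fin (N * m * 2) |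
      (deepNet Ha Hb pa pb R hN hd hm π).A p.1 p.2 ≠ 0}) (t := (Set.univ : Set (Fin (N * m * 2))))
      Prod.snd (fun _ _ => Set.mem_univ _) (by
        rintro ⟨p, j⟩ hp ⟨p', j'⟩ hp' h
        simp only at h
        subst h
        simp only [deepNet, Set.mem_ofPred_eq, ne_eq, ite_eq_right_iff, Classical.not_imp] at hp hp'
        rw [← hp.1, ← hp'.1]) Set.finite_univ
    simpa [Set.ncard_univ] using this
  have h3 : Set.ncard {j : κ × Fin m | (deepNet Ha Hb pa pb R hN hd hm π).b j ≠ 0} = 0 := by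
    simp [deepNet]
  have h4 : (deepNet Ha Hb pa pb R hN hd hm π).size =
    (deepHidden Ha Hb pa pb R hN hd hm).size + (Set.ncard {p : (κ × Fin m) × Fin (N * m * 2) |
      (deepNet Ha Hb pa pb R hN hd hm π).A p.1 p.2 ≠ 0} +
      Set.ncard {j : κ × Fin m | (deepNet Ha Hb pa pb R hN hd hm π).b j ≠ 0}) := rfl
  rw [h4, h3]
  -- Every monomial in the bounds is at most `N * d * d`; the sum of the coefficients is well below
  -- `100`.
  have e1 : N * m ≤ N * d := Nat.mul_le_mul_left _ hmd
  have e2 : N * m * d ≤ N * d * d := Nat.mul_le_mul_right _ e1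
  have e3 : N * d ≤ N * d * d := Nat.le_mul_of_pos_right _ hd
  have e4 : N ≤ N * d := Nat.le_mul_of_pos_right _ hd
  have e5 : d ≤ N * d := Nat.le_mul_of_pos_left _ hN
  nlinarith

theorem deepNet_depth : (deepNet Ha Hb pa pb R hN hd hm π).depth = 5 := rfl

theorem deepNet_activations :
    (deepNet Ha Hb pa pb R hN hd hm π).activations = deepActivations N d m := rfl

/-- Weights of the half spaces. -/
def halfSpaceWeight : Matrix (Fin N × Fin (d + 1)) (Fin d) ℝ := Matrix.of fun q => Ha q.1 q.2

/-- Weights of the intersections of half spaces. -/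
def conjWeight : Matrix (Fin N) (Fin N × Fin (d + 1)) ℝ :=
  Matrix.of fun q p => if p.1 = q then 1 else 0

/-- The hidden layers computing indicator functions. -/
def shallowHidden : HiddenLayers d N :=
  consReindex (Equiv.refl (Fin d)) (finProdFinEquiv (m := N) (n := d + 1)) (Nat.mul_pos hN (Nat.succ_pos d))
    (halfSpaceWeight Ha) (fun q => Hb q.1 q.2) (fun _ => bisu) <|
  consReindex (finProdFinEquiv (m := N) (n := d + 1)) (Equiv.refl (Fin N)) hN
    conjWeight (fun _ => -(d + 1 / 2 : ℝ)) (fun _ => bisu) (.nil _)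

theorem shallowHidden_realize (x : Fin d → ℝ) (q : Fin N) :
    (shallowHidden Ha Hb hN).realize x q = cutoff Ha Hb q x := by
  have hx : x = x ∘ (Equiv.refl (Fin d)).symm := rfl
  conv_lhs => rw [hx]
  rw [shallowHidden, realize_consReindex, realize_consReindex, cutoff, ← bisu_sum_bisu]
  simp only [HiddenLayers.realize, Function.comp_apply, Equiv.refl_symm, Equiv.refl_apply]
  congr 2
  simp only [Matrix.mulVec, dotProduct, Fintype.sum_prod_type]
  rw [Finset.sum_eq_single_of_mem q (Finset.mem_univ q)]
  · simp [conjWeight, halfSpaceWeight]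
  · intro p _ hp
    simp [conjWeight, hp]

theorem shallowHidden_size : (shallowHidden Ha Hb hN).size ≤
    (N * (d + 1) * d + N * (d + 1)) + (N * (d + 1) + N) := by
  classical
  have h1 := size_consReindex_le (Equiv.refl (Fin d)) (finProdFinEquiv (m := N) (n := d + 1))
    (Nat.mul_pos hN (Nat.succ_pos d)) (halfSpaceWeight Ha) (fun q => Hb q.1 q.2) (fun _ => bisu)
    (consReindex (finProdFinEquiv (m := N) (n := d + 1)) (Equiv.refl (Fin N)) hN
      conjWeight (fun _ => -(d + 1 / 2 : ℝ)) (fun _ => bisu) (.nil _))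
    (fun _ => Finset.univ) (by simp)
  have h2 := size_consReindex_le (finProdFinEquiv (m := N) (n := d + 1)) (Equiv.refl (Fin N)) hN
      conjWeight (fun _ => -(d + 1 / 2 : ℝ)) (fun _ => bisu) (.nil _)
    (fun q => Finset.univ.image fun r => (q, r)) (by
      rintro q ⟨p, r⟩ h
      by_cases hp : p = q
      · simp [hp]
      · simp [conjWeight, hp] at h)
  have s2 : ∑ q : Fin N, (Finset.univ.image fun r : Fin (d + 1) => (q, r)).card ≤ N * (d + 1) :=
    (Finset.sum_le_sum fun q _ => Finset.card_image_le.trans (by simp)).trans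
      (by simp : ∑ q : Fin N, (d + 1) ≤ N * (d + 1))
  simp only [Finset.sum_const, Finset.card_univ, Fintype.card_prod, Fintype.card_fin, smul_eq_mul,
    HiddenLayers.size, add_zero] at h1 h2
  rw [shallowHidden]
  omega

open Classical in
/-- The network of depth three, whose outputs are sums of indicator functions. -/
def shallowNet : Network d (κ × Fin 1) where
  lastWidth := N
  hidden := shallowHidden Ha Hb hN
  A := fun i q => if π q = i.1 then 1 else 0
  b := 0

open Classical in
theorem shallowNet_realize (x : Fin d → ℝ) (i : κ) (j : Fin 1) :
    (shallowNet Ha Hb hN π).realize x (i, j) =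
      ∑ q, if π q = i ∧ ∀ r, 0 < Ha q r ⬝ᵥ x + Hb q r then 1 else 0 := by
  have h : (shallowNet Ha Hb hN π).realize x (i, j) = ∑ q : Fin N,
      (if π q = i then 1 else 0) * (shallowHidden Ha Hb hN).realize x q + 0 := rfl
  rw [h, add_zero]
  refine Finset.sum_congr rfl fun q _ => ?_
  rw [shallowHidden_realize, cutoff]
  by_cases hq : π q = i <;> simp [hq]

include hd in
theorem shallowNet_size : (shallowNet Ha Hb hN π).size ≤ 100 * d ^ 2 * N := by
  classical
  have h1 := shallowHidden_size Ha Hb hN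
  have h2 : Set.ncard {p : (κ × Fin 1) × Fin N |
      (shallowNet Ha Hb hN π).A p.1 p.2 ≠ 0} ≤ N := by
    have := Set.ncard_le_ncard_of_injOn (s := {p : (κ × Fin 1) × Fin N |
      (shallowNet Ha Hb hN π).A p.1 p.2 ≠ 0}) (t := (Set.univ : Set (Fin N)))
      Prod.snd (fun _ _ => Set.mem_univ _) (by
        rintro ⟨⟨p, l⟩, j⟩ hp ⟨⟨p', l'⟩, j'⟩ hp' h
        simp only at h
        subst h
        simp only [shallowNet, Set.mem_ofPred_eq, ne_eq, ite_eq_right_iff,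
          Classical.not_imp] at hp hp'
        rw [← hp.1, ← hp'.1, Subsingleton.elim l l']) Set.finite_univ
    simpa [Set.ncard_univ] using this
  have h3 : Set.ncard {j : κ × Fin 1 | (shallowNet Ha Hb hN π).b j ≠ 0} = 0 := by
    simp [shallowNet]
  have h4 : (shallowNet Ha Hb hN π).size =
    (shallowHidden Ha Hb hN).size + (Set.ncard {p : (κ × Fin 1) × Fin N |
      (shallowNet Ha Hb hN π).A p.1 p.2 ≠ 0} +
      Set.ncard {j : κ × Fin 1 | (shallowNet Ha Hb hN π).b j ≠ 0}) := rfl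
  rw [h4, h3]
  have e3 : N * d ≤ N * d * d := Nat.le_mul_of_pos_right _ hd
  have e4 : N ≤ N * d := Nat.le_mul_of_pos_right _ hd
  nlinarith

theorem shallowNet_depth : (shallowNet Ha Hb hN π).depth = 3 := rfl

theorem shallowNet_activations :
    (shallowNet Ha Hb hN π).activations = shallowActivations N d := rfl

end ElementNet

/-! ### Linear combinations of the outputs of a network -/

namespace Network

variable {n : ℕ} {ι κ : Type} [Fintype ι]

/-- The network computing the linear combinations `∑ i, c i • Φ(x)_(i, j)`. -/
def combine (Φ : Network n (ι × κ)) (c : ι → ℝ) : Network n κ where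
  lastWidth := Φ.lastWidth
  hidden := Φ.hidden
  A := fun j q => ∑ i, c i * Φ.A (i, j) q
  b := fun j => ∑ i, c i * Φ.b (i, j)

theorem combine_realize (Φ : Network n (ι × κ)) (c : ι → ℝ) (x : Fin n → ℝ) (j : κ) :
    (Φ.combine c).realize x j = ∑ i, c i * Φ.realize x (i, j) := by
  have h : (Φ.combine c).realize x j = ∑ q, (∑ i, c i * Φ.A (i, j) q) * Φ.hidden.realize x q +
      ∑ i, c i * Φ.b (i, j) := rfl
  have h2 : ∀ i, Φ.realize x (i, j) =
    ∑ q, Φ.A (i, j) q * Φ.hidden.realize x q + Φ.b (i, j) := fun i => rfl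
  simp only [h, h2, mul_add, Finset.sum_add_distrib, Finset.sum_mul, Finset.mul_sum]
  rw [Finset.sum_comm]
  simp only [mul_assoc]

/-- A nonzero entry `(j, q)` of the combination requires a nonzero entry `((i, j), q)` for some `i`;
the support is contained in a projection of the old one. The same holds for the biases. -/
theorem combine_size_le [Finite κ] (Φ : Network n (ι × κ)) (c : ι → ℝ) :
    (Φ.combine c).size ≤ Φ.size := by
  have h1 : Set.ncard {p : κ × Fin Φ.lastWidth | (∑ i, c i * Φ.A (i, p.1) p.2) ≠ 0} ≤
      Set.ncard {p : (ι × κ) × Fin Φ.lastWidth | Φ.A p.1 p.2 ≠ 0} := by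
    refine (Set.ncard_le_ncard (t := (fun p : (ι × κ) × Fin Φ.lastWidth => (p.1.2, p.2)) ''
      {p | Φ.A p.1 p.2 ≠ 0}) ?_ (Set.toFinite _)).trans (Set.ncard_image_le (Set.toFinite _))
    rintro ⟨j, q⟩ h
    obtain ⟨i, -, hi⟩ := Finset.exists_ne_zero_of_sum_ne_zero h
    exact ⟨((i, j), q), right_ne_zero_of_mul hi, rfl⟩
  have h2 : Set.ncard {j : κ | (∑ i, c i * Φ.b (i, j)) ≠ 0} ≤
      Set.ncard {p : ι × κ | Φ.b p ≠ 0} := by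
    refine (Set.ncard_le_ncard (t := Prod.snd '' {p | Φ.b p ≠ 0}) ?_ (Set.toFinite _)).trans
      (Set.ncard_image_le (Set.toFinite _))
    rintro j h
    obtain ⟨i, -, hi⟩ := Finset.exists_ne_zero_of_sum_ne_zero h
    exact ⟨(i, j), right_ne_zero_of_mul hi, rfl⟩
  have h3 : (Φ.combine c).size = Φ.hidden.size +
      (Set.ncard {p : κ × Fin Φ.lastWidth | (∑ i, c i * Φ.A (i, p.1) p.2) ≠ 0} +
      Set.ncard {j : κ | (∑ i, c i * Φ.b (i, j)) ≠ 0}) := rfl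
  have h4 : Φ.size = Φ.hidden.size +
      (Set.ncard {p : (ι × κ) × Fin Φ.lastWidth | Φ.A p.1 p.2 ≠ 0} +
      Set.ncard {p : ι × κ | Φ.b p ≠ 0}) := rfl
  omega

end Network

/-! ### Coordinates of affine functions -/

/-- The coefficients of an affine function. -/
def coeffs (ℓ : E d →ᵃ[ℝ] ℝ) : Fin d → ℝ := fun j => ℓ.linear (EuclideanSpace.single j 1)

theorem coeffs_dotProduct (ℓ : E d →ᵃ[ℝ] ℝ) (x : E d) : coeffs ℓ ⬝ᵥ x.ofLp + ℓ 0 = ℓ x := by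
  have h : ℓ x = ℓ.linear x + ℓ 0 := by
    conv_lhs => rw [AffineMap.decomp ℓ]
    rfl
  have hx : x = ∑ j, x j • EuclideanSpace.single j (1 : ℝ) := by
    have := (EuclideanSpace.basisFun (Fin d) ℝ).sum_repr x
    simpa using this.symm
  rw [h]
  congr 1
  conv_rhs => rw [hx, map_sum]
  refine Finset.sum_congr rfl fun j _ => ?_
  rw [map_smul, smul_eq_mul, mul_comm]
  rfl

/-- The components of an affine map. -/
def component {m : ℕ} (A : E d →ᵃ[ℝ] E m) (j : Fin m) : E d →ᵃ[ℝ] ℝ :=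
  (EuclideanSpace.proj j : E m →L[ℝ] ℝ).toLinearMap.toAffineMap.comp A

theorem component_apply {m : ℕ} (A : E d →ᵃ[ℝ] E m) (j : Fin m) (x : E d) :
    component A j x = A x j := rfl

/-! ### Networks assembled from pairs of a node and an adjacent element -/

namespace SimplicialMesh

variable {Ω : Set (E d)} (M : SimplicialMesh Ω)

/-- The pairs consisting of a node and an adjacent element. -/
abbrev Pairs (N : Finset (Finset (E d))) : Type := Σ i : N, M.star i

/-- One block of units per pair makes the layer dimensions depend on the mesh only through the sum
of the `s(i)`. -/
theorem card_pairs (N : Finset (Finset (E d))) :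
    Fintype.card (M.Pairs N) = (N.val.map M.adj).sum := by
  rw [Fintype.card_sigma]
  simp only [Fintype.card_coe]
  exact Finset.sum_coe_sort N (fun i => M.adj i)

/-- An enumeration of the pairs. -/
def enumPairs (N : Finset (Finset (E d))) : M.Pairs N ≃ Fin (N.val.map M.adj).sum :=
  Fintype.equivFinOfCardEq (M.card_pairs N)

variable {M} {N : Finset (Finset (E d))}

theorem Pairs.isFullSimplex (q : M.Pairs N) : IsFullSimplex (q.2 : Finset (E d)) :=
  M.isFullSimplex _ (M.mem_star.1 q.2.2).1

/-- The barycentric coordinates of the element of a pair. -/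
def Pairs.coord (q : M.Pairs N) (r : Fin (d + 1)) : E d →ᵃ[ℝ] ℝ :=
  bary q.2 (((q.2 : Finset (E d)).equivFinOfCardEq q.isFullSimplex.1).symm r)

theorem Pairs.forall_coord_pos (q : M.Pairs N) (x : E d) :
    (∀ r, 0 < q.coord r x) ↔ x ∈ openHull (q.2 : Finset (E d)) := by
  rw [q.isFullSimplex.mem_openHull_self_iff]
  constructor
  · intro h y hy
    have := h ((q.2 : Finset (E d)).equivFinOfCardEq q.isFullSimplex.1 ⟨y, hy⟩)
    simpa [Pairs.coord] using this
  · intro h r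
    exact h _ (((q.2 : Finset (E d)).equivFinOfCardEq q.isFullSimplex.1).symm r).2

namespace FEData

variable {m : ℕ} {V : Submodule ℝ (FunctionClass Ω m)} {θ : Finset (E d) → E d → E m}
  (D : M.FEData m V N θ)
include D

theorem pairs_pos (hN : N.Nonempty) : 0 < (N.val.map M.adj).sum := by
  obtain ⟨i, hi⟩ := hN
  obtain ⟨t, ht⟩ := D.star_nonempty i hi
  rw [← M.card_pairs, Fintype.card_pos_iff]
  exact ⟨⟨⟨i, hi⟩, ⟨t, ht⟩⟩⟩

/-- The affine map which is equal to `θ i` on the element `t`. -/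
def locAffine (q : M.Pairs N) : E d →ᵃ[ℝ] E m :=
  (D.affine _ (D.loc_mem q.1 q.1.2 q.2 q.2.2)).choose

theorem locAffine_apply (q : M.Pairs N) (x : E d) : D.locAffine q x = D.loc q.1 q.2 x :=
  (congrFun (D.affine _ (D.loc_mem q.1 q.1.2 q.2 q.2.2)).choose_spec x).symm

-- A point of an open element lies in no other element, so among the pairs with first component `i`
-- at most one contributes.
open Classical in
theorem sum_pairs {t : Finset (E d)} (ht : t ∈ M.cells) {x : E d} (hx : x ∈ openHull t) (i : N)
    (j : Fin m) :
    (∑ q : M.Pairs N, if q.1 = i ∧ x ∈ openHull (q.2 : Finset (E d)) then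
      component (D.locAffine q) j x else 0) = θ i x j := by
  have huniq : ∀ s ∈ M.cells, x ∈ openHull s → s = t := fun s hs hxs =>
    (M.eq_of_mem_openHull hs hxs ht (openHull_subset_convexHull t hx))
  by_cases hi : (i : Finset (E d)) ⊆ t
  · have hts := M.mem_star.2 ⟨ht, hi⟩
    rw [Finset.sum_eq_single_of_mem ⟨i, ⟨t, hts⟩⟩ (Finset.mem_univ _)]
    · simp only [hx, and_self, if_true]
      rw [component_apply, locAffine_apply, D.shape_eq i i.2 t hts x hx]
    · rintro ⟨i', ⟨s, hs⟩⟩ _ hne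
      refine if_neg ?_
      rintro ⟨h1, h2⟩
      simp only at h1 h2
      subst h1
      have := huniq s (M.mem_star.1 hs).1 h2
      subst this
      exact hne rfl
  · rw [D.shape_eq_zero i i.2 t ht hi x hx]
    refine Finset.sum_eq_zero fun q _ => if_neg ?_
    rintro ⟨h1, h2⟩
    have := huniq q.2 (M.mem_star.1 q.2.2).1 h2
    exact hi (this ▸ h1 ▸ (M.mem_star.1 q.2.2).2)

theorem exists_deepNet (hΩ : IsPolytopalDomain Ω) (hN : N.Nonempty) (hd : 0 < d) (hm : 0 < m)
    (hmd : m ≤ d) : ∃ Φ : Network d (N × Fin m),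
      (∀ᵐ x ∂(volume.restrict Ω), ∀ (i : N) (j : Fin m), Φ.realize x.ofLp (i, j) = θ i x j) ∧
      Φ.depth = 5 ∧ Φ.size ≤ 100 * d ^ 2 * (N.val.map M.adj).sum ∧
      Φ.activations = deepActivations (N.val.map M.adj).sum d m := by
  classical
  let e := M.enumPairs N
  let p : Fin (N.val.map M.adj).sum → Fin m → E d →ᵃ[ℝ] ℝ := fun q j =>
    component (D.locAffine (e.symm q)) j
  -- One bound for the finitely many affine pieces on the compact closure of the domain. It enters
  -- only as a weight and as a bias, so it influences neither the layer dimensions nor the bound on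
  -- the size.
  obtain ⟨R, hR⟩ : ∃ R : ℝ, ∀ x ∈ closure Ω, ∀ q j, |p q j x| ≤ R := by
    have hc : ContinuousOn (fun x => ∑ q, ∑ j, |p q j x|) (closure Ω) :=
      (continuous_finsetSum _ fun q _ => continuous_finsetSum _ fun j _ =>
        (continuous_affineMap (p q j)).abs).continuousOn
    obtain ⟨R, hR⟩ := M.isCompact_closure.exists_bound_of_continuousOn hc
    refine ⟨R, fun x hx q j => le_trans ?_ ((le_abs_self _).trans (hR x hx))⟩
    refine le_trans ?_ (Finset.single_le_sum (f := fun q => ∑ j, |p q j x|)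
      (fun q _ => Finset.sum_nonneg fun j _ => abs_nonneg _) (Finset.mem_univ q))
    exact Finset.single_le_sum (f := fun j => |p q j x|) (fun j _ => abs_nonneg _)
      (Finset.mem_univ j)
  refine ⟨deepNet (fun q r => coeffs ((e.symm q).coord r)) (fun q r => (e.symm q).coord r 0)
    (fun q j => coeffs (p q j)) (fun q j => p q j 0) R (D.pairs_pos hN) hd hm
    (fun q => (e.symm q).1), ?_, deepNet_depth _ _ _ _ _ _ _ _ _,
    deepNet_size _ _ _ _ _ _ _ _ _ hmd, deepNet_activations _ _ _ _ _ _ _ _ _⟩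
  filter_upwards [M.ae_mem_openHull hΩ] with x ⟨t, ht, hxt⟩ i j
  rw [deepNet_realize]
  · simp only [coeffs_dotProduct, Pairs.forall_coord_pos]
    rw [← D.sum_pairs ht hxt i j, ← e.symm.sum_comp]
  · intro q j
    rw [coeffs_dotProduct]
    exact hR x (subset_closure (M.openHull_subset hΩ ht hxt)) q j

end FEData

/-- If all local pieces are equal to `1`, the indicators are already the answer and the
multiplication layers can be omitted. -/
theorem FEData.exists_shallowNet {V : Submodule ℝ (FunctionClass Ω 1)}
    {θ : Finset (E d) → E d → E 1} (D : M.FEData 1 V N θ) (hΩ : IsPolytopalDomain Ω)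
    (hN : N.Nonempty) (hd : 0 < d) (hloc : ∀ i t x, D.loc i t x 0 = 1) :
    ∃ Φ : Network d (N × Fin 1),
      (∀ᵐ x ∂(volume.restrict Ω), ∀ (i : N) (j : Fin 1), Φ.realize x.ofLp (i, j) = θ i x j) ∧
      Φ.depth = 3 ∧ Φ.size ≤ 100 * d ^ 2 * (N.val.map M.adj).sum ∧
      Φ.activations = shallowActivations (N.val.map M.adj).sum d := by
  classical
  let e := M.enumPairs N
  refine ⟨shallowNet (fun q r => coeffs ((e.symm q).coord r)) (fun q r => (e.symm q).coord r 0)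
    (D.pairs_pos hN) (fun q => (e.symm q).1), ?_, shallowNet_depth _ _ _ _,
    shallowNet_size _ _ _ hd _, shallowNet_activations _ _ _ _⟩
  filter_upwards [M.ae_mem_openHull hΩ] with x ⟨t, ht, hxt⟩ i j
  rw [shallowNet_realize]
  simp only [coeffs_dotProduct, Pairs.forall_coord_pos]
  rw [← D.sum_pairs ht hxt i j, ← e.symm.sum_comp]
  refine Finset.sum_congr rfl fun q _ => ?_
  have : component (D.locAffine (e.symm q)) j x = 1 := by
    rw [component_apply, D.locAffine_apply, Subsingleton.elim j 0]
    exact hloc _ _ _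
  rw [this]

/-- The architecture of the networks. -/
def architecture : FEKind → ℕ → Multiset ℕ → List (List (ℝ → ℝ))
  | .S0, d, s => shallowActivations s.sum d
  | k, d, s => deepActivations s.sum d (k.valueDim d)

theorem architecture_spec (k : FEKind) {s : Multiset ℕ} {l : List (ℝ → ℝ)}
    (hl : l ∈ architecture k d s) {a : ℝ → ℝ} (ha : a ∈ l) : a = relu ∨ a = bisu := by
  cases k
  case S0 => exact shallowActivations_spec hl ha
  all_goals exact deepActivations_spec hl ha

/-- The properties of the networks follow from those of the network computing the basis. -/
theorem exists_nets (k : FEKind) (θ : Finset (E d) → E d → E (k.valueDim d))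
    (b : Module.Basis (M.nodes k) ℝ (M.feSpace k))
    (hb : ∀ i, ((b i : FunctionClass Ω (k.valueDim d)) : E d → E (k.valueDim d))
        =ᵐ[volume.restrict Ω] θ i)
    (Φ : Network d (M.nodes k × Fin (k.valueDim d)))
    (hΦ : ∀ᵐ x ∂(volume.restrict Ω), ∀ (i : M.nodes k) (j : Fin (k.valueDim d)),
          Φ.realize x.ofLp (i, j) = θ i x j)
    (hdepth : Φ.depth = k.netDepth)
    (hsize : Φ.size ≤ 100 * d ^ 2 * (M.adjFamily k).sum)
    (hact : Φ.activations = architecture k d (M.adjFamily k)) :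
    (M.nodes k).card = Module.finrank ℝ (M.feSpace k) ∧
    (100 : ℝ) * d ^ 2 * ∑ i ∈ M.nodes k, (M.adj i : ℝ) ≤
      100 * d ^ 2 * M.maxAdj k * Module.finrank ℝ (M.feSpace k) ∧
    ∃ (Φ : Network d (M.nodes k × Fin (k.valueDim d)))
      (Ψ : M.feSpace k → Network d (Fin (k.valueDim d))),
      (Φ.IsReLUBiSU ∧
        (∀ᵐ x ∂(volume.restrict Ω), ∀ (i : M.nodes k) (j : Fin (k.valueDim d)),
          Φ.realize x.ofLp (i, j) = θ i x j) ∧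
        Φ.depth = k.netDepth ∧
        (Φ.size : ℝ) ≤ 100 * d ^ 2 * ∑ i ∈ M.nodes k, (M.adj i : ℝ) ∧
        Φ.activations = architecture k d (M.adjFamily k)) ∧
      (∀ v : M.feSpace k, (Ψ v).IsReLUBiSU ∧
        (∀ᵐ x ∂(volume.restrict Ω),
          WithLp.toLp 2 ((Ψ v).realize x.ofLp) = (v : FunctionClass Ω (k.valueDim d)) x) ∧
        (Ψ v).depth = k.netDepth ∧
        ((Ψ v).size : ℝ) ≤ 100 * d ^ 2 * ∑ i ∈ M.nodes k, (M.adj i : ℝ) ∧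
        (Ψ v).activations = architecture k d (M.adjFamily k) ∧
        (Ψ v).hiddenLayers = Φ.hiddenLayers) ∧
      ∃ (_ : AddCommGroup (Set.range Ψ)) (_ : Module ℝ (Set.range Ψ)),
        (∀ (v w : M.feSpace k) (c : ℝ),
          (⟨Ψ v, v, rfl⟩ + c • ⟨Ψ w, w, rfl⟩ : Set.range Ψ) = ⟨Ψ (v + c • w), v + c • w, rfl⟩) ∧
        ∃ R : Set.range Ψ ≃ₗ[ℝ] M.feSpace k, ∀ F : Set.range Ψ,
          ∀ᵐ x ∂(volume.restrict Ω),
            ((R F : M.feSpace k) : FunctionClass Ω (k.valueDim d)) x =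
              WithLp.toLp 2 ((F : Network d (Fin (k.valueDim d))).realize x.ofLp) := by
  have hfin : Module.finrank ℝ (M.feSpace k) = (M.nodes k).card := by
    rw [Module.finrank_eq_card_basis b, Fintype.card_coe]
  have hsum : (((M.adjFamily k).sum : ℕ) : ℝ) = ∑ i ∈ M.nodes k, (M.adj i : ℝ) := by
    have : (M.adjFamily k).sum = ∑ i ∈ M.nodes k, M.adj i := rfl
    rw [this]; push_cast; rfl
  have hsize' : (Φ.size : ℝ) ≤ 100 * d ^ 2 * ∑ i ∈ M.nodes k, (M.adj i : ℝ) := by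
    rw [← hsum]; exact_mod_cast hsize
  -- The coordinates of `v` enter the output layer only, so the hidden layers are literally those of
  -- `Φ`.
  let Ψ : M.feSpace k → Network d (Fin (k.valueDim d)) := fun v => Φ.combine (b.equivFun v)
  have hΨ : ∀ v : M.feSpace k, ∀ᵐ x ∂(volume.restrict Ω),
      WithLp.toLp 2 ((Ψ v).realize x.ofLp) = (v : FunctionClass Ω (k.valueDim d)) x := by
    intro v
    have hv : (v : FunctionClass Ω (k.valueDim d)) =
        ∑ i, b.equivFun v i • (b i : FunctionClass Ω (k.valueDim d)) := by
      conv_lhs => rw [← b.sum_equivFun v]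
      simp
    have hb' : ∀ᵐ x ∂(volume.restrict Ω), ∀ i, (b i : FunctionClass Ω (k.valueDim d)) x = θ i x :=
      ae_all_iff.2 hb
    have hs := coeFn_sum_smul Finset.univ (fun i => b.equivFun v i)
      (fun i => (b i : FunctionClass Ω (k.valueDim d)))
    rw [← hv] at hs
    filter_upwards [hs, hb', hΦ] with x h1 h2 h3
    rw [h1]
    ext j
    simp only [Ψ, Network.combine_realize, WithLp.ofLp_sum, Finset.sum_apply, h2, h3]
    simp
  -- The network determines its realization, which determines the class of `v`. Hence the
  -- parametrization by `v` is a bijection onto its range, and the linear structure is transported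
  -- along it.
  have hinj : Function.Injective Ψ := by
    intro v w hvw
    refine Subtype.ext (AEEqFun.ext ?_)
    filter_upwards [hΨ v, hΨ w] with x h1 h2
    rw [← h1, ← h2, hvw]
  have hrelu : ∀ l ∈ Φ.activations, ∀ a ∈ l, a = relu ∨ a = bisu := fun l hl a ha =>
    architecture_spec k (hact ▸ hl) ha
  refine ⟨hfin.symm, ?_, Φ, Ψ, ⟨hrelu, hΦ, hdepth, hsize', hact⟩, fun v => ⟨hrelu, hΨ v, hdepth, ?_,
    hact, rfl⟩, ?_⟩
  · rw [hfin, mul_assoc _ (M.maxAdj k : ℝ)]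
    refine mul_le_mul_of_nonneg_left ?_ (by positivity)
    have : ∑ i ∈ M.nodes k, M.adj i ≤ (M.nodes k).card • M.maxAdj k :=
      Finset.sum_le_card_nsmul _ _ _ fun i hi => Finset.le_sup (f := M.adj) hi
    rw [smul_eq_mul, mul_comm] at this
    exact_mod_cast this
  · refine le_trans ?_ hsize'
    exact_mod_cast Φ.combine_size_le (b.equivFun v)
  · let e : Set.range Ψ ≃ M.feSpace k := (Equiv.ofInjective Ψ hinj).symm
    have he : ∀ v, e ⟨Ψ v, v, rfl⟩ = v := fun v => (Equiv.ofInjective Ψ hinj).symm_apply_apply v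
    let i1 : AddCommGroup (Set.range Ψ) := e.addCommGroup
    let i2 : Module ℝ (Set.range Ψ) := e.module ℝ
    refine ⟨i1, i2, fun v w c => ?_, e.linearEquiv ℝ, fun F => ?_⟩
    · apply e.injective
      have h1 : e ((⟨Ψ v, v, rfl⟩ : Set.range Ψ) + c • ⟨Ψ w, w, rfl⟩) =
        e ⟨Ψ v, v, rfl⟩ + c • e ⟨Ψ w, w, rfl⟩ := by
        -- The operations on the range are by definition those for which `e` is linear.
        rw [← Equiv.linearEquiv_apply (R := ℝ), map_add, map_smul]; rfl
      rw [h1, he, he, he]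
    · obtain ⟨_, v, rfl⟩ := F
      filter_upwards [hΨ v] with x hx
      rw [hx]
      exact congrArg (fun w : M.feSpace k => (w : FunctionClass Ω (k.valueDim d)) x) (he v)

end SimplicialMesh

theorem linear_sub {W : Type*} [AddCommGroup W] [Module ℝ W] (A : E d →ᵃ[ℝ] W) (x y : E d) :
    A.linear (x - y) = A x - A y := A.linearMap_vsub x y

/-- The barycenter of a simplex. -/
def barycenter (s : Finset (E d)) : E d := ∑ y ∈ s, (s.card : ℝ)⁻¹ • y

theorem barycenter_mem {s : Finset (E d)} (hs : s.Nonempty) : barycenter s ∈ openHull s :=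
  centroid_mem_openHull hs

/-! ### Volumes of simplices and areas of faces -/

theorem cellVolume_pos {t : Finset (E d)} (ht : IsFullSimplex t) : 0 < cellVolume t := by
  refine ENNReal.toReal_pos
    (ht.isOpen_openHull.measure_pos volume (openHull_nonempty ht.nonempty)).ne' ?_
  exact ((measure_mono (openHull_subset_convexHull t)).trans_lt
    (t.finite_toSet.isCompact_convexHull ℝ).measure_lt_top).ne

/-- The hyperplane of the face is an isometric copy of `ℝ^(d-1)`, in which the open face becomes a
nonempty bounded open set. Boundedness matters as well, because `toReal` would turn an infinite
measure into `0`. -/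
theorem faceArea_pos (hd : 0 < d) {f t : Finset (E d)} (ht : IsFullSimplex t) (hft : f ⊆ t)
    (hf : f.card = d) : 0 < faceArea f := by
  have hne : f.Nonempty := by rw [← Finset.card_pos]; omega
  obtain ⟨y₀, hy₀⟩ := hne
  set a := oppositeVertex f t with ha
  let K : Submodule ℝ (E d) := LinearMap.ker (bary t a).linear
  have hK : Module.finrank ℝ K = d - 1 := by
    have h0 : (bary t a).linear ≠ 0 := by
      intro h
      have := linear_sub (bary t a) a y₀
      rw [h, ha, bary_opposite_self ht hft hf, bary_opposite_of_mem ht hft hf hy₀] at this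
      simp at this
    have := Module.Dual.finrank_ker_add_one_of_ne_zero
      (f := (bary t a).linear) h0
    rw [finrank_euclideanSpace, Fintype.card_fin] at this
    exact (Nat.sub_eq_of_eq_add this.symm).symm
  let φ : EuclideanSpace ℝ (Fin (d - 1)) ≃ₗᵢ[ℝ] K :=
    ((stdOrthonormalBasis ℝ K).reindex (finCongr hK)).repr.symm
  let g : EuclideanSpace ℝ (Fin (d - 1)) → E d := fun z => (φ z : E d) + y₀
  have hg : Isometry g := Isometry.of_dist_eq fun z z' => by
    simp only [g, dist_add_right]
    exact φ.dist_map z z'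
  have hgK : ∀ z, bary t a (g z) = 0 := fun z => by
    have h1 : (bary t a).linear (φ z : E d) = 0 := (φ z).2
    have h2 := linear_sub (bary t a) (g z) y₀
    simp only [g, add_sub_cancel_right] at h2
    rw [h1, ha, bary_opposite_of_mem ht hft hf hy₀, ← ha] at h2
    simp only [g]
    linarith
  have hrange : openHull f ⊆ Set.range g := by
    intro x hx
    have hxK : x - y₀ ∈ K := by
      change (bary t a).linear (x - y₀) = 0
      rw [linear_sub, ha, bary_opposite_of_mem_openHull ht hft hf hx,
        bary_opposite_of_mem ht hft hf hy₀, sub_zero]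
    exact ⟨φ.symm ⟨x - y₀, hxK⟩, by simp [g]⟩
  have hpre : g ⁻¹' openHull f = ⋂ y ∈ f, {z | 0 < bary t y (g z)} := by
    ext z
    simp only [Set.mem_preimage, Set.mem_iInter, Set.mem_ofPred_eq, ht.mem_openHull_iff hft]
    refine ⟨fun h => h.1, fun h => ⟨h, fun y hy hyf => ?_⟩⟩
    rw [eq_oppositeVertex ht hft hf hy hyf]
    exact hgK z
  have hopen : IsOpen (g ⁻¹' openHull f) := by
    rw [hpre]
    exact isOpen_biInter_finset fun y _ =>
      isOpen_lt continuous_const ((continuous_affineMap _).comp hg.continuous)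
  have hnonempty : (g ⁻¹' openHull f).Nonempty := by
    obtain ⟨x, hx⟩ := openHull_nonempty ⟨y₀, hy₀⟩
    obtain ⟨z, rfl⟩ := hrange hx
    exact ⟨z, hx⟩
  have hvol : Measure.euclideanHausdorffMeasure (d - 1) (openHull f) =
      volume (g ⁻¹' openHull f) := by
    rw [← EuclideanSpace.euclideanHausdorffMeasure_eq_volume, hg.euclideanHausdorffMeasure_preimage,
      Set.inter_eq_left.2 hrange]
  have hbdd : Bornology.IsBounded (g ⁻¹' openHull f) := by
    refine hg.antilipschitz.isBounded_preimage ?_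
    exact (t.finite_toSet.isCompact_convexHull ℝ).isBounded.subset
      ((openHull_subset_convexHull f).trans (convexHull_mono (by exact_mod_cast hft)))
  rw [faceArea, hvol]
  exact ENNReal.toReal_pos (hopen.measure_pos volume hnonempty).ne' hbdd.measure_lt_top.ne

namespace SimplicialMesh

variable {Ω : Set (E d)} (M : SimplicialMesh Ω)

/-- Volumes of simplices with a common face are proportional to their heights. -/
theorem cellVolume_eq (hd : 0 < d) {f s t : Finset (E d)} (hs : s ∈ M.cells) (ht : t ∈ M.cells)
    (hfs : f ⊆ s) (hft : f ⊆ t) (hf : f.card = d) (hst : s ≠ t) :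
    cellVolume t = -bary s (oppositeVertex f s) (oppositeVertex f t) * cellVolume s := by
  have hs' := M.isFullSimplex s hs
  have ht' := M.isFullSimplex t ht
  have hneg := M.bary_opposite_neg hs ht hfs hft hf hst hd
  set a := oppositeVertex f s with ha
  set b := oppositeVertex f t with hb
  -- Up to a translation, `x ↦ x + λ(x) (b - a)` with `λ` the coordinate of `a` in `s`: it fixes the
  -- vertices of `f`, sends `a` to `b` and hence `s` to `t`. Its determinant is `1 + (λ(b) - λ(a)) =
  -- λ(b)`.
  let L : E d →ₗ[ℝ] E d := LinearMap.transvection (bary s a).linear (b - a)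
  have hdet : LinearMap.det L = bary s a b := by
    rw [LinearMap.transvection.det, linear_sub, ha, bary_opposite_self hs' hfs hf]
    ring
  let φ : E d →ᵃ[ℝ] E d := L.toAffineMap + AffineMap.const ℝ (E d) (bary s a 0 • (b - a))
  have hφ : ∀ x, φ x = x + bary s a x • (b - a) := fun x => by
    have h1 : (bary s a).linear x = bary s a x - bary s a 0 := by
      rw [← linear_sub, sub_zero]
    simp [φ, L, LinearMap.transvection.apply, h1, sub_smul]
    abel
  have hφf : ∀ y ∈ f, φ y = y := fun y hy => by
    rw [hφ, ha, bary_opposite_of_mem hs' hfs hf hy, zero_smul, add_zero]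
  have hφa : φ a = b := by
    rw [hφ, ha, bary_opposite_self hs' hfs hf]; simp
  have h1 : ∀ y ∈ f, ∀ x, bary t y (φ x) = bary s y x := by
    intro y hy
    have : (bary t y).comp φ = bary s y := by
      refine hs'.affine_ext fun z hz => ?_
      rw [AffineMap.comp_apply]
      by_cases hzf : z ∈ f
      · rw [hφf z hzf]
        by_cases hzy : z = y
        · subst hzy; rw [hs'.bary_self hz, ht'.bary_self (hft hzf)]
        · rw [hs'.bary_of_ne hz hzy, ht'.bary_of_ne (hft hzf) hzy]
      · rw [eq_oppositeVertex hs' hfs hf hz hzf, ← ha, hφa,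
          ht'.bary_of_ne (oppositeVertex_mem ht' hft hf) (fun h =>
            oppositeVertex_notMem ht' hft hf (h ▸ hy)),
          hs'.bary_of_ne (oppositeVertex_mem hs' hfs hf) (fun h =>
            oppositeVertex_notMem hs' hfs hf (h ▸ hy))]
    exact fun x => by rw [← this]; rfl
  have h2 : ∀ x, bary t b (φ x) = bary s a x := by
    have : (bary t b).comp φ = bary s a := by
      refine hs'.affine_ext fun z hz => ?_
      rw [AffineMap.comp_apply]
      by_cases hzf : z ∈ f
      · rw [hφf z hzf, hb, bary_opposite_of_mem ht' hft hf hzf, ha,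
          bary_opposite_of_mem hs' hfs hf hzf]
      · rw [eq_oppositeVertex hs' hfs hf hz hzf, ← ha, hφa, hb, bary_opposite_self ht' hft hf, ha,
          bary_opposite_self hs' hfs hf]
    exact fun x => by rw [← this]; rfl
  have hpre : L ⁻¹' ((fun x => x + bary s a 0 • (b - a)) ⁻¹' openHull t) = openHull s := by
    ext x
    have hx : L x + bary s a 0 • (b - a) = φ x := by simp [φ]
    simp only [Set.mem_preimage, hx, ht'.mem_openHull_self_iff, hs'.mem_openHull_self_iff]
    constructor <;> intro h y hy <;> by_cases hyf : y ∈ f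
    · rw [← h1 y hyf]; exact h y (hft hyf)
    · rw [eq_oppositeVertex hs' hfs hf hy hyf, ← ha, ← h2]
      exact h b (oppositeVertex_mem ht' hft hf)
    · rw [h1 y hyf]; exact h y (hfs hyf)
    · rw [eq_oppositeVertex ht' hft hf hy hyf, ← hb, h2]
      exact h a (oppositeVertex_mem hs' hfs hf)
  have hvol := Measure.addHaar_preimage_linearMap volume (f := L) (by rw [hdet]; exact hneg.ne)
    ((fun x => x + bary s a 0 • (b - a)) ⁻¹' openHull t)
  rw [hpre, measure_preimage_add_right, hdet] at hvol
  have hvol' : cellVolume s = |(bary s a b)⁻¹| * cellVolume t := by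
    rw [cellVolume, hvol, ENNReal.toReal_mul, ENNReal.toReal_ofReal (abs_nonneg _), cellVolume]
  rw [hvol', abs_inv, abs_of_neg hneg]
  rw [← mul_assoc, mul_inv_cancel₀ (by linarith), one_mul]

/-! ### Piecewise affine functions -/

/-- The closure of the domain is compact and there are finitely many continuous pieces, so the
integrability conditions in the spaces hold automatically. -/
theorem memLp_of_piecewise (hΩ : IsPolytopalDomain Ω) {m : ℕ} {v : E d → E m}
    (hv : AEStronglyMeasurable v (volume.restrict Ω)) (p : Finset (E d) → E d → E m)
    (hp : ∀ t ∈ M.cells, Continuous (p t))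
    (h : ∀ t ∈ M.cells, ∀ᵐ x ∂(volume.restrict Ω), x ∈ openHull t → v x = p t x)
    (q : ENNReal) : MemLp v q (volume.restrict Ω) := by
  have : IsFiniteMeasure ((volume : Measure (E d)).restrict Ω) :=
    ⟨by simpa using M.volume_lt_top⟩
  have hc : ContinuousOn (fun x => ∑ t ∈ M.cells, ‖p t x‖) (closure Ω) :=
    continuousOn_finsetSum _ fun t ht => (hp t ht).norm.continuousOn
  obtain ⟨C, hC⟩ := M.isCompact_closure.exists_bound_of_continuousOn hc
  refine MemLp.of_bound hv C ?_
  have h' : ∀ᵐ x ∂(volume.restrict Ω), ∀ t ∈ M.cells, x ∈ openHull t → v x = p t x :=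
    (ae_ball_iff M.cells.countable_toSet).2 h
  filter_upwards [M.ae_mem_openHull hΩ, h'] with x ⟨t, ht, hxt⟩ hx
  rw [hx t ht hxt]
  refine le_trans ?_ ((le_abs_self _).trans
    (hC x (subset_closure (M.openHull_subset hΩ ht hxt))))
  exact Finset.single_le_sum (f := fun t => ‖p t x‖) (fun t _ => norm_nonneg _) ht

theorem sum_indicator_eq {W : Type*} [AddCommMonoid W] (S : Finset (Finset (E d)))
    (hS : S ⊆ M.cells) (g : Finset (E d) → E d → W) {t : Finset (E d)} (ht : t ∈ S) {x : E d}
    (hx : x ∈ openHull t) : ∑ s ∈ S, (openHull s).indicator (g s) x = g t x := by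
  rw [Finset.sum_eq_single_of_mem t ht, Set.indicator_of_mem hx]
  intro s hs hst
  exact Set.indicator_of_notMem (fun hxs =>
    Set.disjoint_left.1 (M.disjoint s (hS hs) t (hS ht) hst) hxs hx) _

theorem sum_indicator_eq_zero {W : Type*} [AddCommMonoid W] (S : Finset (Finset (E d)))
    (hS : S ⊆ M.cells) (g : Finset (E d) → E d → W) {t : Finset (E d)} (ht : t ∈ M.cells)
    (htS : t ∉ S) {x : E d} (hx : x ∈ openHull t) :
    ∑ s ∈ S, (openHull s).indicator (g s) x = 0 := by
  refine Finset.sum_eq_zero fun s hs => Set.indicator_of_notMem (fun hxs => ?_) _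
  exact Set.disjoint_left.1 (M.disjoint s (hS hs) t ht (fun h => htS (h ▸ hs))) hxs hx

theorem star_subset (i : Finset (E d)) : M.star i ⊆ M.cells := fun _ ht => (M.mem_star.1 ht).1

theorem star_nonempty_of_mem {j : ℕ} {i : Finset (E d)} (hi : i ∈ M.subsimplices j) :
    (M.star i).Nonempty := by
  obtain ⟨t, ht, hit, -⟩ := M.mem_subsimplices.1 hi
  exact ⟨t, M.mem_star.2 ⟨ht, hit⟩⟩

theorem card_of_mem {j : ℕ} {i : Finset (E d)} (hi : i ∈ M.subsimplices j) : i.card = j := by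
  obtain ⟨t, ht, hit, h⟩ := M.mem_subsimplices.1 hi
  exact h

theorem subsimplices_nonempty (hΩ : IsPolytopalDomain Ω) {j : ℕ} (hj : j ≤ d + 1) :
    (M.subsimplices j).Nonempty := by
  obtain ⟨t, ht⟩ := M.cells_nonempty hΩ
  obtain ⟨i, hi⟩ := Finset.exists_subset_card_eq (s := t) (n := j)
    (by rw [(M.isFullSimplex t ht).1]; exact hj)
  exact ⟨i, M.mem_subsimplices.2 ⟨t, ht, hi⟩⟩

/-! ### Jumps across faces -/

/-- For small `ε` the two evaluation points lie in the two open elements at the face, where `u`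
agrees with continuous functions. The jump therefore tends to the difference of these at `x₀`, up to
a sign. -/
theorem tendsto_jump_iff (hd : 0 < d) {W : Type} [AddCommGroup W] [Module ℝ W]
    [TopologicalSpace W] [IsTopologicalAddGroup W] [ContinuousSMul ℝ W] [T2Space W]
    (T : E d →ₗ[ℝ] W) {f s t : Finset (E d)} (hf : f.card = d) (hs : s ∈ M.star f)
    (ht : t ∈ M.star f) (hst : s ≠ t) {n : E d} (hn : IsUnitNormal f n) {x₀ : E d}
    (hx : x₀ ∈ openHull f) {u ps pt : E d → E d} (hps : Continuous ps) (hpt : Continuous pt)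
    (hus : Set.EqOn u ps (openHull s)) (hut : Set.EqOn u pt (openHull t)) :
    Tendsto (fun ε : ℝ => T (u (x₀ + ε • n) - u (x₀ - ε • n))) (𝓝[>] 0) (𝓝 0) ↔
      T (ps x₀ - pt x₀) = 0 := by
  rw [mem_star] at hs ht
  have hs' := M.isFullSimplex s hs.1
  have hne : f.Nonempty := by rw [← Finset.card_pos]; omega
  obtain ⟨h, h0, hh⟩ := exists_inner_normal hs' hs.2 hf hne hn
  have hT : Continuous T := T.continuous_of_finiteDimensional
  have hev := M.eventually_two_sides hs.1 ht.1 hs.2 ht.2 hf hst hd hx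
  set lam := bary s (oppositeVertex f s) with hlam
  have hx0 : lam x₀ = 0 := bary_opposite_of_mem_openHull hs' hs.2 hf hx
  have hn1 : h * lam.linear n = 1 := by
    rw [← hh, real_inner_self_eq_norm_sq, hn.1, one_pow]
  have hline : ∀ ε : ℝ, lam (x₀ + ε • n) = ε * lam.linear n := fun ε => by
    have := linear_sub lam (x₀ + ε • n) x₀
    rw [add_sub_cancel_left, map_smul, hx0, sub_zero, smul_eq_mul] at this
    exact this.symm
  have hline' : ∀ ε : ℝ, lam (x₀ - ε • n) = -(ε * lam.linear n) := fun ε => by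
    have := hline (-ε)
    rw [neg_smul, ← sub_eq_add_neg] at this
    rw [this]; ring
  have hlim1 : Tendsto (fun ε : ℝ => x₀ + ε • n) (𝓝[>] 0) (𝓝 x₀) := by
    have : Continuous (fun ε : ℝ => x₀ + ε • n) := by fun_prop
    simpa using (this.tendsto 0).mono_left nhdsWithin_le_nhds
  have hlim2 : Tendsto (fun ε : ℝ => x₀ - ε • n) (𝓝[>] 0) (𝓝 x₀) := by
    have : Continuous (fun ε : ℝ => x₀ - ε • n) := by fun_prop
    simpa using (this.tendsto 0).mono_left nhdsWithin_le_nhds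
  have hpos : ∀ᶠ ε : ℝ in 𝓝[>] 0, 0 < ε := self_mem_nhdsWithin
  -- The sign of this number tells whether `n` points into `t` or into `s`.
  rcases lt_or_gt_of_ne (fun h' : lam.linear n = 0 => by rw [h'] at hn1; simp at hn1) with hl | hl
  · have hlim : Tendsto (fun ε : ℝ => T (u (x₀ + ε • n) - u (x₀ - ε • n))) (𝓝[>] 0)
        (𝓝 (T (pt x₀ - ps x₀))) := by
      refine Tendsto.congr' ?_ ((hT.tendsto _).comp
        (((hpt.tendsto x₀).comp hlim1).sub ((hps.tendsto x₀).comp hlim2)))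
      filter_upwards [hlim1.eventually hev, hlim2.eventually hev, hpos] with ε h1 h2 h3
      have h4 := h1.2.1 (by rw [hline]; exact mul_neg_of_pos_of_neg h3 hl)
      have h5 := h2.1 (by rw [hline']; linarith [mul_neg_of_pos_of_neg h3 hl])
      simp only [Function.comp_apply]
      rw [hut h4, hus h5]
    rw [show T (ps x₀ - pt x₀) = 0 ↔ T (pt x₀ - ps x₀) = 0 by
      rw [← neg_sub, map_neg, neg_eq_zero]]
    exact ⟨fun h => tendsto_nhds_unique hlim h, fun h => h ▸ hlim⟩
  · have hlim : Tendsto (fun ε : ℝ => T (u (x₀ + ε • n) - u (x₀ - ε • n))) (𝓝[>] 0)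
        (𝓝 (T (ps x₀ - pt x₀))) := by
      refine Tendsto.congr' ?_ ((hT.tendsto _).comp
        (((hps.tendsto x₀).comp hlim1).sub ((hpt.tendsto x₀).comp hlim2)))
      filter_upwards [hlim1.eventually hev, hlim2.eventually hev, hpos] with ε h1 h2 h3
      have h4 := h1.1 (by rw [hline]; exact mul_pos h3 hl)
      have h5 := h2.2.1 (by rw [hline']; linarith [mul_pos h3 hl])
      simp only [Function.comp_apply]
      rw [hus h4, hut h5]
    exact ⟨fun h => tendsto_nhds_unique hlim h, fun h => h ▸ hlim⟩

/-- This replaces limits of a representative by values of the local pieces. The faces inside the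
domain are those with two adjacent elements: `openHull_face_subset` gives one direction and
`exists_second_cell` the other. -/
theorem mem_jumpSpace_iff (hΩ : IsPolytopalDomain Ω) (hd : 0 < d) {W : Type} [AddCommGroup W]
    [Module ℝ W] [TopologicalSpace W] [IsTopologicalAddGroup W] [ContinuousSMul ℝ W] [T2Space W]
    (P : Submodule ℝ (E d → E d)) (hP : ∀ p ∈ P, Continuous p) (trace : E d → E d →ₗ[ℝ] W)
    (v : FunctionClass Ω d) : v ∈ M.jumpSpace P trace ↔ ∃ p : Finset (E d) → E d → E d,
    (∀ t ∈ M.cells, p t ∈ P) ∧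
    (∀ t ∈ M.cells, ∀ᵐ x ∂(volume.restrict Ω), x ∈ openHull t → v x = p t x) ∧
    ∀ f ∈ M.subsimplices d, ∀ s ∈ M.star f, ∀ t ∈ M.star f, s ≠ t → ∀ n, IsUnitNormal f n →
      ∀ x₀ ∈ openHull f, trace n (p s x₀ - p t x₀) = 0 := by
  classical
  constructor
  · rintro ⟨-, u, hvu, hu, hjump⟩
    choose! p hpP hpu using hu
    refine ⟨p, hpP, fun t ht => ?_, fun f hf s hs t ht hst n hn x₀ hx₀ => ?_⟩
    · filter_upwards [hvu] with x hx hxt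
      rw [hx, hpu t ht hxt]
    · have hfc := M.card_of_mem hf
      have hs' := M.mem_star.1 hs
      have ht' := M.mem_star.1 ht
      exact (M.tendsto_jump_iff hd (trace n) hfc hs ht hst hn hx₀ (hP _ (hpP s hs'.1))
        (hP _ (hpP t ht'.1)) (hpu s hs'.1) (hpu t ht'.1)).1
        (hjump f hf (M.openHull_face_subset hs'.1 ht'.1 hs'.2 ht'.2 hfc hst hΩ hd) n hn x₀ hx₀)
  · rintro ⟨p, hpP, hpv, hpj⟩
    have hu : ∀ t ∈ M.cells, Set.EqOn
        (fun x => ∑ t ∈ M.cells, (openHull t).indicator (p t) x) (p t) (openHull t) :=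
      fun t ht x hx => M.sum_indicator_eq M.cells subset_rfl p ht hx
    refine ⟨M.memLp_of_piecewise hΩ v.aestronglyMeasurable p (fun t ht => hP _ (hpP t ht)) hpv 1,
      fun x => ∑ t ∈ M.cells, (openHull t).indicator (p t) x, ?_,
      fun t ht => ⟨p t, hpP t ht, hu t ht⟩, fun f hf hfΩ n hn x₀ hx₀ => ?_⟩
    · have hpv' : ∀ᵐ x ∂(volume.restrict Ω), ∀ t ∈ M.cells, x ∈ openHull t → v x = p t x :=
        (ae_ball_iff M.cells.countable_toSet).2 hpv
      filter_upwards [M.ae_mem_openHull hΩ, hpv'] with x ⟨t, ht, hxt⟩ hx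
      rw [hx t ht hxt]
      exact (hu t ht hxt).symm
    · have hfc := M.card_of_mem hf
      obtain ⟨s, hs⟩ := M.star_nonempty_of_mem hf
      obtain ⟨t, ht, hst⟩ := M.exists_second_cell hd hfc hs hΩ hfΩ
      have hs' := M.mem_star.1 hs
      have ht' := M.mem_star.1 ht
      exact (M.tendsto_jump_iff hd (trace n) hfc hs ht hst hn hx₀ (hP _ (hpP s hs'.1))
        (hP _ (hpP t ht'.1)) (hu s hs'.1) (hu t ht'.1)).2 (hpj f hf s hs t ht hst n hn x₀ hx₀)

end SimplicialMesh

theorem E_one_ext {x y : E 1} (h : x 0 = y 0) : x = y := by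
  ext j
  rw [Subsingleton.elim j 0]
  exact h

/-- Evaluation at a point, followed by a linear functional. -/
def evalDof {m : ℕ} (x : E d) (L : E m →ₗ[ℝ] ℝ) : (E d → E m) →ₗ[ℝ] ℝ :=
  L.comp (LinearMap.proj x)

theorem evalDof_apply {m : ℕ} (x : E d) (L : E m →ₗ[ℝ] ℝ) (p : E d → E m) :
    evalDof x L p = L (p x) := rfl

/-- The coordinate on `ℝ¹`. -/
def coordOne : E 1 →ₗ[ℝ] ℝ := (EuclideanSpace.proj 0 : E 1 →L[ℝ] ℝ).toLinearMap

theorem coordOne_apply (x : E 1) : coordOne x = x 0 := rfl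

namespace SimplicialMesh

variable {Ω : Set (E d)} (M : SimplicialMesh Ω)

/-! ### Piecewise constant functions -/

/-- The constant functions. -/
def constLocal (d m : ℕ) : Submodule ℝ (E d → E m) where
  carrier := {p | ∃ c : E m, ∀ x, p x = c}
  zero_mem' := ⟨0, fun _ => rfl⟩
  add_mem' := by
    rintro p q ⟨a, hp⟩ ⟨b, hq⟩
    exact ⟨a + b, fun x => by simp [hp, hq]⟩
  smul_mem' := by
    rintro r p ⟨a, hp⟩
    exact ⟨r • a, fun x => by simp [hp]⟩

theorem eq_of_mem_top {i t : Finset (E d)} (hi : i ∈ M.subsimplices (d + 1)) (ht : t ∈ M.cells)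
    (hit : i ⊆ t) : i = t :=
  Finset.eq_of_subset_of_card_le hit (by rw [(M.isFullSimplex t ht).1, M.card_of_mem hi])

/-- The finite element description of the piecewise constant functions. -/
def dataS0 (hΩ : IsPolytopalDomain Ω) : M.FEData 1 M.S0 (M.subsimplices (d + 1)) shapeS0 where
  P := constLocal d 1
  affine := by
    rintro p ⟨c, hc⟩
    exact ⟨AffineMap.const ℝ (E d) c, funext fun x => by simp [hc]⟩
  loc := fun _ _ _ => !₂[1]
  -- Local functions are constant, so any evaluation point serves.
  dof := fun _ => evalDof 0 coordOne
  star_nonempty := fun i hi => M.star_nonempty_of_mem hi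
  loc_mem := fun _ _ _ _ => ⟨_, fun _ => rfl⟩
  shape_eq := by
    intro i hi t ht x hx
    rw [M.eq_of_mem_top hi (M.mem_star.1 ht).1 (M.mem_star.1 ht).2]
    simp [shapeS0, hx]
  shape_eq_zero := by
    intro i hi t ht hit x hx
    obtain ⟨s, hs, his, -⟩ := M.mem_subsimplices.1 hi
    have := M.eq_of_mem_top hi hs his
    subst this
    have hxi : x ∉ openHull i := fun h => Set.disjoint_left.1
      (M.disjoint i hs t ht (fun h => hit (h ▸ subset_rfl))) h hx
    refine E_one_ext ?_
    simp [shapeS0, hxi]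
  dof_self := fun i hi => ⟨1, one_ne_zero, fun t ht => by simp [evalDof_apply, coordOne_apply]⟩
  dof_other := by
    intro i hi j hj hij t ht hit hjt
    exact absurd ((M.eq_of_mem_top hi ht hit).trans (M.eq_of_mem_top hj ht hjt).symm) hij
  unisolvent := by
    rintro p ⟨c, hc⟩ t ht h
    have h0 := h t (M.mem_subsimplices.2 ⟨t, ht, subset_rfl, (M.isFullSimplex t ht).1⟩) subset_rfl
    rw [evalDof_apply, coordOne_apply, hc] at h0
    funext x
    rw [hc]
    exact E_one_ext h0
  mem_iff := by
    intro v
    constructor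
    · rintro ⟨-, h⟩
      choose! c hc using h
      refine ⟨fun t _ => !₂[c t], fun t _ => ⟨_, fun _ => rfl⟩, fun t ht => ?_,
        fun i hi s hs t ht => rfl.trans ?_⟩
      · filter_upwards [hc t ht] with x hx hxt
        exact E_one_ext (by simpa using hx hxt)
      · rw [← M.eq_of_mem_top hi (M.mem_star.1 hs).1 (M.mem_star.1 hs).2,
          ← M.eq_of_mem_top hi (M.mem_star.1 ht).1 (M.mem_star.1 ht).2]
    · rintro ⟨p, hpP, hpv, -⟩
      refine ⟨M.memLp_of_piecewise hΩ v.aestronglyMeasurable p (fun t ht => ?_) hpv 2,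
        fun t ht => ?_⟩
      · obtain ⟨c, hc⟩ := hpP t ht
        rw [show p t = fun _ => c from funext hc]
        exact continuous_const
      · obtain ⟨c, hc⟩ := hpP t ht
        refine ⟨c 0, ?_⟩
        filter_upwards [hpv t ht] with x hx hxt
        rw [hx hxt, hc]

/-! ### Raviart-Thomas functions -/

theorem rtLocal_affine {p : E d → E d} (hp : p ∈ rtLocal d) : ∃ A : E d →ᵃ[ℝ] E d, p = A := by
  obtain ⟨a, c, h⟩ := hp
  refine ⟨AffineMap.const ℝ (E d) a + (c • LinearMap.id : E d →ₗ[ℝ] E d).toAffineMap,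
    funext fun x => by simp [h]⟩

theorem rtLocal_continuous {p : E d → E d} (hp : p ∈ rtLocal d) : Continuous p := by
  obtain ⟨A, rfl⟩ := rtLocal_affine hp
  exact continuous_affineMap A

variable {M} in
/-- The barycentric coordinate of the first element at `f` that vanishes on `f`. -/
def Orientation.faceCoord (o : M.Orientation) (f : Finset (E d)) : E d →ᵃ[ℝ] ℝ :=
  bary (o.first f) (oppositeVertex f (o.first f))

/-- Normal components of Raviart-Thomas functions are constant on faces. -/
theorem rtLocal_normal {p : E d → E d} (hp : p ∈ rtLocal d) (lam : E d →ᵃ[ℝ] ℝ) {x y : E d}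
    (h : lam x = lam y) : lam.linear (p x) = lam.linear (p y) := by
  obtain ⟨a, c, hp⟩ := hp
  have h1 := linear_sub lam x y
  rw [map_sub, h, sub_self, sub_eq_zero] at h1
  rw [hp, hp, map_add, map_add, map_smul, map_smul, h1]

variable (o : M.Orientation)

/-- The degree of freedom at the face `f`: a multiple of the normal component. -/
def dofRT0 (f : Finset (E d)) : (E d → E d) →ₗ[ℝ] ℝ :=
  evalDof (barycenter f) (o.faceCoord f).linear

open Classical in
/-- The Raviart-Thomas shape function of `f` on the element `t`. -/
def locRT0 (f t : Finset (E d)) (x : E d) : E d :=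
  ((if t = o.first f then 1 else -1) * (faceArea f / (d * cellVolume t))) • (x - oppositeVertex f t)

theorem face_nonempty (hd : 0 < d) {f : Finset (E d)} (hf : f ∈ M.subsimplices d) :
    f.Nonempty := by
  rw [← Finset.card_pos, M.card_of_mem hf]; exact hd

theorem faceCoord_of_mem {f : Finset (E d)} (hf : f ∈ M.subsimplices d) {x : E d}
    (hx : x ∈ openHull f) : o.faceCoord f x = 0 := by
  have h := M.mem_star.1 (o.first_mem f hf)
  exact bary_opposite_of_mem_openHull (M.isFullSimplex _ h.1) h.2 (M.card_of_mem hf) hx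

theorem faceCoord_vertex {f : Finset (E d)} (hf : f ∈ M.subsimplices d) {x : E d}
    (hx : x ∈ f) : o.faceCoord f x = 0 := by
  have h := M.mem_star.1 (o.first_mem f hf)
  exact bary_opposite_of_mem (M.isFullSimplex _ h.1) h.2 (M.card_of_mem hf) hx

/-- For `p x = a + c • x` the hypothesis on the face opposite to `y` says that the linear part of
the coordinate of `y` maps `a` to `c` times its value at the origin. The coordinates sum to `1` and
their linear parts to `0`, whence `c = 0`; then `a` and `0` have the same coordinates. -/
theorem rtLocal_unisolvent {t : Finset (E d)} (ht : IsFullSimplex t) {p : E d → E d}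
    (hp : p ∈ rtLocal d) (h : ∀ y ∈ t, ∃ x, bary t y x = 0 ∧ (bary t y).linear (p x) = 0) :
    p = 0 := by
  obtain ⟨a, c, hp⟩ := hp
  have h1 : ∀ y ∈ t, (bary t y).linear a = c * bary t y 0 := by
    intro y hy
    obtain ⟨x, hx, hxp⟩ := h y hy
    have h2 := linear_sub (bary t y) x 0
    rw [sub_zero, hx, zero_sub] at h2
    rw [hp, map_add, map_smul, h2, smul_eq_mul] at hxp
    linarith
  have h2 : ∀ y, (bary t y).linear a = bary t y a - bary t y 0 := fun y => by
    rw [← linear_sub, sub_zero]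
  have hc : c = 0 := by
    have h3 : ∑ y ∈ t, (bary t y).linear a = ∑ y ∈ t, c * bary t y 0 :=
      Finset.sum_congr rfl h1
    rw [← Finset.mul_sum, ht.sum_bary, Finset.sum_congr rfl fun y _ => h2 y,
      Finset.sum_sub_distrib, ht.sum_bary, ht.sum_bary] at h3
    linarith
  have ha : a = 0 := by
    rw [← ht.sum_bary_smul a, ← ht.sum_bary_smul 0]
    refine Finset.sum_congr rfl fun y hy => ?_
    have h3 := h1 y hy
    rw [h2, hc, zero_mul, sub_eq_zero] at h3
    rw [h3]
  funext x
  simp [hp, ha, hc]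

/-- Degrees of freedom of Raviart-Thomas functions agree if and only if the normal components do. -/
theorem dofRT0_eq_iff (hd : 0 < d) {f : Finset (E d)} (hf : f ∈ M.subsimplices d)
    {p q : E d → E d} (hp : p ∈ rtLocal d) (hq : q ∈ rtLocal d) :
    M.dofRT0 o f p = M.dofRT0 o f q ↔
      ∀ n, IsUnitNormal f n → ∀ x₀ ∈ openHull f, inner ℝ (p x₀ - q x₀) n = 0 := by
  have h1 := M.mem_star.1 (o.first_mem f hf)
  have hs := M.isFullSimplex _ h1.1
  have hfc := M.card_of_mem hf
  have hne := M.face_nonempty hd hf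
  constructor
  · intro h n hn x₀ hx₀
    obtain ⟨c, hc0, hc⟩ := exists_inner_normal hs h1.2 hfc hne hn
    have h2 : ∀ q ∈ rtLocal d, (o.faceCoord f).linear (q x₀) =
        (o.faceCoord f).linear (q (barycenter f)) := fun q hq =>
      rtLocal_normal hq _ (by
        rw [M.faceCoord_of_mem o hf hx₀, M.faceCoord_of_mem o hf (barycenter_mem hne)])
    rw [hc]
    change c * (o.faceCoord f).linear (p x₀ - q x₀) = 0
    rw [map_sub, h2 _ hp, h2 _ hq]
    have h3 : (o.faceCoord f).linear (p (barycenter f)) =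
      (o.faceCoord f).linear (q (barycenter f)) := h
    rw [h3, sub_self, mul_zero]
  · intro h
    obtain ⟨n, hn⟩ := exists_unitNormal hs h1.2 hfc hne
    obtain ⟨c, hc0, hc⟩ := exists_inner_normal hs h1.2 hfc hne hn
    have h2 : inner ℝ (p (barycenter f) - q (barycenter f)) n = 0 :=
      h n hn _ (barycenter_mem hne)
    rw [hc, mul_eq_zero, or_iff_right hc0, map_sub, sub_eq_zero] at h2
    exact h2

open Classical in
/-- The finite element description of the Raviart-Thomas space. -/
def dataRT0 (hΩ : IsPolytopalDomain Ω) (hd : 0 < d) :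
    M.FEData d M.RT0 (M.subsimplices d) (M.shapeRT0 o) where
  P := rtLocal d
  affine := fun p hp => rtLocal_affine hp
  loc := M.locRT0 o
  dof := M.dofRT0 o
  star_nonempty := fun i hi => M.star_nonempty_of_mem hi
  loc_mem := fun f _ t _ => by
    set r := (if t = o.first f then 1 else -1) * (faceArea f / (d * cellVolume t)) with hr
    exact ⟨-(r • oppositeVertex f t), r, fun x => by
      rw [locRT0, ← hr, smul_sub]; abel⟩
  shape_eq := fun f _ t ht x hx => by
    exact M.sum_indicator_eq (M.star f) (M.star_subset f) (M.locRT0 o f) ht hx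
  shape_eq_zero := fun f _ t ht hft x hx => by
    exact M.sum_indicator_eq_zero (M.star f) (M.star_subset f) (M.locRT0 o f) ht
      (fun h => hft (M.mem_star.1 h).2) hx
  dof_self := by
    intro f hf
    have hfc := M.card_of_mem hf
    have h1 := M.mem_star.1 (o.first_mem f hf)
    have hs := M.isFullSimplex _ h1.1
    have hvol := cellVolume_pos hs
    have harea := faceArea_pos hd hs h1.2 hfc
    -- The value on the first element. On the second one the sign `-1` compensates for the opposite
    -- side of the face, and by `cellVolume_eq` the ratio of the volumes cancels the ratio of the
    -- heights.
    refine ⟨-(faceArea f / (d * cellVolume (o.first f))), ?_, fun t ht => ?_⟩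
    · have : (0 : ℝ) < d := by exact_mod_cast hd
      exact neg_ne_zero.2 (by positivity)
    · rw [mem_star] at ht
      rw [dofRT0, evalDof_apply, locRT0, map_smul, linear_sub,
        M.faceCoord_of_mem o hf (barycenter_mem (M.face_nonempty hd hf)), smul_eq_mul]
      by_cases h : t = o.first f
      · rw [if_pos h, h, Orientation.faceCoord, bary_opposite_self hs h1.2 hfc]
        ring
      · rw [if_neg h, M.cellVolume_eq hd h1.1 ht.1 h1.2 ht.2 hfc (Ne.symm h),
          Orientation.faceCoord]
        have hneg := M.bary_opposite_neg h1.1 ht.1 h1.2 ht.2 hfc (Ne.symm h) hd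
        set b := bary (o.first f) (oppositeVertex f (o.first f)) (oppositeVertex f t)
        have : b ≠ 0 := hneg.ne
        have : (d : ℝ) ≠ 0 := by exact_mod_cast hd.ne'
        field_simp
        ring
  dof_other := by
    intro f hf g hg hfg t ht hft hgt
    have ht' := M.isFullSimplex t ht
    -- The function attached to `f` is directed away from this vertex. Since the vertex lies on `g`,
    -- the function is tangential on `g`.
    have hmem : oppositeVertex f t ∈ g := by
      by_contra h
      refine hfg (Finset.eq_of_subset_of_card_le (fun y hy => ?_) ?_).symm
      · by_contra hyf
        exact h (eq_oppositeVertex ht' hft (M.card_of_mem hf) (hgt hy) hyf ▸ hy)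
      · rw [M.card_of_mem hf, M.card_of_mem hg]
    rw [dofRT0, evalDof_apply, locRT0, map_smul, linear_sub,
      M.faceCoord_of_mem o hg (barycenter_mem (M.face_nonempty hd hg)),
      M.faceCoord_vertex o hg hmem, sub_self, smul_zero]
  unisolvent := by
    intro p hp t ht h
    have ht' := M.isFullSimplex t ht
    refine rtLocal_unisolvent ht' hp fun y hy => ?_
    have hfc : (t.erase y).card = d := by rw [Finset.card_erase_of_mem hy, ht'.1]; rfl
    have hft : t.erase y ⊆ t := Finset.erase_subset _ _
    have hf : t.erase y ∈ M.subsimplices d := M.mem_subsimplices.2 ⟨t, ht, hft, hfc⟩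
    have hopp : oppositeVertex (t.erase y) t = y :=
      (eq_oppositeVertex ht' hft hfc hy (Finset.notMem_erase y t)).symm
    have hx := barycenter_mem (M.face_nonempty hd hf)
    refine ⟨barycenter (t.erase y), ?_, ?_⟩
    · have := bary_opposite_of_mem_openHull ht' hft hfc hx
      rwa [hopp] at this
    · have h0 := h _ hf hft
      rw [dofRT0, evalDof_apply] at h0
      have h1 := M.mem_star.1 (o.first_mem _ hf)
      -- The degree of freedom uses the coordinate of the chosen first element, which is
      -- proportional to that of `t`.
      have hmul := M.bary_opposite_mul ht h1.1 hft h1.2 hfc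
      rw [hopp] at hmul
      have h2 : ∀ w, (bary t y).linear w = bary t y (oppositeVertex (t.erase y)
          (o.first (t.erase y))) * (o.faceCoord (t.erase y)).linear w := by
        intro w
        have e1 := linear_sub (bary t y) w 0
        have e2 := linear_sub (o.faceCoord (t.erase y)) w 0
        rw [sub_zero] at e1 e2
        rw [e1, e2, hmul w, hmul 0, Orientation.faceCoord]
        ring
      rw [h2, h0, mul_zero]
  mem_iff := by
    intro v
    rw [RT0, M.mem_jumpSpace_iff hΩ hd _ (fun p hp => rtLocal_continuous hp)]
    refine exists_congr fun p => and_congr_right fun hpP => and_congr_right fun _ =>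
      forall₂_congr fun f hf => forall₂_congr fun s hs => forall₂_congr fun t ht => ?_
    rw [M.dofRT0_eq_iff o hd hf (hpP s (M.mem_star.1 hs).1) (hpP t (M.mem_star.1 ht).1)]
    refine ⟨fun h => ?_, fun h _ => h⟩
    by_cases hst : s = t
    · simp [hst]
    · exact h hst

end SimplicialMesh

namespace SimplicialMesh

/-! ### Nédélec functions in the plane -/

/-- The rotation as a linear map. -/
def rotLinear : E 2 →ₗ[ℝ] E 2 where
  toFun := rot
  map_add' x y := by ext j; fin_cases j <;> simp [rot]; ring
  map_smul' r x := by ext j; fin_cases j <;> simp [rot]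

theorem rotLinear_apply (x : E 2) : rotLinear x = rot x := rfl

theorem rot_rot (x : E 2) : rot (rot x) = -x := by
  ext j; fin_cases j <;> simp [rot]

/-- The inverse rotation `-rot` turns Nédélec functions into Raviart-Thomas functions and tangential
components into normal ones; the planar case is transported along it. -/
theorem neLocal_two_iff {p : E 2 → E 2} :
    p ∈ neLocal 2 ↔ -(rotLinear.compLeft (E 2)) p ∈ rtLocal 2 := by
  constructor
  · rintro ⟨a, c, h⟩
    refine ⟨-rot a, c, fun x => ?_⟩
    change -rotLinear (p x) = _
    rw [h, map_add, map_smul, rotLinear_apply, rotLinear_apply, rot_rot]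
    simp [add_comm]
  · rintro ⟨a, c, h⟩
    refine ⟨rot a, c, fun x => ?_⟩
    have h1 : -rotLinear (p x) = a + c • x := h x
    have h2 := congrArg rotLinear h1
    rw [map_neg, map_add, map_smul, rotLinear_apply, rotLinear_apply, rotLinear_apply, rot_rot,
      neg_neg, rotLinear_apply] at h2
    exact h2

theorem tangentialPart_two (n w : E 2) :
    tangentialPart n w = 0 ↔ inner ℝ (-rot w) n = (0 : ℝ) := by
  have h1 : tangentialPart n w = ![0, 0, w 0 * n 1 - w 1 * n 0] := by
    ext j
    fin_cases j <;> simp [tangentialPart, embed3, cross_apply]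
  have h2 : inner ℝ (-rot w) n = w 1 * n 0 - w 0 * n 1 := by
    simp [rot, PiLp.inner_apply, Fin.sum_univ_two]
    ring
  rw [h1, h2]
  constructor
  · intro h
    have := congrFun h 2
    simp at this
    linarith
  · intro h
    have : w 0 * n 1 - w 1 * n 0 = 0 := by linarith
    rw [this]
    ext j; fin_cases j <;> rfl

theorem neLocal_two_affine {p : E 2 → E 2} (hp : p ∈ neLocal 2) :
    ∃ A : E 2 →ᵃ[ℝ] E 2, p = A := by
  obtain ⟨a, c, h⟩ := hp
  exact ⟨AffineMap.const ℝ (E 2) a + (c • rotLinear).toAffineMap, funext fun x => by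
    simp [h, rotLinear_apply]⟩

/-- The finite element description of the Nédélec space in the plane. -/
def dataN0Two {Ω : Set (E 2)} (M : SimplicialMesh Ω) (o : M.Orientation)
    (hΩ : IsPolytopalDomain Ω) : M.FEData 2 M.N0 (M.subsimplices 2) (M.shapeN0 o) where
  P := neLocal 2
  affine := fun p hp => neLocal_two_affine hp
  loc := fun i t => rotLinear.compLeft (E 2) ((M.dataRT0 o hΩ two_pos).loc i t)
  dof := fun i => (M.dofRT0 o i).comp (-rotLinear.compLeft (E 2))
  star_nonempty := fun i hi => M.star_nonempty_of_mem hi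
  loc_mem := fun i hi t ht => by
    rw [neLocal_two_iff]
    convert! (M.dataRT0 o hΩ two_pos).loc_mem i hi t ht using 1
    funext x
    change -rot (rot _) = _
    rw [rot_rot, neg_neg]
  shape_eq := fun i hi t ht x hx =>
    congrArg rot ((M.dataRT0 o hΩ two_pos).shape_eq i hi t ht x hx)
  shape_eq_zero := fun i hi t ht hit x hx =>
    (congrArg rot ((M.dataRT0 o hΩ two_pos).shape_eq_zero i hi t ht hit x hx)).trans
      (map_zero rotLinear)
  dof_self := fun i hi => by
    obtain ⟨c, hc0, hc⟩ := (M.dataRT0 o hΩ two_pos).dof_self i hi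
    refine ⟨c, hc0, fun t ht => (hc t ht ▸ ?_)⟩
    refine congrArg (M.dofRT0 o i) (funext fun x => ?_)
    change -rot (rot _) = _
    rw [rot_rot, neg_neg]
  dof_other := fun i hi j hj hij t ht hit hjt => by
    have := (M.dataRT0 o hΩ two_pos).dof_other i hi j hj hij t ht hit hjt
    refine Eq.trans ?_ this
    refine congrArg (M.dofRT0 o j) (funext fun x => ?_)
    change -rot (rot _) = _
    rw [rot_rot, neg_neg]
  unisolvent := fun p hp t ht h => by
    have h1 := (M.dataRT0 o hΩ two_pos).unisolvent _ (neLocal_two_iff.1 hp) t ht h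
    funext x
    have h2 : -rotLinear (p x) = 0 := congrFun h1 x
    have h3 := congrArg rotLinear h2
    rw [map_neg, rotLinear_apply, rotLinear_apply, rot_rot, neg_neg, map_zero] at h3
    exact h3
  mem_iff := by
    intro v
    rw [N0, M.mem_jumpSpace_iff hΩ two_pos _ (fun p hp => by
      obtain ⟨A, rfl⟩ := neLocal_two_affine hp
      exact continuous_affineMap A)]
    refine exists_congr fun p => and_congr_right fun hpP => and_congr_right fun _ =>
      forall₂_congr fun f hf => forall₂_congr fun s hs => forall₂_congr fun t ht => ?_
    have h1 := M.dofRT0_eq_iff o two_pos hf (neLocal_two_iff.1 (hpP s (M.mem_star.1 hs).1))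
      (neLocal_two_iff.1 (hpP t (M.mem_star.1 ht).1))
    refine Iff.trans ?_ h1.symm
    have h2 : ∀ (n x₀ : E 2), tangentialPart n (p s x₀ - p t x₀) = 0 ↔
        inner ℝ ((-(rotLinear.compLeft (E 2)) (p s)) x₀ -
          (-(rotLinear.compLeft (E 2)) (p t)) x₀) n = (0 : ℝ) := by
      intro n x₀
      rw [tangentialPart_two]
      have : -rot (p s x₀ - p t x₀) = -rotLinear (p s x₀) - -rotLinear (p t x₀) := by
        rw [← rotLinear_apply, map_sub]; abel
      rw [this]
      rfl
    refine ⟨fun h n hn x₀ hx₀ => ?_, fun h _ n hn x₀ hx₀ => (h2 n x₀).2 (h n hn x₀ hx₀)⟩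
    by_cases hst : s = t
    · simp [hst]
    · exact (h2 n x₀).1 (h hst n hn x₀ hx₀)

/-! ### Nédélec functions in space -/

theorem inner_three (x y : E 3) : inner ℝ x y = x 0 * y 0 + x 1 * y 1 + x 2 * y 2 := by
  simp [PiLp.inner_apply, Fin.sum_univ_three]
  ring

theorem cross_zero (x y : E 3) : cross x y 0 = x 1 * y 2 - x 2 * y 1 := by
  simp [cross, cross_apply]

theorem cross_one (x y : E 3) : cross x y 1 = x 2 * y 0 - x 0 * y 2 := by
  simp [cross, cross_apply]

theorem cross_two (x y : E 3) : cross x y 2 = x 0 * y 1 - x 1 * y 0 := by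
  simp [cross, cross_apply]

theorem E_three_ext {x y : E 3} (h0 : x 0 = y 0) (h1 : x 1 = y 1) (h2 : x 2 = y 2) : x = y := by
  ext j; fin_cases j <;> assumption

/-- The cross product as a linear map in the first argument. -/
def crossLinear (b : E 3) : E 3 →ₗ[ℝ] E 3 where
  toFun x := cross x b
  map_add' x y := by
    refine E_three_ext ?_ ?_ ?_ <;> simp only [cross_zero, cross_one, cross_two, PiLp.add_apply] <;>
      ring
  map_smul' r x := by
    refine E_three_ext ?_ ?_ ?_ <;> simp only [cross_zero, cross_one, cross_two, PiLp.smul_apply,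
      smul_eq_mul, RingHom.id_apply] <;> ring

theorem crossLinear_apply (b x : E 3) : crossLinear b x = cross x b := rfl

theorem cross_self (x : E 3) : cross x x = 0 := by
  refine E_three_ext ?_ ?_ ?_ <;> simp only [cross_zero, cross_one, cross_two, PiLp.zero_apply] <;>
      ring

theorem cross_smul_self (r : ℝ) (x : E 3) : cross (r • x) x = 0 := by
  rw [← crossLinear_apply, map_smul, crossLinear_apply, cross_self, smul_zero]

theorem inner_cross_self (x b : E 3) : inner ℝ (cross x b) x = (0 : ℝ) := by
  rw [inner_three, cross_zero, cross_one, cross_two]; ring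

theorem inner_cross_cross (w v n : E 3) : inner ℝ (cross w n) (cross v n) =
    inner ℝ w v * inner ℝ n n - inner ℝ w n * inner ℝ v n := by
  simp only [inner_three, cross_zero, cross_one, cross_two]; ring

theorem tangentialPart_three (n w : E 3) : tangentialPart n w = (cross w n).ofLp := by
  have h : ∀ w : E 3, embed3 3 w = w.ofLp := fun w => by
    ext j; simp [embed3]
  simp [tangentialPart, h, cross]

theorem neLocal_three_affine {p : E 3 → E 3} (hp : p ∈ neLocal 3) :
    ∃ A : E 3 →ᵃ[ℝ] E 3, p = A := by
  obtain ⟨a, b, h⟩ := hp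
  exact ⟨AffineMap.const ℝ (E 3) a + (crossLinear b).toAffineMap, funext fun x => by
    simp [h, crossLinear_apply]⟩

/-- Tangential components of Nédélec functions are constant along lines. -/
theorem neLocal_tangent {p : E 3 → E 3} (hp : p ∈ neLocal 3) {x y w : E 3} {r : ℝ}
    (h : x - y = r • w) : inner ℝ (p x) w = inner ℝ (p y) w := by
  obtain ⟨a, b, hp⟩ := hp
  have hx : x = y + r • w := by rw [← h]; abel
  rw [hp, hp, hx, ← crossLinear_apply, ← crossLinear_apply, map_add, map_smul, crossLinear_apply,
    crossLinear_apply, inner_add_left, inner_add_left, inner_add_left, inner_smul_left,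
    inner_cross_self]
  simp

/-- The affine function `x ↦ w · (x - y)` vanishes at all vertices, hence everywhere, in particular
at `w + y`. -/
theorem eq_zero_of_inner_vertices {d : ℕ} {t : Finset (E d)} (ht : IsFullSimplex t) {w y : E d}
    (h : ∀ z ∈ t, inner ℝ w (z - y) = 0) : w = 0 := by
  let A : E d →ᵃ[ℝ] ℝ :=
    (innerₗ (E d) w).toAffineMap - AffineMap.const ℝ (E d) (inner ℝ w y)
  have hA : ∀ x, A x = inner ℝ w (x - y) := fun x => by simp [A, inner_sub_right]
  have h0 : A = 0 := ht.affine_ext fun z hz => by rw [hA, h z hz]; rfl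
  have := hA (w + y)
  rw [h0, add_sub_cancel_right, real_inner_self_eq_norm_sq] at this
  simpa using this.symm

variable {Ω : Set (E 3)} (M : SimplicialMesh Ω) (o : M.Orientation)

theorem tangent_ne_zero {e : Finset (E 3)} (he : e ∈ M.subsimplices 2) : o.tangent e ≠ 0 := by
  intro h
  have := o.norm_tangent e he
  rw [h, norm_zero] at this
  exact zero_ne_one this

theorem exists_tangent {e : Finset (E 3)} (he : e ∈ M.subsimplices 2) {y z : E 3} (hy : y ∈ e)
    (hz : z ∈ e) (hyz : y ≠ z) : ∃ r : ℝ, r ≠ 0 ∧ z - y = r • o.tangent e := by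
  classical
  have hez : e = {y, z} := (Finset.eq_of_subset_of_card_le (by
    intro x hx; simp only [Finset.mem_insert, Finset.mem_singleton] at hx
    rcases hx with rfl | rfl <;> assumption)
    (by rw [M.card_of_mem he, Finset.card_pair hyz])).symm
  have h := o.tangent_mem e he
  rw [hez, Finset.coe_pair, Set.pair_comm, vectorSpan_pair, Submodule.mem_span_singleton, ← hez] at h
  obtain ⟨r, hr⟩ := h
  have hr0 : r ≠ 0 := by
    rintro rfl
    rw [zero_smul] at hr
    exact M.tangent_ne_zero o he hr.symm
  refine ⟨r⁻¹, inv_ne_zero hr0, ?_⟩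
  rw [← hr, smul_smul, inv_mul_cancel₀ hr0, one_smul, vsub_eq_sub]

theorem exists_other_vertex {e : Finset (E 3)} (he : e ∈ M.subsimplices 2) {y : E 3}
    (hy : y ∈ e) : ∃ z ∈ e, y ≠ z ∧ edgeMidpoint e - y = (1 / 2 : ℝ) • (z - y) := by
  classical
  have hc := M.card_of_mem he
  obtain ⟨z, hz⟩ := Finset.card_eq_one.1 (show (e.erase y).card = 1 by
    rw [Finset.card_erase_of_mem hy, hc])
  have hze : z ∈ e.erase y := by simp [hz]
  rw [Finset.mem_erase] at hze
  refine ⟨z, hze.2, hze.1.symm, ?_⟩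
  rw [edgeMidpoint, ← Finset.add_sum_erase e (fun y => y) hy, hz, Finset.sum_singleton]
  module

theorem exists_midpoint_sub {e : Finset (E 3)} (he : e ∈ M.subsimplices 2) {y : E 3}
    (hy : y ∈ e) : ∃ r : ℝ, edgeMidpoint e - y = r • o.tangent e := by
  obtain ⟨z, hz, hyz, h⟩ := M.exists_other_vertex he hy
  obtain ⟨r, -, hr⟩ := M.exists_tangent o he hy hz hyz
  exact ⟨1 / 2 * r, by rw [h, hr, smul_smul]⟩

/-- The degree of freedom at the edge `e`: the tangential component. -/
def dofN0 (e : Finset (E 3)) : (E 3 → E 3) →ₗ[ℝ] ℝ :=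
  evalDof (edgeMidpoint e) ((innerₗ (E 3)).flip (o.tangent e))

theorem dofN0_apply (e : Finset (E 3)) (p : E 3 → E 3) :
    M.dofN0 o e p = inner ℝ (p (edgeMidpoint e)) (o.tangent e) := by
  simp [dofN0, evalDof_apply, real_inner_comm]

/-- The tangential component is constant along the edge, so the midpoint may be replaced by either
endpoint. -/
theorem dofN0_eq {e : Finset (E 3)} (he : e ∈ M.subsimplices 2) {p : E 3 → E 3}
    (hp : p ∈ neLocal 3) {y : E 3} (hy : y ∈ e) :
    M.dofN0 o e p = inner ℝ (p y) (o.tangent e) := by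
  obtain ⟨r, hr⟩ := M.exists_midpoint_sub o he hy
  rw [dofN0_apply, neLocal_tangent hp hr]

/-- Two different endpoints differ by a nonzero multiple of the chosen tangent, so vanishing does
not depend on that choice. -/
theorem dofN0_eq_zero_iff {e : Finset (E 3)} (he : e ∈ M.subsimplices 2) {p : E 3 → E 3}
    (hp : p ∈ neLocal 3) : M.dofN0 o e p = 0 ↔ ∀ y ∈ e, ∀ z ∈ e, inner ℝ (p y) (z - y) = 0 := by
  constructor
  · intro h y hy z hz
    by_cases hyz : y = z
    · simp [hyz]
    obtain ⟨r, -, hr⟩ := M.exists_tangent o he hy hz hyz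
    rw [hr, inner_smul_right, ← M.dofN0_eq o he hp hy, h, mul_zero]
  · intro h
    have hne : e.Nonempty := by rw [← Finset.card_pos, M.card_of_mem he]; norm_num
    obtain ⟨y, hy⟩ := hne
    obtain ⟨z, hz, hyz, -⟩ := M.exists_other_vertex he hy
    obtain ⟨r, hr0, hr⟩ := M.exists_tangent o he hy hz hyz
    have h1 := h y hy z hz
    rw [hr, inner_smul_right, mul_eq_zero, or_iff_right hr0] at h1
    rw [M.dofN0_eq o he hp hy, h1]

theorem pair_mem_subsimplices [DecidableEq (E 3)] {t : Finset (E 3)} (ht : t ∈ M.cells)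
    {y z : E 3} (hy : y ∈ t) (hz : z ∈ t) (hyz : y ≠ z) :
    ({y, z} : Finset (E 3)) ∈ M.subsimplices 2 ∧ ({y, z} : Finset (E 3)) ⊆ t := by
  have h : ({y, z} : Finset (E 3)) ⊆ t := by
    intro x hx; simp only [Finset.mem_insert, Finset.mem_singleton] at hx
    rcases hx with rfl | rfl <;> assumption
  exact ⟨M.mem_subsimplices.2 ⟨t, ht, h, Finset.card_pair hyz⟩, h⟩

/-- At a vertex, `p` is orthogonal to all edges of the element that leave it, and these span the
space. So the affine map `p` vanishes at all vertices. -/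
theorem neLocal_unisolvent {p : E 3 → E 3} (hp : p ∈ neLocal 3) {t : Finset (E 3)}
    (ht : t ∈ M.cells) (h : ∀ e ∈ M.subsimplices 2, e ⊆ t → M.dofN0 o e p = 0) : p = 0 := by
  classical
  have ht' := M.isFullSimplex t ht
  have h0 : ∀ y ∈ t, p y = 0 := by
    intro y hy
    refine eq_zero_of_inner_vertices ht' (y := y) fun z hz => ?_
    by_cases hyz : y = z
    · simp [hyz]
    obtain ⟨he, het⟩ := M.pair_mem_subsimplices ht hy hz hyz
    exact (M.dofN0_eq_zero_iff o he hp).1 (h _ he het) y (by simp) z (by simp)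
  obtain ⟨A, rfl⟩ := neLocal_three_affine hp
  have : A = 0 := ht'.affine_ext fun y hy => by rw [h0 y hy]; rfl
  rw [this]; rfl

/-- The tangential trace of a Nédélec function on a face is determined by the degrees of freedom on
the edges of the face. -/
theorem tangentialPart_face {p : E 3 → E 3} (hp : p ∈ neLocal 3) {f t : Finset (E 3)}
    (ht : t ∈ M.cells) (hft : f ⊆ t) (hf : f.card = 3)
    (h : ∀ e ∈ M.subsimplices 2, e ⊆ f → M.dofN0 o e p = 0) {n : E 3} (hn : IsUnitNormal f n)
    {x : E 3} (hx : x ∈ openHull f) : tangentialPart n (p x) = 0 := by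
  classical
  have ht' := M.isFullSimplex t ht
  have hne : f.Nonempty := by rw [← Finset.card_pos, hf]; norm_num
  obtain ⟨c, hc0, hc⟩ := exists_inner_normal ht' hft hf hne hn
  set lam := bary t (oppositeVertex f t) with hlam
  have hv : ∀ y ∈ f, cross (p y) n = 0 := by
    intro y hy
    set w := p y with hw
    have h1 : ∀ z ∈ f, inner ℝ w (z - y) = 0 := by
      intro z hz
      by_cases hyz : y = z
      · simp [hyz]
      obtain ⟨he, -⟩ := M.pair_mem_subsimplices ht (hft hy) (hft hz) hyz
      exact (M.dofN0_eq_zero_iff o he hp).1 (h _ he (by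
        intro x hx; simp only [Finset.mem_insert, Finset.mem_singleton] at hx
        rcases hx with rfl | rfl <;> assumption)) y (by simp) z (by simp)
    -- Being orthogonal to the edges of the face at `y`, the value `w` is a multiple of `n`; the
    -- factor is found by testing with the vertex opposite to the face.
    have h2 : w - (inner ℝ w (oppositeVertex f t - y) * c⁻¹) • n = 0 := by
      refine eq_zero_of_inner_vertices ht' (y := y) fun z hz => ?_
      have hlin : inner ℝ n (z - y) = c * lam z := by
        rw [real_inner_comm, hc, linear_sub, hlam, bary_opposite_of_mem ht' hft hf hy, sub_zero]
      rw [inner_sub_left, inner_smul_left, hlin]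
      by_cases hzf : z ∈ f
      · rw [h1 z hzf, hlam, bary_opposite_of_mem ht' hft hf hzf]; simp
      · rw [eq_oppositeVertex ht' hft hf hz hzf, hlam, bary_opposite_self ht' hft hf]
        simp [hc0]
    rw [sub_eq_zero.1 h2, cross_smul_self]
  obtain ⟨A, rfl⟩ := neLocal_three_affine hp
  have h3 : ((crossLinear n).toAffineMap.comp A) x = 0 :=
    affine_eq_zero_on_face ((crossLinear n).toAffineMap.comp A) hv hx
  rw [tangentialPart_three]
  have h4 : cross (A x) n = 0 := h3
  rw [h4]; rfl

/-- Conversely, the degrees of freedom on the edges of a face are determined by the tangential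
trace. -/
theorem dofN0_eq_zero_of_face {p : E 3 → E 3} (hp : p ∈ neLocal 3) {f e : Finset (E 3)}
    (he : e ∈ M.subsimplices 2) (hef : e ⊆ f) {n : E 3} (hn : IsUnitNormal f n)
    (h : ∀ x ∈ openHull f, tangentialPart n (p x) = 0) : M.dofN0 o e p = 0 := by
  rw [M.dofN0_eq_zero_iff o he hp]
  intro y hy z hz
  have h1 : cross (p y) n = 0 := by
    obtain ⟨A, rfl⟩ := neLocal_three_affine hp
    refine face_affine_eq_zero (f := f) ⟨y, hef hy⟩ ((crossLinear n).toAffineMap.comp A)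
      (fun x hx => ?_) (hef hy)
    have := h x hx
    rw [tangentialPart_three] at this
    exact PiLp.ext (congrFun this)
  -- By Lagrange's identity, since `z - y` is orthogonal to the unit vector `n`, a vanishing cross
  -- product of `p y` with `n` forces `p y` to be orthogonal to `z - y`.
  have h2 := inner_cross_cross (p y) (z - y) n
  rw [h1, inner_zero_left, hn.2 z (hef hz) y (hef hy), real_inner_self_eq_norm_sq, hn.1] at h2
  linarith

/-- The unnormalized shape function of the edge opposite to `g`. -/
def edgeFunction (g : Finset (E 3)) (x : E 3) : E 3 := cross (x - edgeMidpoint g) (o.tangent g)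

theorem edgeFunction_mem (g : Finset (E 3)) : M.edgeFunction o g ∈ neLocal 3 := by
  refine ⟨-cross (edgeMidpoint g) (o.tangent g), o.tangent g, fun x => ?_⟩
  rw [edgeFunction, ← crossLinear_apply, map_sub, crossLinear_apply, crossLinear_apply]
  abel

open Classical in
theorem sdiff_mem_subsimplices {e t : Finset (E 3)} (he : e ∈ M.subsimplices 2) (ht : t ∈ M.cells)
    (het : e ⊆ t) : t \ e ∈ M.subsimplices 2 := by
  refine M.mem_subsimplices.2 ⟨t, ht, Finset.sdiff_subset, ?_⟩
  rw [Finset.card_sdiff_of_subset het, (M.isFullSimplex t ht).1, M.card_of_mem he]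

-- An edge `g ≠ e` of `t` has a vertex on the edge opposite to `e`; there the function is the cross
-- product of two parallel vectors.
open Classical in
theorem dofN0_edgeFunction {e g t : Finset (E 3)} (he : e ∈ M.subsimplices 2)
    (hg : g ∈ M.subsimplices 2) (heg : e ≠ g) (ht : t ∈ M.cells) (het : e ⊆ t) (hgt : g ⊆ t) :
    M.dofN0 o g (M.edgeFunction o (t \ e)) = 0 := by
  obtain ⟨y, hyg, hye⟩ : ∃ y ∈ g, y ∉ e := by
    by_contra! h
    exact heg (Finset.eq_of_subset_of_card_le h
      (by rw [M.card_of_mem he, M.card_of_mem hg])).symm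
  have hy : y ∈ t \ e := Finset.mem_sdiff.2 ⟨hgt hyg, hye⟩
  obtain ⟨r, hr⟩ := M.exists_midpoint_sub o (M.sdiff_mem_subsimplices he ht het) hy
  rw [M.dofN0_eq o hg (M.edgeFunction_mem o _) hyg, edgeFunction,
    show y - edgeMidpoint (t \ e) = (-r) • o.tangent (t \ e) by rw [neg_smul, ← hr]; abel,
    cross_smul_self, inner_zero_left]

-- The denominator of the shape function is not zero: all other degrees of freedom vanish, so
-- otherwise unisolvence would make the cross product with a nonzero vector vanish identically.
open Classical in
theorem dofN0_edgeFunction_self {e t : Finset (E 3)} (he : e ∈ M.subsimplices 2)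
    (ht : t ∈ M.cells) (het : e ⊆ t) : M.dofN0 o e (M.edgeFunction o (t \ e)) ≠ 0 := by
  intro h0
  have hg := M.sdiff_mem_subsimplices he ht het
  have h1 := M.neLocal_unisolvent o (M.edgeFunction_mem o (t \ e)) ht fun g hg hgt => by
    by_cases heg : e = g
    · rw [← heg, h0]
    · exact M.dofN0_edgeFunction o he hg heg ht het hgt
  have h2 : ∀ x, cross x (o.tangent (t \ e)) = 0 := fun x => by
    have := congrFun h1 (x + edgeMidpoint (t \ e))
    rwa [edgeFunction, add_sub_cancel_right] at this
  apply M.tangent_ne_zero o hg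
  have e0 := h2 (EuclideanSpace.single 0 1)
  have e1 := h2 (EuclideanSpace.single 1 1)
  have a1 := congrArg (fun x : E 3 => x 2) e0
  have a2 := congrArg (fun x : E 3 => x 1) e0
  have a3 := congrArg (fun x : E 3 => x 2) e1
  simp only [cross_one, cross_two] at a1 a2 a3
  refine E_three_ext ?_ ?_ ?_
  · simpa using a3
  · simpa using a1
  · simpa using a2

open Classical in
/-- The Nédélec shape function of `e` on the element `t`. -/
def locN0 (e t : Finset (E 3)) (x : E 3) : E 3 :=
  (inner ℝ (o.tangent e)
    (cross (edgeMidpoint e - edgeMidpoint (t \ e)) (o.tangent (t \ e))))⁻¹ •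
    cross (x - edgeMidpoint (t \ e)) (o.tangent (t \ e))

open Classical in
theorem locN0_eq (e t : Finset (E 3)) : M.locN0 o e t =
    (M.dofN0 o e (M.edgeFunction o (t \ e)))⁻¹ • M.edgeFunction o (t \ e) := by
  funext x
  rw [dofN0_apply, real_inner_comm]
  rfl

open Classical in
/-- The finite element description of the Nédélec space in space. -/
def dataN0Three (hΩ : IsPolytopalDomain Ω) (hc : LocallyConnectedUpToBoundary Ω) :
    M.FEData 3 M.N0 (M.subsimplices 2) (M.shapeN0 o) where
  P := neLocal 3
  affine := fun p hp => neLocal_three_affine hp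
  loc := M.locN0 o
  dof := M.dofN0 o
  star_nonempty := fun i hi => M.star_nonempty_of_mem hi
  loc_mem := fun e _ t _ => by
    rw [locN0_eq]
    exact Submodule.smul_mem _ _ (M.edgeFunction_mem o _)
  shape_eq := fun e _ t ht x hx => by
    exact M.sum_indicator_eq (M.star e) (M.star_subset e) (M.locN0 o e) ht hx
  shape_eq_zero := fun e _ t ht het x hx => by
    exact M.sum_indicator_eq_zero (M.star e) (M.star_subset e) (M.locN0 o e) ht
      (fun h => het (M.mem_star.1 h).2) hx
  dof_self := fun e he => by
    refine ⟨1, one_ne_zero, fun t ht => ?_⟩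
    rw [mem_star] at ht
    rw [locN0_eq, map_smul, smul_eq_mul,
      inv_mul_cancel₀ (M.dofN0_edgeFunction_self o he ht.1 ht.2)]
  dof_other := fun e he g hg heg t ht het hgt => by
    rw [locN0_eq, map_smul, M.dofN0_edgeFunction o he hg heg ht het hgt, smul_zero]
  unisolvent := fun p hp t ht h => M.neLocal_unisolvent o hp ht h
  mem_iff := by
    intro v
    rw [N0, M.mem_jumpSpace_iff hΩ three_pos _ (fun p hp => by
      obtain ⟨A, rfl⟩ := neLocal_three_affine hp
      exact continuous_affineMap A)]
    refine exists_congr fun p => and_congr_right fun hpP => and_congr_right fun _ => ?_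
    constructor
    · intro h e he s hs t ht
      have hne : e.Nonempty := by rw [← Finset.card_pos, M.card_of_mem he]; norm_num
      -- The jump condition transfers the degree of freedom at `e` only between elements with a
      -- common face; agreement with `s` is propagated through the star of `e`.
      refine M.face_connected_star hΩ hc hne (fun r => M.dofN0 o e (p s) = M.dofN0 o e (p r))
        (fun a ha b hb hab hcard hQ => ?_) hs ht rfl
      have ha' := M.mem_star.1 ha
      have hb' := M.mem_star.1 hb
      have hf : a ∩ b ∈ M.subsimplices 3 :=
        M.mem_subsimplices.2 ⟨a, ha'.1, Finset.inter_subset_left, hcard⟩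
      have hfne : (a ∩ b).Nonempty := by rw [← Finset.card_pos, hcard]; norm_num
      obtain ⟨n, hn⟩ := exists_unitNormal (M.isFullSimplex a ha'.1)
        (Finset.inter_subset_left (s₁ := a) (s₂ := b)) hcard hfne
      have h1 := M.dofN0_eq_zero_of_face o (p := p a - p b)
        ((neLocal 3).sub_mem (hpP a ha'.1) (hpP b hb'.1)) he
        (Finset.subset_inter ha'.2 hb'.2) hn fun x hx => h _ hf a
          (M.mem_star.2 ⟨ha'.1, Finset.inter_subset_left⟩) b
          (M.mem_star.2 ⟨hb'.1, Finset.inter_subset_right⟩) hab n hn x hx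
      rw [map_sub, sub_eq_zero] at h1
      exact hQ.trans h1
    · intro h f hf s hs t ht hst n hn x₀ hx₀
      have hs' := M.mem_star.1 hs
      have ht' := M.mem_star.1 ht
      refine M.tangentialPart_face o (p := p s - p t)
        ((neLocal 3).sub_mem (hpP s hs'.1) (hpP t ht'.1)) hs'.1 hs'.2 (M.card_of_mem hf)
        (fun e he hef => ?_) hn hx₀
      rw [map_sub, sub_eq_zero]
      exact h e he s (M.mem_star.2 ⟨hs'.1, hef.trans hs'.2⟩) t
        (M.mem_star.2 ⟨ht'.1, hef.trans ht'.2⟩)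

end SimplicialMesh

/-! ### Calculus of affine functions -/

theorem affine_eq_clm (ℓ : E d →ᵃ[ℝ] ℝ) :
    (ℓ : E d → ℝ) = fun x => LinearMap.toContinuousLinearMap ℓ.linear x + ℓ 0 := by
  funext x
  conv_lhs => rw [AffineMap.decomp ℓ]
  rfl

theorem affine_hasFDerivAt (ℓ : E d →ᵃ[ℝ] ℝ) (x : E d) :
    HasFDerivAt ℓ (LinearMap.toContinuousLinearMap ℓ.linear) x := by
  rw [affine_eq_clm ℓ]
  exact (ContinuousLinearMap.hasFDerivAt _).add_const _

theorem affine_contDiff (ℓ : E d →ᵃ[ℝ] ℝ) : ContDiff ℝ ∞ ℓ := by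
  rw [affine_eq_clm ℓ]
  exact (ContinuousLinearMap.contDiff _).add contDiff_const

theorem hasFDerivAt_affine_mul (ℓ : E d →ᵃ[ℝ] ℝ) {φ : E d → ℝ} (hφ : ContDiff ℝ ∞ φ) (x : E d) :
    HasFDerivAt (fun x => ℓ x * φ x)
      (ℓ x • fderiv ℝ φ x + φ x • LinearMap.toContinuousLinearMap ℓ.linear) x :=
  (affine_hasFDerivAt ℓ x).mul ((hφ.differentiable (by simp)) x).hasFDerivAt

/-- Integration by parts against an affine function. -/
theorem integral_affine_mul_fderiv (ℓ : E d →ᵃ[ℝ] ℝ) {φ : E d → ℝ} (hφ : ContDiff ℝ ∞ φ)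
    (hc : HasCompactSupport φ) (e : E d) :
    ∫ x, (ℓ x * fderiv ℝ φ x e + ℓ.linear e * φ x) = 0 := by
  have hfd : ∀ x, fderiv ℝ ℓ x e = ℓ.linear e := fun x => by
    rw [(affine_hasFDerivAt ℓ x).fderiv]; rfl
  have hcont : Continuous fun x => fderiv ℝ φ x e :=
    (hφ.continuous_fderiv (by simp)).clm_apply continuous_const
  have h1 : Integrable (fun x => ℓ x * fderiv ℝ φ x e) :=
    ((continuous_affineMap ℓ).mul hcont).integrable_of_hasCompactSupport
      (hc.fderiv_apply ℝ e).mul_left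
  have h2 : Integrable (fun x => ℓ x * φ x) :=
    ((continuous_affineMap ℓ).mul hφ.continuous).integrable_of_hasCompactSupport hc.mul_left
  have h3 : Integrable (fun x => ℓ.linear e * φ x) :=
    (continuous_const.mul hφ.continuous).integrable_of_hasCompactSupport hc.mul_left
  have h4 := integral_mul_fderiv_eq_neg_fderiv_mul_of_integrable (μ := volume) (f := ℓ) (g := φ)
    (v := e) (by simpa only [hfd] using h3) h1 h2
    (fun x _ => (affine_hasFDerivAt ℓ x).differentiableAt)
    (fun x _ => (hφ.differentiable (by simp)) x)
  simp only [hfd] at h4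
  rw [integral_add h1 h3, h4]
  simp

/-! ### Continuous piecewise affine functions are weakly differentiable -/

/-- A function which agrees on the sets of a finite closed cover with Lipschitz functions is
Lipschitz. -/
theorem lipschitzWith_of_finite_cover {ι : Type*} [Finite ι] {C : ι → Set (E d)}
    (hC : ∀ i, IsClosed (C i)) (hcov : ⋃ i, C i = Set.univ) {K : NNReal} {g : ι → E d → ℝ}
    (hg : ∀ i, LipschitzWith K (g i)) {h : E d → ℝ} (hh : ∀ i, Set.EqOn h (g i) (C i)) :
    LipschitzWith K h := by
  have hcont : Continuous h := (locallyFinite_of_finite C).continuous hcov hC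
    fun i => (hg i).continuous.continuousOn.congr (hh i)
  refine LipschitzWith.of_dist_le_mul fun x y => ?_
  let γ : ℝ → E d := fun s => AffineMap.lineMap x y s
  have hγ : Continuous γ := AffineMap.lineMap_continuous
  have hdist : ∀ s r : ℝ, s ≤ r → dist (γ s) (γ r) = (r - s) * dist x y := fun s r hsr => by
    rw [dist_lineMap_lineMap, Real.dist_eq, abs_sub_comm, abs_of_nonneg (sub_nonneg.2 hsr)]
  let S : Set ℝ := {s | dist (h x) (h (γ s)) ≤ K * s * dist x y}
  have hS : IsClosed S := isClosed_le (continuous_const.dist (hcont.comp hγ)) (by fun_prop)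
  have hsub : Set.Icc (0 : ℝ) 1 ⊆ S := by
    refine IsClosed.Icc_subset_of_forall_exists_gt (hS.inter isClosed_Icc) (by simp [S, γ]) ?_
    rintro s ⟨hs, -⟩ r hr
    -- Arbitrarily close to the right of `s`, the segment meets one and the same of the finitely
    -- many sets. This set is closed, so it contains `γ s` too, and the Lipschitz bound on it
    -- extends the estimate beyond `s`.
    obtain ⟨i, hi⟩ : ∃ i, ∃ᶠ q in 𝓝[>] s, γ q ∈ C i := by
      by_contra! hne
      have h1 : ∀ᶠ q in 𝓝[>] s, ∀ i, γ q ∉ C i :=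
        Filter.eventually_all.2 hne
      obtain ⟨q, hq⟩ := h1.exists
      have : γ q ∈ ⋃ i, C i := by rw [hcov]; trivial
      obtain ⟨i, hi⟩ := Set.mem_iUnion.1 this
      exact hq i hi
    have hsi : γ s ∈ C i := (hC i).mem_of_frequently_of_tendsto hi
      ((hγ.tendsto s).mono_left nhdsWithin_le_nhds)
    obtain ⟨q, hqi, hq⟩ := (hi.and_eventually (Ioc_mem_nhdsGT hr)).exists
    refine ⟨q, ?_, hq⟩
    have h2 : dist (h (γ s)) (h (γ q)) ≤ K * ((q - s) * dist x y) := by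
      rw [hh i hsi, hh i hqi, ← hdist s q hq.1.le]
      exact (hg i).dist_le_mul _ _
    have h3 : dist (h x) (h (γ s)) ≤ K * s * dist x y := hs
    have h4 := dist_triangle (h x) (h (γ s)) (h (γ q))
    change dist (h x) (h (γ q)) ≤ K * q * dist x y
    linarith
  have h1 : dist (h x) (h (γ 1)) ≤ K * 1 * dist x y := hsub (Set.right_mem_Icc.2 zero_le_one)
  simpa [γ] using h1

/-- Integration by parts for Lipschitz functions, with the constant `1` as the other factor. -/
theorem integral_lineDeriv_eq_zero {h : E d → ℝ} {K : NNReal} (hh : LipschitzWith K h)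
    (hc : HasCompactSupport h) (e : E d) : ∫ x, lineDeriv ℝ h x e = 0 := by
  have h1 := LipschitzWith.integral_lineDeriv_mul_eq (μ := volume)
    (LipschitzWith.const (1 : ℝ) : LipschitzWith 0 fun _ : E d => (1 : ℝ)) hh hc (-e)
  simp only [neg_neg, mul_one] at h1
  rw [← h1]
  simp [lineDeriv]

namespace SimplicialMesh

variable {Ω : Set (E d)} (M : SimplicialMesh Ω)

open Classical in
/-- The continuous function on `closure Ω` with affine pieces `ℓ t`. -/
def glue (ℓ : Finset (E d) → E d →ᵃ[ℝ] ℝ) (x : E d) : ℝ :=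
  if h : ∃ t ∈ M.cells, x ∈ convexHull ℝ (t : Set (E d)) then ℓ h.choose x else 0

/-- Two elements meet only in the hull of their common vertices, and there the affine pieces agree
because they agree at these vertices. -/
theorem glue_eq {ℓ : Finset (E d) → E d →ᵃ[ℝ] ℝ}
    (hℓ : ∀ s ∈ M.cells, ∀ t ∈ M.cells, ∀ y ∈ s, y ∈ t → ℓ s y = ℓ t y) {t : Finset (E d)}
    (ht : t ∈ M.cells) {x : E d} (hx : x ∈ convexHull ℝ (t : Set (E d))) :
    M.glue ℓ x = ℓ t x := by
  classical
  have h : ∃ t ∈ M.cells, x ∈ convexHull ℝ (t : Set (E d)) := ⟨t, ht, hx⟩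
  rw [glue, dif_pos h]
  obtain ⟨hs, hxs⟩ := h.choose_spec
  set s := h.choose
  by_cases hst : s = t
  · rw [hst]
  have h1 := M.regular s hs t ht hst ⟨hxs, hx⟩
  obtain ⟨w, -, hw, hwx⟩ := Finset.mem_convexHull'.1 h1
  rw [← hwx, affineMap_sum _ _ _ hw, affineMap_sum _ _ _ hw]
  refine Finset.sum_congr rfl fun y hy => ?_
  rw [Finset.mem_inter] at hy
  rw [hℓ s hs t ht y hy.1 hy.2]

/-- The glued function itself may jump at the boundary of the domain. After multiplication by a test
function, the closed elements and the zero set of `φ` form a finite closed cover with Lipschitz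
pieces. -/
theorem glue_mul_lipschitz {ℓ : Finset (E d) → E d →ᵃ[ℝ] ℝ}
    (hℓ : ∀ s ∈ M.cells, ∀ t ∈ M.cells, ∀ y ∈ s, y ∈ t → ℓ s y = ℓ t y) {φ : E d → ℝ}
    (hφ : ContDiff ℝ ∞ φ) (hc : HasCompactSupport φ) (hsupp : tsupport φ ⊆ Ω) :
    ∃ K, LipschitzWith K fun x => M.glue ℓ x * φ x := by
  have hex : ∀ t : M.cells, ∃ K, LipschitzWith K fun x => ℓ t x * φ x := fun t =>
    ContDiff.lipschitzWith_of_hasCompactSupport (HasCompactSupport.mul_left hc)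
      ((affine_contDiff (ℓ t)).mul hφ) (by simp)
  choose K hK using hex
  let C : Option M.cells → Set (E d) := fun i => i.elim {x | φ x = 0}
    fun t => convexHull ℝ ((t : Finset (E d)) : Set (E d))
  let g : Option M.cells → E d → ℝ := fun i => i.elim (fun _ => 0) fun t x => ℓ t x * φ x
  refine ⟨Finset.univ.sup K, lipschitzWith_of_finite_cover (C := C) (g := g) ?_ ?_ ?_ ?_⟩
  · rintro (_ | t)
    · exact isClosed_eq hφ.continuous continuous_const
    · exact isClosed_convexHull _
  · rw [Set.eq_univ_iff_forall]
    intro x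
    rw [Set.mem_iUnion]
    by_cases hx : φ x = 0
    · exact ⟨none, hx⟩
    · have hxΩ : x ∈ Ω := hsupp (subset_tsupport φ hx)
      obtain ⟨t, ht, hxt⟩ := M.exists_cell_of_mem (subset_closure hxΩ)
      exact ⟨some ⟨t, ht⟩, hxt⟩
  · rintro (_ | t)
    · exact LipschitzWith.const' _
    · exact (hK t).weaken (Finset.le_sup (Finset.mem_univ t))
  · rintro (_ | t) x hx
    · have : φ x = 0 := hx
      simp [g, this]
    · simp only [g, Option.elim]
      rw [M.glue_eq hℓ t.2 hx]

/-- The piecewise constant function with values `(ℓ t).linear e`. -/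
def pieceDeriv (ℓ : Finset (E d) → E d →ᵃ[ℝ] ℝ) (e x : E d) : ℝ :=
  ∑ t ∈ M.cells, (openHull t).indicator (fun _ => (ℓ t).linear e) x

theorem memLp_pieceDeriv (ℓ : Finset (E d) → E d →ᵃ[ℝ] ℝ) (e : E d) :
    MemLp (M.pieceDeriv ℓ e) 2 (volume.restrict Ω) := by
  have : IsFiniteMeasure ((volume : Measure (E d)).restrict Ω) :=
    ⟨by simpa using M.volume_lt_top⟩
  exact memLp_finsetSum _ fun t ht =>
    (memLp_const _).indicator (M.isFullSimplex t ht).isOpen_openHull.measurableSet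

/-- The piecewise gradient is the weak gradient: the product of the glued function with a test
function is Lipschitz with compact support, so its derivative has integral zero, and inside the
elements the product rule holds. -/
theorem inH1_of_piecewise (hΩ : IsPolytopalDomain Ω) {ℓ : Finset (E d) → E d →ᵃ[ℝ] ℝ}
    (hℓ : ∀ s ∈ M.cells, ∀ t ∈ M.cells, ∀ y ∈ s, y ∈ t → ℓ s y = ℓ t y) {v : E d → ℝ}
    (hv : MemLp v 2 (volume.restrict Ω))
    (h : ∀ t ∈ M.cells, ∀ᵐ x ∂(volume.restrict Ω), x ∈ openHull t → v x = ℓ t x) :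
    InH1 Ω v := by
  refine ⟨hv, fun j => ⟨M.pieceDeriv ℓ (EuclideanSpace.single j 1), M.memLp_pieceDeriv ℓ _,
    fun φ hφ hc hsupp => ?_⟩⟩
  set e : E d := EuclideanSpace.single j 1
  obtain ⟨K, hK⟩ := M.glue_mul_lipschitz hℓ hφ hc hsupp
  have h0 := integral_lineDeriv_eq_zero hK (HasCompactSupport.mul_left hc) e
  rw [← setIntegral_eq_integral_of_forall_compl_eq_zero (s := Ω)] at h0
  · have h1 : ∀ᵐ x ∂(volume.restrict Ω), lineDeriv ℝ (fun x => M.glue ℓ x * φ x) x e =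
        v x * fderiv ℝ φ x e + M.pieceDeriv ℓ e x * φ x := by
      have h' : ∀ᵐ x ∂(volume.restrict Ω), ∀ t ∈ M.cells, x ∈ openHull t → v x = ℓ t x :=
        (ae_ball_iff M.cells.countable_toSet).2 h
      filter_upwards [M.ae_mem_openHull hΩ, h'] with x ⟨t, ht, hxt⟩ hx
      have h2 : (fun x => M.glue ℓ x * φ x) =ᶠ[𝓝 x] fun x => ℓ t x * φ x := by
        filter_upwards [(M.isFullSimplex t ht).isOpen_openHull.mem_nhds hxt] with y hy
        rw [M.glue_eq hℓ ht (openHull_subset_convexHull t hy)]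
      rw [h2.lineDeriv_eq, ((hasFDerivAt_affine_mul (ℓ t) hφ x).hasLineDerivAt e).lineDeriv, hx t ht hxt,
        pieceDeriv, M.sum_indicator_eq M.cells subset_rfl (fun t _ => (ℓ t).linear e) ht hxt]
      simp
      ring
    rw [integral_congr_ae h1, integral_add (integrable_mul_fderiv j hv hφ hc)
      (integrable_mul_testFunction (M.memLp_pieceDeriv ℓ e) hφ.continuous hc)] at h0
    linarith
  · intro x hx
    have hx' : x ∉ tsupport φ := fun h => hx (hsupp h)
    have h2 : (fun x => M.glue ℓ x * φ x) =ᶠ[𝓝 x] fun _ => 0 := by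
      filter_upwards [(isClosed_tsupport φ).isOpen_compl.mem_nhds hx'] with y hy
      rw [image_eq_zero_of_notMem_tsupport hy, mul_zero]
    rw [h2.lineDeriv_eq]
    simp [lineDeriv]

end SimplicialMesh

/-! ### Weakly differentiable piecewise affine functions have no jumps -/

theorem InH1.exists_directional {Ω : Set (E d)} {v : E d → ℝ} (hv : InH1 Ω v) (e : E d) :
    ∃ g : E d → ℝ, MemLp g 2 (volume.restrict Ω) ∧ ∀ φ : E d → ℝ, ContDiff ℝ ∞ φ →
      HasCompactSupport φ → tsupport φ ⊆ Ω →
      ∫ x in Ω, (v x * fderiv ℝ φ x e + g x * φ x) = 0 := by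
  choose g hg hvg using hv.2
  have hgm : MemLp (fun x => ∑ j, e j * g j x) 2 (volume.restrict Ω) :=
    memLp_finsetSum _ fun j _ => (hg j).const_mul (e j)
  refine ⟨fun x => ∑ j, e j * g j x, hgm, fun φ hφ hc hsupp => ?_⟩
  have he : e = ∑ j, e j • EuclideanSpace.single j (1 : ℝ) := by
    have := (EuclideanSpace.basisFun (Fin d) ℝ).sum_repr e
    simpa using this.symm
  have h1 : ∀ x, v x * fderiv ℝ φ x e + (∑ j, e j * g j x) * φ x =
      ∑ j, e j * (v x * fderiv ℝ φ x (EuclideanSpace.single j 1) + g j x * φ x) := fun x => by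
    conv_lhs => rw [he]
    rw [map_sum, Finset.mul_sum, Finset.sum_mul, ← Finset.sum_add_distrib]
    refine Finset.sum_congr rfl fun j _ => ?_
    rw [map_smul, smul_eq_mul, ← he]
    ring
  have hintg : ∀ j, Integrable (fun x => v x * fderiv ℝ φ x (EuclideanSpace.single j 1) +
      g j x * φ x) (volume.restrict Ω) := fun j =>
    (integrable_mul_fderiv j hv.1 hφ hc).add (integrable_mul_testFunction (hg j) hφ.continuous hc)
  simp only [h1]
  rw [integral_finsetSum _ fun j _ => (hintg j).const_mul (e j)]
  refine Finset.sum_eq_zero fun j _ => ?_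
  rw [integral_const_mul, integral_add (integrable_mul_fderiv j hv.1 hφ hc)
    (integrable_mul_testFunction (hg j) hφ.continuous hc), hvg j φ hφ hc hsupp]
  simp

/-- Differentiation of the integral over a set of the translates of a test function. -/
theorem hasDerivAt_integral_translate {ψ : E d → ℝ} (hψ : ContDiff ℝ ∞ ψ)
    (hc : HasCompactSupport ψ) {A : Set (E d)} (e : E d) (r₀ : ℝ) :
    HasDerivAt (fun r : ℝ => ∫ x in A, ψ (x + r • e))
      (∫ x in A, fderiv ℝ ψ (x + r₀ • e) e) r₀ := by
  have hfd : Continuous (fderiv ℝ ψ) := hψ.continuous_fderiv (by simp)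
  obtain ⟨C, hC⟩ := (hc.fderiv (𝕜 := ℝ)).exists_bound_of_continuous hfd
  obtain ⟨ρ, hρ⟩ := hc.isCompact.isBounded.subset_closedBall (0 : E d)
  have htr : ∀ r : ℝ, Continuous fun x : E d => x + r • e := fun r => by fun_prop
  have hintg : Integrable (fun x => ψ (x + r₀ • e)) :=
    (hψ.continuous.comp (htr r₀)).integrable_of_hasCompactSupport
      (hc.comp_homeomorph (Homeomorph.addRight (r₀ • e)))
  refine (hasDerivAt_integral_of_dominated_loc_of_deriv_le
    (bound := (Metric.closedBall (0 : E d) (ρ + (|r₀| + 1) * ‖e‖)).indicator fun _ => C * ‖e‖)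
    (F := fun r x => ψ (x + r • e)) (F' := fun r x => fderiv ℝ ψ (x + r • e) e)
    (Metric.ball_mem_nhds r₀ one_pos) ?_ hintg.restrict ?_ ?_ ?_ ?_).2
  · exact Filter.Eventually.of_forall fun r =>
      (hψ.continuous.comp (htr r)).aestronglyMeasurable
  · exact ((hfd.comp (htr r₀)).clm_apply continuous_const).aestronglyMeasurable
  · refine Filter.Eventually.of_forall fun x r hr => ?_
    by_cases hx : x ∈ Metric.closedBall (0 : E d) (ρ + (|r₀| + 1) * ‖e‖)
    · rw [Set.indicator_of_mem hx]
      exact (ContinuousLinearMap.le_opNorm _ _).trans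
        (mul_le_mul_of_nonneg_right (hC _) (norm_nonneg _))
    · rw [Set.indicator_of_notMem hx, fderiv_of_notMem_tsupport]
      · simp
      · intro hmem
        apply hx
        have h1 := hρ hmem
        rw [mem_closedBall_zero_iff] at h1 ⊢
        have h2 : |r| ≤ |r₀| + 1 := by
          have h3 : |r - r₀| < 1 := hr
          have := abs_sub_abs_le_abs_sub r r₀
          linarith
        have h4 : ‖x‖ ≤ ‖x + r • e‖ + ‖r • e‖ := by
          have := norm_sub_le (x + r • e) (r • e)
          rwa [add_sub_cancel_right] at this
        rw [norm_smul, Real.norm_eq_abs] at h4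
        have := mul_le_mul_of_nonneg_right h2 (norm_nonneg e)
        linarith
  · exact ((integrableOn_const (s := Metric.closedBall (0 : E d) (ρ + (|r₀| + 1) * ‖e‖))
      (μ := volume) (C := C * ‖e‖) measure_closedBall_lt_top.ne).integrable_indicator
      measurableSet_closedBall).restrict
  · refine Filter.Eventually.of_forall fun x r _ => ?_
    have h1 : HasFDerivAt ψ (fderiv ℝ ψ (x + r • e)) (x + r • e) :=
      ((hψ.differentiable (by simp)) _).hasFDerivAt
    have h2 : HasDerivAt (fun r : ℝ => x + r • e) e r := by
      simpa using ((hasDerivAt_id r).smul_const e).const_add x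
    exact h1.comp_hasDerivAt r h2

/-- A half space has no vanishing transversal derivative near a boundary point. -/
theorem exists_integral_halfSpace_ne (lam : E d →ᵃ[ℝ] ℝ) {e x₀ : E d} (he : lam.linear e = 1)
    (hx₀ : lam x₀ = 0) {ρ : ℝ} (hρ : 0 < ρ) :
    ∃ ψ : E d → ℝ, ContDiff ℝ ∞ ψ ∧ HasCompactSupport ψ ∧ tsupport ψ ⊆ Metric.ball x₀ ρ ∧
      ∫ x in {x | 0 < lam x}, fderiv ℝ ψ x e ≠ 0 := by
  -- Otherwise the integral of a bump over the half space would not change when the bump is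
  -- translated by `r • e` with `0 ≤ r ≤ T`. Then the bump would have integral zero over the slab `0
  -- < lam ≤ T`, which contains an open part of its support.
  by_contra! H
  let β : ContDiffBump x₀ := ⟨ρ / 4, ρ / 2, by linarith, by linarith⟩
  have hβ : ContDiff ℝ ∞ β := β.contDiff
  have hβc : HasCompactSupport β := β.hasCompactSupport
  -- Translations move points by at most `ρ / 4`, so that the supports, of radius `ρ / 2`, stay
  -- inside the ball of radius `ρ`.
  set T : ℝ := ρ / (4 * (‖e‖ + 1)) with hT
  have hT0 : 0 < T := by positivity
  have hTe : T * ‖e‖ ≤ ρ / 4 := by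
    rw [hT, div_mul_eq_mul_div, div_le_div_iff₀ (by positivity) (by norm_num)]
    nlinarith [norm_nonneg e]
  have hlam : ∀ (x : E d) (r : ℝ), lam (x + r • e) = lam x + r := fun x r => by
    have := linear_sub lam (x + r • e) x
    rw [add_sub_cancel_left, map_smul, he, smul_eq_mul, mul_one] at this
    linarith
  have hder : ∀ r ∈ Set.Icc (0 : ℝ) T,
      HasDerivAt (fun r : ℝ => ∫ x in {x | 0 < lam x}, β (x + r • e)) 0 r := by
    intro r hr
    have h1 := hasDerivAt_integral_translate hβ hβc (A := {x | 0 < lam x}) e r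
    have h2 := H (fun x => β (x + r • e)) (hβ.comp (contDiff_id.add contDiff_const))
      (hβc.comp_homeomorph (Homeomorph.addRight (r • e))) (by
        intro x hx
        have h3 : x + r • e ∈ tsupport β := by
          have := tsupport_comp_subset_preimage (β : E d → ℝ)
            (show Continuous fun x : E d => x + r • e by fun_prop)
          exact this hx
        rw [β.tsupport_eq, mem_closedBall_iff_norm] at h3
        rw [mem_ball_iff_norm]
        have h4 : ‖x - x₀‖ ≤ ‖x + r • e - x₀‖ + ‖r • e‖ := by
          have := norm_sub_le (x + r • e - x₀) (r • e)
          rwa [show x + r • e - x₀ - r • e = x - x₀ by abel] at this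
        have h5 : ‖r • e‖ ≤ T * ‖e‖ := by
          rw [norm_smul, Real.norm_eq_abs, abs_of_nonneg hr.1]
          exact mul_le_mul_of_nonneg_right hr.2 (norm_nonneg _)
        have h6 : ‖x + r • e - x₀‖ ≤ ρ / 2 := h3
        linarith)
    simp only [fderiv_comp_add_right] at h2
    rwa [h2] at h1
  have hconst := constant_of_has_deriv_right_zero
    (f := fun r : ℝ => ∫ x in {x | 0 < lam x}, β (x + r • e)) (a := 0) (b := T)
    (fun r hr => (hder r hr).continuousAt.continuousWithinAt)
    (fun r hr => (hder r ⟨hr.1, hr.2.le⟩).hasDerivWithinAt) T ⟨hT0.le, le_rfl⟩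
  have hmeas : ∀ r : ℝ, MeasurableSet {x | r < lam x} := fun r =>
    (isOpen_lt continuous_const (continuous_affineMap lam)).measurableSet
  have hβi : Integrable (β : E d → ℝ) := hβ.continuous.integrable_of_hasCompactSupport hβc
  have htrans : ∫ x in {x | 0 < lam x}, β (x + T • e) = ∫ x in {x | T < lam x}, β x := by
    rw [← integral_indicator (hmeas 0), ← integral_indicator (hmeas T),
      ← integral_add_right_eq_self (Set.indicator {x | T < lam x} β) (T • e)]
    refine integral_congr_ae (Filter.Eventually.of_forall fun x => ?_)
    have hx : x + T • e ∈ {x | T < lam x} ↔ x ∈ {x | 0 < lam x} := by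
      change T < lam (x + T • e) ↔ 0 < lam x
      rw [hlam]
      constructor <;> intro h <;> linarith
    by_cases h : x ∈ {x | 0 < lam x}
    · simp only [Set.indicator_of_mem h, Set.indicator_of_mem (hx.2 h)]
    · simp only [Set.indicator_of_notMem h, Set.indicator_of_notMem (mt hx.1 h)]
  simp only [zero_smul, add_zero] at hconst
  rw [htrans] at hconst
  have hsub : {x : E d | T < lam x} ⊆ {x | 0 < lam x} := fun x hx => hT0.trans hx
  have hdiff := setIntegral_sdiff (μ := volume) (hmeas T) hβi.integrableOn hsub
  rw [hconst, sub_self] at hdiff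
  have hmd : MeasurableSet ({x : E d | 0 < lam x} \ {x | T < lam x}) := (hmeas 0).diff (hmeas T)
  rw [← integral_indicator hmd] at hdiff
  have hpos : 0 < ∫ x, ({x : E d | 0 < lam x} \ {x | T < lam x}).indicator β x := by
    rw [integral_pos_iff_support_of_nonneg
      (fun x => Set.indicator_nonneg (fun x _ => β.nonneg) x) (hβi.indicator hmd)]
    have hopen : IsOpen ({x : E d | 0 < lam x} ∩ {x | lam x < T} ∩ Metric.ball x₀ (ρ / 2)) :=
      ((isOpen_lt continuous_const (continuous_affineMap lam)).inter
        (isOpen_lt (continuous_affineMap lam) continuous_const)).inter Metric.isOpen_ball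
    refine (hopen.measure_pos volume ?_).trans_le (measure_mono ?_)
    · refine ⟨x₀ + (T / 2) • e, ⟨?_, ?_⟩, ?_⟩
      · simp only [Set.mem_ofPred_eq, hlam, hx₀]; linarith
      · simp only [Set.mem_ofPred_eq, hlam, hx₀]; linarith
      · rw [mem_ball_iff_norm, add_sub_cancel_left, norm_smul, Real.norm_eq_abs,
          abs_of_pos (by linarith)]
        linarith
    · rintro x ⟨⟨h1, h2⟩, h3⟩
      rw [Function.mem_support, Set.indicator_of_mem
        (show x ∈ {x : E d | 0 < lam x} \ {x | T < lam x} from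
          ⟨h1, not_lt.2 (show lam x < T from h2).le⟩)]
      have : x ∈ Function.support β := by rw [β.support_eq]; exact h3
      exact this
  linarith

namespace SimplicialMesh

variable {Ω : Set (E d)} (M : SimplicialMesh Ω)

/-- A weak directional derivative is the classical one inside the elements. -/
theorem weakDeriv_ae (hΩ : IsPolytopalDomain Ω) {v g : E d → ℝ} {e : E d}
    (hg : MemLp g 2 (volume.restrict Ω))
    (hvg : ∀ φ : E d → ℝ, ContDiff ℝ ∞ φ → HasCompactSupport φ → tsupport φ ⊆ Ω →
      ∫ x in Ω, (v x * fderiv ℝ φ x e + g x * φ x) = 0)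
    {t : Finset (E d)} (ht : t ∈ M.cells) {ℓ : E d →ᵃ[ℝ] ℝ}
    (hℓ : ∀ᵐ x ∂(volume.restrict Ω), x ∈ openHull t → v x = ℓ x) :
    ∀ᵐ x, x ∈ openHull t → g x = ℓ.linear e := by
  have : IsFiniteMeasure ((volume : Measure (E d)).restrict Ω) :=
    ⟨by simpa using M.volume_lt_top⟩
  have htΩ := M.openHull_subset hΩ ht
  have hopen := (M.isFullSimplex t ht).isOpen_openHull
  have hgi : IntegrableOn g Ω := hg.integrable (by norm_num)
  have hloc : LocallyIntegrableOn (fun x => g x - ℓ.linear e) (openHull t) volume :=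
    ((hgi.mono_set htΩ).locallyIntegrableOn).sub
      ((locallyIntegrable_const _).locallyIntegrableOn _)
  have key := hopen.ae_eq_zero_of_integral_contDiff_smul_eq_zero hloc fun φ hφ hc hsupp => by
    have h1 := hvg φ hφ hc (hsupp.trans htΩ)
    have h2 := integral_affine_mul_fderiv ℓ hφ hc e
    have hz : ∀ x, x ∉ openHull t → φ x = 0 ∧ fderiv ℝ φ x = 0 := fun x hx =>
      ⟨image_eq_zero_of_notMem_tsupport fun h => hx (hsupp h),
        fderiv_of_notMem_tsupport ℝ fun h => hx (hsupp h)⟩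
    have h3 : ∫ x in Ω, (v x * fderiv ℝ φ x e + g x * φ x) =
        ∫ x in Ω, (ℓ x * fderiv ℝ φ x e + g x * φ x) := by
      refine integral_congr_ae ?_
      filter_upwards [hℓ] with x hx
      by_cases hxt : x ∈ openHull t
      · rw [hx hxt]
      · simp [(hz x hxt).2]
    have hzΩ : ∀ x ∉ Ω, φ x = 0 ∧ fderiv ℝ φ x = 0 := fun x hx => hz x fun h => hx (htΩ h)
    rw [h3, setIntegral_eq_integral_of_forall_compl_eq_zero fun x hx => by
      simp [(hzΩ x hx).1, (hzΩ x hx).2]] at h1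
    have hcont : Continuous fun x => fderiv ℝ φ x e :=
      (hφ.continuous_fderiv (by simp)).clm_apply continuous_const
    have i1 : Integrable (fun x => ℓ x * fderiv ℝ φ x e) :=
      ((continuous_affineMap ℓ).mul hcont).integrable_of_hasCompactSupport
        (hc.fderiv_apply ℝ e).mul_left
    have i2 : Integrable (fun x => ℓ.linear e * φ x) :=
      (continuous_const.mul hφ.continuous).integrable_of_hasCompactSupport hc.mul_left
    have i3 : Integrable (fun x => g x * φ x) := by
      have := integrable_mul_testFunction hg hφ.continuous hc
      refine (integrableOn_iff_integrable_of_support_subset ?_).1 this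
      intro x hx
      by_contra hxΩ
      exact hx (by simp [(hzΩ x hxΩ).1])
    rw [integral_add i1 i3] at h1
    rw [integral_add i1 i2] at h2
    have h4 : ∀ x, φ x • (g x - ℓ.linear e) = g x * φ x - ℓ.linear e * φ x := fun x => by
      rw [smul_eq_mul]; ring
    simp only [h4]
    rw [integral_sub i3 i2]
    linarith
  filter_upwards [key] with x hx hxt
  exact sub_eq_zero.1 (hx hxt)

/-- Suppose that the difference `w` of the pieces is nonzero at a point of the open face. Near this
point every test function `ψ` has the form `w φ`. After subtraction of the affine function of `t`,
the weak derivative identity for `φ` says that the transversal derivative of `ψ` has integral zero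
over the side of `s`, contradicting `exists_integral_halfSpace_ne`. -/
theorem affine_eq_on_face (hΩ : IsPolytopalDomain Ω) (hd : 0 < d) {v : E d → ℝ} (hv : InH1 Ω v)
    {f s t : Finset (E d)} (hs : s ∈ M.cells) (ht : t ∈ M.cells) (hfs : f ⊆ s) (hft : f ⊆ t)
    (hf : f.card = d) (hst : s ≠ t) {ℓs ℓt : E d →ᵃ[ℝ] ℝ}
    (hℓs : ∀ᵐ x ∂(volume.restrict Ω), x ∈ openHull s → v x = ℓs x)
    (hℓt : ∀ᵐ x ∂(volume.restrict Ω), x ∈ openHull t → v x = ℓt x) {y : E d} (hy : y ∈ f) :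
    ℓs y = ℓt y := by
  set w : E d →ᵃ[ℝ] ℝ := ℓs - ℓt with hw
  have hwx : ∀ x, w x = ℓs x - ℓt x := fun x => rfl
  have hwl : ∀ x, w.linear x = ℓs.linear x - ℓt.linear x := fun x => rfl
  suffices h : ∀ x ∈ openHull f, w x = 0 from
    sub_eq_zero.1 (face_affine_eq_zero ⟨y, hy⟩ w h hy)
  intro x₀ hx₀
  by_contra hne
  have hs' := M.isFullSimplex s hs
  set a := oppositeVertex f s with ha
  set lam := bary s a with hlam
  have hlam0 : lam x₀ = 0 := bary_opposite_of_mem_openHull hs' hfs hf hx₀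
  have he : lam.linear (a - x₀) = 1 := by
    rw [linear_sub, hlam0, hlam, ha, bary_opposite_self hs' hfs hf, sub_zero]
  set e := a - x₀
  obtain ⟨ρ, hρ, hball⟩ := Metric.eventually_nhds_iff_ball.1
    (((M.eventually_two_sides hs ht hfs hft hf hst hd hx₀).and (hΩ.isOpen.mem_nhds
      (M.openHull_face_subset hs ht hfs hft hf hst hΩ hd hx₀))).and
      ((continuous_affineMap w).continuousAt.eventually_ne hne))
  obtain ⟨ψ, hψ, hψc, hψs, hψi⟩ := exists_integral_halfSpace_ne lam he hlam0 hρ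
  apply hψi
  obtain ⟨g, hg, hvg⟩ := hv.exists_directional e
  have hgs := M.weakDeriv_ae hΩ hg hvg hs hℓs
  have hgt := M.weakDeriv_ae hΩ hg hvg ht hℓt
  -- Smooth because `w` has no zero on the support of `ψ`; outside that support `φ` vanishes,
  -- whatever `w` is.
  let φ : E d → ℝ := fun x => ψ x / w x
  have hφ0 : ∀ x, x ∉ tsupport ψ → φ =ᶠ[𝓝 x] fun _ => 0 := fun x hx => by
    filter_upwards [(isClosed_tsupport ψ).isOpen_compl.mem_nhds hx] with z hz
    simp [φ, image_eq_zero_of_notMem_tsupport hz]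
  have hφ : ContDiff ℝ ∞ φ := by
    rw [contDiff_iff_contDiffAt]
    intro x
    by_cases hx : x ∈ tsupport ψ
    · exact hψ.contDiffAt.div (affine_contDiff w).contDiffAt (hball x (hψs hx)).2
    · exact contDiffAt_const.congr_of_eventuallyEq (hφ0 x hx)
  have hφsub : tsupport φ ⊆ tsupport ψ := closure_mono fun x hx => by
    rw [Function.mem_support] at hx ⊢
    exact fun h => hx (by simp [φ, h])
  have hφc : HasCompactSupport φ := 
    IsCompact.of_isClosed_subset hψc (isClosed_tsupport φ) hφsub
  have hψφ : ψ = fun x => w x * φ x := by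
    funext x
    by_cases hx : x ∈ tsupport ψ
    · have := (hball x (hψs hx)).2
      simp only [φ]
      field_simp
    · simp [φ, image_eq_zero_of_notMem_tsupport hx]
  have hfd : ∀ x, fderiv ℝ ψ x e = w x * fderiv ℝ φ x e + w.linear e * φ x := fun x => by
    conv_lhs => rw [hψφ]
    rw [(hasFDerivAt_affine_mul w hφ x).fderiv]
    simp
    ring
  have hz : ∀ x, x ∉ tsupport ψ → φ x = 0 ∧ fderiv ℝ φ x = 0 ∧ fderiv ℝ ψ x = 0 := fun x hx =>
    ⟨(hφ0 x hx).self_of_nhds, fderiv_of_notMem_tsupport ℝ fun h => hx (hφsub h),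
      fderiv_of_notMem_tsupport ℝ hx⟩
  have hψΩ : tsupport ψ ⊆ Ω := fun x hx => (hball x (hψs hx)).1.2
  have h1 := hvg φ hφ hφc (hφsub.trans hψΩ)
  have h2 := integral_affine_mul_fderiv ℓt hφ hφc e
  have hnull : ∀ᵐ x : E d, lam x ≠ 0 := by
    have := volume_affine_zero lam (y := a) (by
      rw [hlam, ha, bary_opposite_self hs' hfs hf]; exact one_ne_zero)
    exact measure_eq_zero_iff_ae_notMem.1 this
  -- On the side of `t` the integrand is that of the affine function `ℓt`. On the side of `s` the
  -- excess is the derivative of `w φ = ψ`, and the `ℓt` part integrates to zero.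
  have h3 : ∀ᵐ x ∂(volume.restrict Ω), v x * fderiv ℝ φ x e + g x * φ x =
      {x | 0 < lam x}.indicator (fun x => fderiv ℝ ψ x e) x +
        (ℓt x * fderiv ℝ φ x e + ℓt.linear e * φ x) := by
    filter_upwards [hℓs, hℓt, ae_restrict_of_ae hgs, ae_restrict_of_ae hgt,
      ae_restrict_of_ae hnull] with x k1 k2 k3 k4 k5
    by_cases hx : x ∈ tsupport ψ
    · have hb := (hball x (hψs hx)).1.1
      rcases lt_or_gt_of_ne k5 with hneg | hpos
      · have hxt := hb.2.1 hneg
        rw [Set.indicator_of_notMem (show x ∉ {x | 0 < lam x} from not_lt.2 hneg.le), k2 hxt,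
          k4 hxt, zero_add]
      · have hxs := hb.1 hpos
        rw [Set.indicator_of_mem (show x ∈ {x | 0 < lam x} from hpos), k1 hxs, k3 hxs, hfd, hwx,
          hwl]
        ring
    · obtain ⟨z1, z2, z3⟩ := hz x hx
      simp [z1, z2, z3, Set.indicator_apply]
  have hmeas : MeasurableSet {x : E d | 0 < lam x} :=
    (isOpen_lt continuous_const (continuous_affineMap lam)).measurableSet
  have hcontψ : Continuous fun x => fderiv ℝ ψ x e :=
    (hψ.continuous_fderiv (by simp)).clm_apply continuous_const
  have hcontφ : Continuous fun x => fderiv ℝ φ x e :=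
    (hφ.continuous_fderiv (by simp)).clm_apply continuous_const
  have i1 : Integrable ({x | 0 < lam x}.indicator fun x => fderiv ℝ ψ x e) :=
    (hcontψ.integrable_of_hasCompactSupport (hψc.fderiv_apply ℝ e)).indicator hmeas
  have i2 : Integrable fun x => ℓt x * fderiv ℝ φ x e + ℓt.linear e * φ x :=
    (((continuous_affineMap ℓt).mul hcontφ).integrable_of_hasCompactSupport
      (hφc.fderiv_apply ℝ e).mul_left).add
      ((continuous_const.mul hφ.continuous).integrable_of_hasCompactSupport hφc.mul_left)
  rw [integral_congr_ae h3, setIntegral_eq_integral_of_forall_compl_eq_zero, integral_add i1 i2, h2,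
    add_zero, integral_indicator hmeas] at h1
  · exact h1
  · intro x hx
    obtain ⟨z1, z2, z3⟩ := hz x fun h => hx (hψΩ h)
    simp [z1, z2, z3, Set.indicator_apply]

end SimplicialMesh

/-! ### Continuous piecewise affine functions -/

/-- The affine maps. -/
def affineLocal (d m : ℕ) : Submodule ℝ (E d → E m) where
  carrier := {p | ∃ A : E d →ᵃ[ℝ] E m, p = A}
  zero_mem' := ⟨0, rfl⟩
  add_mem' := by
    rintro p q ⟨A, rfl⟩ ⟨B, rfl⟩
    exact ⟨A + B, rfl⟩
  smul_mem' := by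
    rintro r p ⟨A, rfl⟩
    exact ⟨r • A, rfl⟩

/-- The isomorphism `ℝ → ℝ¹`. -/
def toOne : ℝ →ₗ[ℝ] E 1 where
  toFun r := !₂[r]
  map_add' r s := E_one_ext (by simp)
  map_smul' r s := E_one_ext (by simp)

theorem toOne_mem_affineLocal (ℓ : E d →ᵃ[ℝ] ℝ) : (fun x => !₂[ℓ x]) ∈ affineLocal d 1 :=
  ⟨toOne.toAffineMap.comp ℓ, rfl⟩

/-- Evaluation at the vertex `p`, where `i = {p}`. -/
def dofS1 (i : Finset (E d)) : (E d → E 1) →ₗ[ℝ] ℝ := evalDof (∑ y ∈ i, y) coordOne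

theorem dofS1_singleton (y : E d) (p : E d → E 1) : dofS1 {y} p = p y 0 := by
  rw [dofS1, Finset.sum_singleton, evalDof_apply, coordOne_apply]

namespace SimplicialMesh

variable {Ω : Set (E d)} (M : SimplicialMesh Ω)

theorem exists_eq_singleton {i : Finset (E d)} (hi : i ∈ M.subsimplices 1) : ∃ y, i = {y} :=
  Finset.card_eq_one.1 (M.card_of_mem hi)

theorem singleton_mem {t : Finset (E d)} (ht : t ∈ M.cells) {y : E d} (hy : y ∈ t) :
    {y} ∈ M.subsimplices 1 :=
  M.mem_subsimplices.2 ⟨t, ht, Finset.singleton_subset_iff.2 hy, Finset.card_singleton y⟩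

open Classical in
/-- Values at vertices of the pieces of a piecewise affine function in `H¹` agree. -/
theorem affine_eq_at_vertex (hΩ : IsPolytopalDomain Ω) (hd : 0 < d)
    (hc : LocallyConnectedUpToBoundary Ω) {v : E d → ℝ} (hv : InH1 Ω v)
    {ℓ : Finset (E d) → E d →ᵃ[ℝ] ℝ}
    (hℓ : ∀ t ∈ M.cells, ∀ᵐ x ∂(volume.restrict Ω), x ∈ openHull t → v x = ℓ t x)
    {y : E d} {s t : Finset (E d)} (hs : s ∈ M.star {y}) (ht : t ∈ M.star {y}) :
    ℓ s y = ℓ t y := by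
  refine M.face_connected_star hΩ hc (Finset.singleton_nonempty y) (fun r => ℓ s y = ℓ r y)
    (fun a ha b hb hab hcard h => h.trans ?_) hs ht rfl
  rw [mem_star, Finset.singleton_subset_iff] at ha hb
  exact M.affine_eq_on_face hΩ hd hv ha.1 hb.1 Finset.inter_subset_left Finset.inter_subset_right
    (by convert hcard) hab (hℓ a ha.1) (hℓ b hb.1) (Finset.mem_inter.2 ⟨ha.2, hb.2⟩)

/-- The finite element description of the continuous piecewise affine functions. -/
def dataS1 (hΩ : IsPolytopalDomain Ω) (hd : 0 < d) (hc : LocallyConnectedUpToBoundary Ω) :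
    M.FEData 1 M.S1 (M.subsimplices 1) M.shapeS1 where
  P := affineLocal d 1
  affine := fun _ hp => hp
  loc := fun i t x => !₂[nodalAffine i t x]
  dof := dofS1
  star_nonempty := fun i hi => M.star_nonempty_of_mem hi
  loc_mem := fun i _ t _ => toOne_mem_affineLocal _
  shape_eq := by
    intro i hi t ht x hx
    have h : ∃ t ∈ M.star i, x ∈ convexHull ℝ (t : Set (E d)) :=
      ⟨t, ht, openHull_subset_convexHull t hx⟩
    have ht' : t = h.choose := M.eq_of_mem_openHull (M.mem_star.1 ht).1 hx
      (M.mem_star.1 h.choose_spec.1).1 h.choose_spec.2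
    rw [shapeS1, dif_pos h, ← ht']
  shape_eq_zero := by
    intro i hi t ht hit x hx
    have h : ¬ ∃ t ∈ M.star i, x ∈ convexHull ℝ (t : Set (E d)) := by
      rintro ⟨s, hs, hxs⟩
      rw [mem_star] at hs
      exact hit (M.eq_of_mem_openHull ht hx hs.1 hxs ▸ hs.2)
    rw [shapeS1, dif_neg h]
    exact E_one_ext (by simp)
  dof_self := by
    intro i hi
    obtain ⟨y, rfl⟩ := M.exists_eq_singleton hi
    refine ⟨1, one_ne_zero, fun t ht => ?_⟩
    rw [mem_star, Finset.singleton_subset_iff] at ht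
    simp [dofS1_singleton, (M.isFullSimplex t ht.1).nodalAffine_apply _ ht.2]
  dof_other := by
    intro i hi j hj hij t ht hit hjt
    obtain ⟨y, rfl⟩ := M.exists_eq_singleton hi
    obtain ⟨z, rfl⟩ := M.exists_eq_singleton hj
    have hzy : z ≠ y := fun h => hij (by rw [h])
    simp [dofS1_singleton, hzy,
      (M.isFullSimplex t ht).nodalAffine_apply _ (Finset.singleton_subset_iff.1 hjt)]
  unisolvent := by
    rintro p ⟨A, rfl⟩ t ht h
    have : A = 0 := (M.isFullSimplex t ht).affine_ext fun y hy => by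
      have h0 := h {y} (M.singleton_mem ht hy) (Finset.singleton_subset_iff.2 hy)
      rw [dofS1_singleton] at h0
      exact E_one_ext h0
    rw [this]
    rfl
  mem_iff := by
    intro v
    constructor
    · rintro ⟨hv, h⟩
      choose! ℓ hℓ using h
      refine ⟨fun t x => !₂[ℓ t x], fun t _ => toOne_mem_affineLocal _, fun t ht => ?_,
        fun i hi s hs t ht => ?_⟩
      · filter_upwards [hℓ t ht] with x hx hxt
        exact E_one_ext (by simpa using hx hxt)
      · obtain ⟨y, rfl⟩ := M.exists_eq_singleton hi
        rw [dofS1_singleton, dofS1_singleton]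
        exact M.affine_eq_at_vertex hΩ hd hc hv hℓ hs ht
    · rintro ⟨p, hpP, hpv, hdof⟩
      choose! A hA using hpP
      have hℓ : ∀ t ∈ M.cells, ∀ᵐ x ∂(volume.restrict Ω),
          x ∈ openHull t → v x 0 = component (A t) 0 x := by
        intro t ht
        filter_upwards [hpv t ht] with x hx hxt
        rw [hx hxt, hA t ht, component_apply]
      have hmem : MemLp v 2 (volume.restrict Ω) :=
        M.memLp_of_piecewise hΩ v.aestronglyMeasurable p
          (fun t ht => by rw [hA t ht]; exact continuous_affineMap _) hpv 2
      refine ⟨M.inH1_of_piecewise hΩ (fun s hs t ht y hys hyt => ?_)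
        ((EuclideanSpace.proj 0 : E 1 →L[ℝ] ℝ).comp_memLp' hmem) hℓ, fun t ht => ⟨_, hℓ t ht⟩⟩
      have h := hdof {y} (M.singleton_mem hs hys)
        s (M.mem_star.2 ⟨hs, Finset.singleton_subset_iff.2 hys⟩)
        t (M.mem_star.2 ⟨ht, Finset.singleton_subset_iff.2 hyt⟩)
      rwa [dofS1_singleton, dofS1_singleton, hA s hs, hA t ht] at h

end SimplicialMesh

end FEMNet
end

/-! ### Assembly of the four cases -/

theorem proposition5p1 :
    ∃ C : ℝ, 0 < C ∧
    ∃ arch : FEKind → ℕ → Multiset ℕ → List (List (ℝ → ℝ)),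
    ∀ d : ℕ, 2 ≤ d →
    ∀ Ω : Set (E d), IsPolytopalDomain Ω →
    ∀ (M : SimplicialMesh Ω) (o : M.Orientation) (k : FEKind),
    (k = .N0 → d ≤ 3) →
    (k = .S1 ∨ (k = .N0 ∧ d = 3) → LocallyConnectedUpToBoundary Ω) →
    -- the shape functions form a basis of the finite element space
    (∃ b : Module.Basis (M.nodes k) ℝ (M.feSpace k),
      ∀ i, ((b i : FunctionClass Ω (k.valueDim d)) : E d → E (k.valueDim d))
        =ᵐ[volume.restrict Ω] M.shape o k i) ∧
    (M.nodes k).card = Module.finrank ℝ (M.feSpace k) ∧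
    C * d ^ 2 * ∑ i ∈ M.nodes k, (M.adj i : ℝ) ≤
      C * d ^ 2 * M.maxAdj k * Module.finrank ℝ (M.feSpace k) ∧
    -- the basis net, and one net for each function of the space
    ∃ (Φ : Network d (M.nodes k × Fin (k.valueDim d)))
      (Ψ : M.feSpace k → Network d (Fin (k.valueDim d))),
      (Φ.IsReLUBiSU ∧
        (∀ᵐ x ∂(volume.restrict Ω), ∀ (i : M.nodes k) (j : Fin (k.valueDim d)),
          Φ.realize x.ofLp (i, j) = M.shape o k i x j) ∧
        Φ.depth = k.netDepth ∧
        (Φ.size : ℝ) ≤ C * d ^ 2 * ∑ i ∈ M.nodes k, (M.adj i : ℝ) ∧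
        Φ.activations = arch k d (M.adjFamily k)) ∧
      (∀ v : M.feSpace k, (Ψ v).IsReLUBiSU ∧
        (∀ᵐ x ∂(volume.restrict Ω),
          WithLp.toLp 2 ((Ψ v).realize x.ofLp) = (v : FunctionClass Ω (k.valueDim d)) x) ∧
        (Ψ v).depth = k.netDepth ∧
        ((Ψ v).size : ℝ) ≤ C * d ^ 2 * ∑ i ∈ M.nodes k, (M.adj i : ℝ) ∧
        (Ψ v).activations = arch k d (M.adjFamily k) ∧
        (Ψ v).hiddenLayers = Φ.hiddenLayers) ∧
      -- the set of these nets is a vector space, and realization is a linear isomorphism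
      ∃ (_ : AddCommGroup (Set.range Ψ)) (_ : Module ℝ (Set.range Ψ)),
        (∀ (v w : M.feSpace k) (c : ℝ),
          (⟨Ψ v, v, rfl⟩ + c • ⟨Ψ w, w, rfl⟩ : Set.range Ψ) = ⟨Ψ (v + c • w), v + c • w, rfl⟩) ∧
        ∃ R : Set.range Ψ ≃ₗ[ℝ] M.feSpace k, ∀ F : Set.range Ψ,
          ∀ᵐ x ∂(volume.restrict Ω),
            ((R F : M.feSpace k) : FunctionClass Ω (k.valueDim d)) x =
              WithLp.toLp 2 ((F : Network d (Fin (k.valueDim d))).realize x.ofLp) := by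
  -- The constant is the one of `deepNet_size` and `shallowNet_size`.
  refine ⟨100, by norm_num, SimplicialMesh.architecture,
    fun d hd Ω hΩ M o k hN0 hconn => ?_⟩
  have hd0 : 0 < d := by omega
  cases k
  case S1 =>
    have D := M.dataS1 hΩ hd0 (hconn (.inl rfl))
    obtain ⟨b, hb⟩ := D.exists_basis hΩ
    obtain ⟨Φ, h1, h2, h3, h4⟩ := D.exists_deepNet hΩ (M.subsimplices_nonempty hΩ (by omega)) hd0
      one_pos hd0
    exact ⟨⟨b, hb⟩, M.exists_nets .S1 _ b hb Φ h1 h2 h3 h4⟩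
  case N0 =>
    obtain rfl | rfl : d = 2 ∨ d = 3 := by have := hN0 rfl; omega
    · have D := M.dataN0Two o hΩ
      obtain ⟨b, hb⟩ := D.exists_basis hΩ
      obtain ⟨Φ, h1, h2, h3, h4⟩ := D.exists_deepNet hΩ
        (M.subsimplices_nonempty hΩ (by omega)) hd0 hd0 le_rfl
      exact ⟨⟨b, hb⟩, M.exists_nets .N0 _ b hb Φ h1 h2 h3 h4⟩
    · have D := M.dataN0Three o hΩ (hconn (.inr ⟨rfl, rfl⟩))
      obtain ⟨b, hb⟩ := D.exists_basis hΩ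
      obtain ⟨Φ, h1, h2, h3, h4⟩ := D.exists_deepNet hΩ
        (M.subsimplices_nonempty hΩ (by omega)) hd0 hd0 le_rfl
      exact ⟨⟨b, hb⟩, M.exists_nets .N0 _ b hb Φ h1 h2 h3 h4⟩
  case RT0 =>
    have D := M.dataRT0 o hΩ hd0
    obtain ⟨b, hb⟩ := D.exists_basis hΩ
    obtain ⟨Φ, h1, h2, h3, h4⟩ := D.exists_deepNet hΩ (M.subsimplices_nonempty hΩ (by omega)) hd0
      hd0 le_rfl
    exact ⟨⟨b, hb⟩, M.exists_nets .RT0 _ b hb Φ h1 h2 h3 h4⟩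
  case S0 =>
    -- The description must stay transparent here, since the shallow network needs to see that the
    -- local pieces are equal to `1`.
    obtain ⟨b, hb⟩ := (M.dataS0 hΩ).exists_basis hΩ
    obtain ⟨Φ, h1, h2, h3, h4⟩ := (M.dataS0 hΩ).exists_shallowNet hΩ
      (M.subsimplices_nonempty hΩ le_rfl) hd0 (fun _ _ _ => by simp [SimplicialMesh.dataS0])
    exact ⟨⟨b, hb⟩, M.exists_nets .S0 _ b hb Φ h1 h2 h3 h4⟩
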